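/- **Setting.** Let $\Gamma$ be an $n$-dimensional Bieberbach group, i.e. a discrete, cocompact, torsion-free subgroup of the isometry group $I(\mathbb R^n)$, and $M_\Gamma=\Gamma\backslash\mathbb R^n$ the corresponding compact flat manifold. Write $\gamma\in\Gamma$ as $\gamma=BL_b$, $\gamma x=B(x+b)$, with $B\in O(n)$, $b\in\mathbb R^n$. Let $\Lambda$ be the lattice of translations in $\Gamma$, $\Lambda^*$ its dual lattice, $T_\Lambda=\Lambda\backslash\mathbb R^n$ the covering torus, and $F=\Lambda\backslash\Gamma$ the (finite) holonomy group. For $B\in O(n)$ let $n_B=\dim\ker(B-\mathrm{Id})$, let $p_B$ be the orthogonal projection of $\mathbb R^n$ onto $\ker(B-\mathrm{Id})$, and ${\Lambda^*}^B=\Lambda^*\cap\ker(B-\mathrm{Id})$, a lattice in $\ker(B-\mathrm{Id})$ with covolume $\mathrm{vol}({\Lambda^*}^B)$. For $\gamma = BL_b$ put $b_+=p_B(b)$. For a finite-dimensional complex representation $\tau$ of $O(n)$ on $V$, let $-\Delta_\tau$ be the connection Laplacian on the vector bundle $\Gamma\backslash E_\tau$ over $M_\Gamma$, where $E_\tau=I(\mathbb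 R^n)\times_{O(n)}V$; that is, $-\Delta_\tau=-\sum_i\partial_i^2$ on the smooth functions $f:\mathbb R^n\to V$ with $f(\gamma x)=\tau(B)f(x)$ for all $\gamma=BL_b\in\Gamma$. Let $d_{\tau,\mu}(\Gamma)$ be the multiplicity of $4\pi^2\mu$ as an eigenvalue of $-\Delta_\tau$, and $\mathrm{Spec}_\tau(M_\Gamma)$ the set of eigenvalues with multiplicities. For $\tau$ trivial this is the spectrum $\mathrm{Spec}(M_\Gamma)$ on functions; for the $p$-exterior representation $\tau_p$, $0\le p\le n$, it is the spectrum $\mathrm{Spec}_p(M_\Gamma)$ on $p$-forms. Two manifolds are $\tau$-isospectral, isospectral, $p$-isospectral if these spectra agree. **Theorem.** (i) All eigenspaces of $-\Delta_\tau$ are finite-dimensional, and for every $s>0$ the series below converge and $$Z_\tau^\Gamma(s):=\sum_{\mu\ge0}d_{\tau,\mu}(\Gamma)\,e^{-4\pi^2\mu s}=|F|^{-1}\sum_{BL_b\in F}\mathrm{tr}\,\tau(B)\;\mathrm{vol}({\Lambda^*}^B)^{-1}\,(4\pi s)^{-n_B/2}\sum_{\lambda_+\in p_B(\Lambda)}e^{-\|\lambda_++b_+\|^2/4s},$$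 where $BL_b$ runs through any system of representatives of $F$. (ii) $\mathrm{Spec}(M_\Gamma)$ determines the set of lengths of closed geodesics of $M_\Gamma$ and the numbers $n_B$: if $M_\Gamma$ and $M_{\Gamma'}$ (of possibly different dimensions) are isospectral, then they have the same set of lengths of closed geodesics and, for every $d$, $F$ and $F'$ have the same number of elements $BL_b$ with $n_B=d$. (iii) For $\tau\ne0$, $\mathrm{Spec}_\tau(M_\Gamma)$ determines the spectrum of $T_\Lambda$ and the cardinality of $F$: if $M_\Gamma$ and $M_{\Gamma'}$ are $\tau$-isospectral, then the tori $T_\Lambda$ and $T_{\Lambda'}$ are isospectral (on functions) and $|F|=|F'|$. In particular the same holds if $M_\Gamma$ and $M_{\Gamma'}$ are $p$-isospectral for some $p$ with $0\le p\le\dim M_\Gamma,\dim M_{\Gamma'}$. -/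

import Mathlib

open scoped RealInnerProductSpace ContDiff

noncomputable section

namespace FlatManifold

/-- Euclidean space `ℝⁿ`. -/
abbrev E (n : ℕ) := EuclideanSpace ℝ (Fin n)

/-- The isometry group `I(ℝⁿ)` (isometries of `ℝⁿ` are affine). -/
abbrev Isom (n : ℕ) := E n ≃ᵃⁱ[ℝ] E n

/-- The orthogonal group `O(n)`. -/
abbrev O (n : ℕ) := E n ≃ₗᵢ[ℝ] E n

/-- The linear part `B` of an isometry `γ = B L_b`, i.e. `γ x = B (x + b)`, as a homomorphism
`I(ℝⁿ) → O(n)`. -/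
def linearPart (n : ℕ) : Isom n →* O n where
  toFun γ := γ.linearIsometryEquiv
  map_one' := rfl
  map_mul' _ _ := rfl

/-- The vector `b` of an isometry `γ = B L_b`, i.e. `γ x = B (x + b)`. -/
def transPart {n : ℕ} (γ : Isom n) : E n := (linearPart n γ).symm (γ 0)

theorem apply_eq {n : ℕ} (γ : Isom n) (x : E n) : γ x = linearPart n γ (x + transPart γ) := by
  have h := γ.map_vadd 0 x
  simp only [vadd_eq_add, add_zero] at h
  rw [map_add, transPart, LinearIsometryEquiv.apply_symm_apply, h]
  rfl

/-- A Bieberbach group: a discrete, cocompact, torsion-free subgroup of `I(ℝⁿ)`.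
The topology of `I(ℝⁿ)` is that of uniform convergence on compact sets (for affine maps: on the
closed unit ball), and a subgroup is discrete if and only if its neutral element is isolated. -/
structure IsBieberbach {n : ℕ} (Γ : Subgroup (Isom n)) : Prop where
  discrete : ∃ ε > 0, ∀ γ ∈ Γ, (∀ x : E n, ‖x‖ ≤ 1 → ‖γ x - x‖ < ε) → γ = 1
  cocompact : ∃ K : Set (E n), IsCompact K ∧ ∀ x : E n, ∃ γ ∈ Γ, γ x ∈ K
  torsionFree : ∀ γ ∈ Γ, IsOfFinOrder γ → γ = 1

section Group

variable {n : ℕ} (Γ : Subgroup (Isom n))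

/-- The homomorphism `Γ → O(n)`, `B L_b ↦ B`. -/
def holonomyHom : Γ →* O n := (linearPart n).comp Γ.subtype

/-- The holonomy group `F = Λ\Γ`: the quotient of `Γ` by its normal subgroup of translations. -/
abbrev Holonomy := Γ ⧸ (holonomyHom Γ).ker

/-- The element `B ∈ O(n)` determined by the class of `B L_b` in `F`. -/
def holonomyLin : Holonomy Γ →* O n := QuotientGroup.kerLift (holonomyHom Γ)

/-- The subgroup `L_Λ` of translations of `Γ`, as a subgroup of `I(ℝⁿ)`; the torus
`T_Λ = Λ\ℝⁿ` is the quotient of `ℝⁿ` by it. -/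
def translationGroup : Subgroup (Isom n) := Γ ⊓ (linearPart n).ker

/-- The translation lattice `Λ = {v | L_v ∈ Γ}`. -/
def lattice : Submodule ℤ (E n) :=
  AddSubgroup.toIntSubmodule
    { carrier := {v | AffineIsometryEquiv.constVAdd ℝ (E n) v ∈ Γ}
      zero_mem' := by
        simp only [Set.mem_ofPred_eq, AffineIsometryEquiv.constVAdd_zero]
        exact Γ.one_mem
      add_mem' := by
        intro a b ha hb
        have h := Γ.mul_mem ha hb
        have e : AffineIsometryEquiv.constVAdd ℝ (E n) a *
            AffineIsometryEquiv.constVAdd ℝ (E n) b =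
            AffineIsometryEquiv.constVAdd ℝ (E n) (a + b) := by
          ext1 x
          simp [add_assoc]
        rwa [e] at h
      neg_mem' := by
        intro a ha
        have h := Γ.inv_mem ha
        have e : (AffineIsometryEquiv.constVAdd ℝ (E n) a)⁻¹ =
            AffineIsometryEquiv.constVAdd ℝ (E n) (-a) := by
          rw [inv_eq_iff_mul_eq_one]
          ext1 x
          simp
        rwa [e] at h }

/-- The lengths of the closed geodesics of `M_Γ = Γ\ℝⁿ`. A geodesic of `M_Γ` is the image of
`t ↦ x + t v`; it is closed with period `1` when `x + t v` and `x + (t + 1) v` have the same image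
for every `t`, and its length is then `‖v‖`. (Constant geodesics, of length `0`, are allowed.) -/
def geodesicLengths : Set ℝ :=
  {l | ∃ x v : E n, (∀ t : ℝ, ∃ γ ∈ Γ, γ (x + t • v) = x + (t + 1) • v) ∧ ‖v‖ = l}

end Group

section Fixed

variable {n : ℕ}

/-- The dual lattice `L*` of `L`. -/
def dualLattice (L : Submodule ℤ (E n)) : Submodule ℤ (E n) :=
  AddSubgroup.toIntSubmodule
    { carrier := {v | ∀ l ∈ L, ∃ k : ℤ, ⟪v, l⟫ = (k : ℝ)}
      zero_mem' := fun l _ => ⟨0, by simp⟩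
      add_mem' := by
        intro a b ha hb l hl
        obtain ⟨j, hj⟩ := ha l hl
        obtain ⟨k, hk⟩ := hb l hl
        exact ⟨j + k, by rw [inner_add_left, hj, hk]; push_cast; rfl⟩
      neg_mem' := by
        intro a ha l hl
        obtain ⟨j, hj⟩ := ha l hl
        exact ⟨-j, by rw [inner_neg_left, hj]; push_cast; rfl⟩ }

/-- The fixed space `ker (B - Id)`. -/
def fixedSpace (B : O n) : Submodule ℝ (E n) :=
  LinearMap.ker ((B.toLinearEquiv : E n →ₗ[ℝ] E n) - LinearMap.id)

/-- The number `n_B = dim ker (B - Id)`. -/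
def fixedDim (B : O n) : ℕ := Module.finrank ℝ (fixedSpace B)

/-- The orthogonal projection `p_B` of `ℝⁿ` onto `ker (B - Id)`. -/
def fixedProj (B : O n) : E n →L[ℝ] E n := (fixedSpace B).starProjection

/-- `L^B = L ∩ ker (B - Id)`, as a subgroup of `ker (B - Id)`. -/
def fixedLattice (L : Submodule ℤ (E n)) (B : O n) : Submodule ℤ (fixedSpace B) :=
  L.comap ((fixedSpace B).subtype.restrictScalars ℤ)

/-- The volume `vol (L)` of a lattice `L` in a subspace `W` of `ℝⁿ`, with respect to the Lebesgue
measure of the Euclidean space `W` (unit cubes have measure `1`). -/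
def latticeVol {W : Submodule ℝ (E n)} (L : Submodule ℤ W) : ℝ :=
  ZLattice.covolume L (stdOrthonormalBasis ℝ W).toBasis.addHaar

end Fixed

section Spectrum

variable {n : ℕ} {V : Type*} [NormedAddCommGroup V] [NormedSpace ℂ V]

/-- The eigenspace, for the eigenvalue `a`, of the connection Laplacian `-Δ_τ` on the smooth
sections of the bundle `Γ\E_τ` over `M_Γ`. Here `E_τ = I(ℝⁿ) ×_{O(n)} V` is trivialized by the
parallel sections `x ↦ [L_x, v]`; the connection then becomes the flat one, `Δ_τ` acts on
`V`-valued functions as the Euclidean Laplacian, `γ = B L_b` acts by `[L_x, v] ↦ [L_{γ x}, τ(B) v]`,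
and the sections over `M_Γ` are the functions with `f (γ x) = τ(B) f(x)` for `γ = B L_b ∈ Γ`. -/
def eigenspace (τ : Representation ℂ (O n) V) (Γ : Subgroup (Isom n)) (a : ℝ) :
    Submodule ℂ (E n → V) where
  carrier := {f | ContDiff ℝ ∞ f ∧
    (∀ γ ∈ Γ, ∀ x, f (γ x) = τ (linearPart n γ) (f x)) ∧
    ∀ x, -(Laplacian.laplacian f x) = (a : ℂ) • f x}
  zero_mem' := by
    refine ⟨contDiff_const, fun γ _ x => by simp, fun x => ?_⟩
    have h : Laplacian.laplacian (fun _ : E n => (0 : V)) = 0 :=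
      InnerProductSpace.laplacian_const
    have h' := congrFun h x
    simp only [Pi.zero_apply, smul_zero, neg_eq_zero] at h' ⊢
    exact h'
  add_mem' := by
    rintro f g ⟨hf, hf', hf''⟩ ⟨hg, hg', hg''⟩
    refine ⟨hf.add hg, fun γ hγ x => by simp [hf' γ hγ x, hg' γ hγ x], fun x => ?_⟩
    have h2 : (2 : WithTop ℕ∞) ≤ ∞ := WithTop.coe_le_coe.2 (le_top : (2 : ℕ∞) ≤ ⊤)
    rw [(hf.contDiffAt.of_le h2).laplacian_add (hg.contDiffAt.of_le h2), neg_add, hf'', hg'',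
      Pi.add_apply, smul_add]
  smul_mem' := by
    rintro c f ⟨hf, hf', hf''⟩
    refine ⟨hf.const_smul c, fun γ hγ x => by simp [hf' γ hγ x], fun x => ?_⟩
    have h2 : (2 : WithTop ℕ∞) ≤ ∞ := WithTop.coe_le_coe.2 (le_top : (2 : ℕ∞) ≤ ⊤)
    have key : Laplacian.laplacian (c • f) x = c • Laplacian.laplacian f x := by
      have h := (hf.contDiffAt.of_le h2).laplacian_CLM_comp_left (x := x)
        (l := (c • ContinuousLinearMap.id ℂ V).restrictScalars ℝ)
      exact h
    rw [key, ← smul_neg, hf'', Pi.smul_apply, smul_comm]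

/-- The multiplicity of `a` as an eigenvalue of `-Δ_τ` (`0` if `a` is not an eigenvalue). -/
def mult (τ : Representation ℂ (O n) V) (Γ : Subgroup (Isom n)) (a : ℝ) : ℕ :=
  Module.finrank ℂ (eigenspace τ Γ a)

/-- `d_{τ,μ}(Γ)`, the multiplicity of the eigenvalue `4π²μ` of `-Δ_τ`. -/
def dmult (τ : Representation ℂ (O n) V) (Γ : Subgroup (Isom n)) (μ : ℝ) : ℕ :=
  mult τ Γ (4 * Real.pi ^ 2 * μ)

end Spectrum

/-- `τ`-isospectrality of `M_Γ` and `M_Γ'`: the same eigenvalues with the same multiplicities for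
the connection Laplacians. -/
def TauIsospectral {n : ℕ} {V : Type*} [NormedAddCommGroup V] [NormedSpace ℂ V]
    (τ : Representation ℂ (O n) V) (Γ Γ' : Subgroup (Isom n)) : Prop :=
  ∀ a : ℝ, mult τ Γ a = mult τ Γ' a

/-- The trivial representation of `O(n)`, whose bundle has the functions as sections. -/
abbrev trivRep (n : ℕ) : Representation ℂ (O n) ℂ := Representation.trivial ℂ (O n) ℂ

/-- The `p`-exterior representation `τ_p`: `O(n)` acts on complex-valued alternating `p`-forms on
`ℝⁿ` by `(B ω)(v₁, …, v_p) = ω(B⁻¹ v₁, …, B⁻¹ v_p)`. The sections of its bundle over `M_Γ` are the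
differential `p`-forms of `M_Γ`. -/
def extRep (n p : ℕ) : Representation ℂ (O n) (E n [⋀^Fin p]→L[ℝ] ℂ) where
  toFun B :=
    { toFun := fun η =>
        η.compContinuousLinearMap ((B⁻¹ : O n).toContinuousLinearEquiv : E n →L[ℝ] E n)
      map_add' := fun _ _ => rfl
      map_smul' := fun _ _ => rfl }
  map_one' := by
    ext η v
    rfl
  map_mul' B C := by
    ext η v
    simp only [mul_inv_rev]
    rfl

/-- Isospectrality on functions (the dimensions need not be assumed to agree). -/
def Isospectral {n m : ℕ} (Γ : Subgroup (Isom n)) (Γ' : Subgroup (Isom m)) : Prop :=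
  ∀ a : ℝ, mult (trivRep n) Γ a = mult (trivRep m) Γ' a

/-- Isospectrality on `p`-forms (the dimensions need not be assumed to agree). -/
def PIsospectral (p : ℕ) {n m : ℕ} (Γ : Subgroup (Isom n)) (Γ' : Subgroup (Isom m)) : Prop :=
  ∀ a : ℝ, mult (extRep n p) Γ a = mult (extRep m p) Γ' a

/-- The inner sum `∑_{λ₊ ∈ p_B(Λ)} exp (-‖λ₊ + b₊‖² / 4s)` attached to `γ = B L_b`, termwise. -/
def heatTerm {n : ℕ} (Γ : Subgroup (Isom n)) (γ : Isom n) (s : ℝ)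
    (v : (fixedProj (linearPart n γ) '' (lattice Γ : Set (E n)) : Set (E n))) : ℝ :=
  Real.exp (-(‖(v : E n) + fixedProj (linearPart n γ) (transPart γ)‖ ^ 2) / (4 * s))

end FlatManifold

end

/-!
The real content is the heat trace formula, from which the other claims follow by reading off the
terms of an asymptotic expansion.

**The translation lattice.** The linear parts of `Γ` form a finite group, and the translations in `Γ`
form a lattice `Λ` of full rank (Bieberbach's first theorem). The proof is Buser's: an element whose
linear part is close to the identity is a translation (`IsBieberbach.linearPart_eq_one_of_near`).
Otherwise let `α = A L_a` be a counterexample which moves the origin least, and consider the elements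
of `Γ` which have linear part close to the identity and move the origin nearly in a direction in which
`A - Id` has its full norm; commutation with `α` maps this set to itself and shortens the
translation vectors, which contradicts discreteness. Compactness of `O(n)` then gives
`IsBieberbach.finite_holonomy`, and cocompactness gives `IsBieberbach.span_lattice`.

**The heat trace.** By Fourier expansion on the torus `Λ\ℝⁿ`, the `Λ`-periodic eigenfunctions for the
eigenvalue `a` are the trigonometric polynomials with frequencies `v ∈ Λ*`, `4π²‖v‖² = a`
(`eigenfunction_eq_sum`). So the eigenspace consists of the invariants of the finite group `F` in a
finite-dimensional space. The dimension of the invariants is the average of the traces, and `B L_b`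
permutes the frequencies up to scalars, so that only the frequencies fixed by `B` contribute to its
trace (`mult_eq_sum`). The sum over these frequencies, which form the dual of the lattice `p_B(Λ)` in
`ker (B - Id)`, is transformed by Poisson summation for Gaussians (`hasSum_poisson`), giving
`IsBieberbach.hasSum_heatTrace`.

**What the spectrum determines.** With `s = (4πu²)⁻¹` the heat trace becomes a series
`∑ cₓ u^{dₓ} exp (-rₓ u²)`, whose coefficients, grouped by `(dₓ, rₓ)`, are determined by its values for
large `u` (`tsum_coeff_mul_eq`): compare the terms with the smallest exponent `r`, which are a
polynomial in `u` up to the factor `exp (-r u²)`. Hence the spectrum determines, for each `k`, the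
contribution of the classes with `n_B = k` (`sum_heatCoef_eq`).
* On functions, all coefficients are positive, so the spectrum determines the set of the numbers
  `‖λ₊ + b₊‖`. These are the lengths of the closed geodesics: `γ = B L_b` translates some line in the
  direction `b₊` by `‖b₊‖` (`IsBieberbach.mem_geodesicLengths`).
* Poisson summation in the other direction shows that for `s → ∞` the contribution of each class
  tends to `|F|⁻¹ tr τ(B)` (`IsBieberbach.tendsto_heatPart`), so the spectrum determines
  `|F|⁻¹ ∑ tr τ(B)` over the classes with `n_B = k`. The only class with `n_B = n` is the trivial one.
  This gives first the dimension and `|F|`, and then, for functions, the number of classes with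
  `n_B = k`.
* The contribution of the trivial class is `|F|⁻¹ dim V` times the heat trace of the torus `T_Λ`. So
  the `τ`-spectrum determines the latter, and with it the spectrum of `T_Λ`.
-/

open scoped RealInnerProductSpace ContDiff

noncomputable section

namespace FlatManifold

open MeasureTheory Module Filter Topology

/-! ### Bieberbach's first theorem -/

/-- A family which maps to a bounded subset of a proper space and is uniformly separated there is
finite. -/
theorem finite_of_separated {X Y : Type*} [PseudoMetricSpace Y] [ProperSpace Y] {S : Set X}
    (f : X → Y) (hb : Bornology.IsBounded (f '' S)) {δ : ℝ} (hδ : 0 < δ)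
    (h : ∀ x ∈ S, ∀ y ∈ S, dist (f x) (f y) < δ → x = y) : S.Finite := by
  by_contra hS
  have hS : S.Infinite := hS
  let u := hS.natEmbedding S
  obtain ⟨a, -, φ, hφ, hlim⟩ := tendsto_subseq_of_bounded hb
    (x := fun k => f (u k)) (fun k => ⟨u k, (u k).2, rfl⟩)
  have hc := hlim.cauchySeq
  obtain ⟨N, hN⟩ := Metric.cauchySeq_iff.1 hc δ hδ
  have h1 := h _ (u (φ N)).2 _ (u (φ (N + 1))).2 (hN N le_rfl (N + 1) (Nat.le_succ N))
  have h2 := hφ.injective (u.injective (Subtype.ext h1))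
  omega

/-- The linear part of an isometry as a continuous linear map. -/
def linCLM {n : ℕ} (γ : Isom n) : E n →L[ℝ] E n :=
  ((linearPart n γ).toContinuousLinearEquiv : E n →L[ℝ] E n)

section Basics

variable {n : ℕ}

@[simp] theorem linCLM_apply (γ : Isom n) (x : E n) : linCLM γ x = linearPart n γ x := rfl

theorem apply_eq_add (γ : Isom n) (x : E n) : γ x = linearPart n γ x + γ 0 := by
  have h := γ.map_vadd 0 x
  simp only [vadd_eq_add, add_zero] at h
  exact h

theorem apply_sub_apply (γ : Isom n) (x y : E n) : γ x - γ y = linearPart n γ (x - y) := by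
  rw [apply_eq_add γ x, apply_eq_add γ y, map_sub]; abel

theorem norm_inv_apply_zero (γ : Isom n) : ‖γ⁻¹ 0‖ = ‖γ 0‖ := by
  have h : γ (γ⁻¹ 0) = 0 := γ.apply_symm_apply 0
  have h1 := apply_sub_apply γ (γ⁻¹ 0) 0
  rw [h, zero_sub, sub_zero] at h1
  have h2 := congrArg norm h1
  rw [norm_neg, LinearIsometryEquiv.norm_map] at h2
  exact h2.symm

theorem norm_linCLM_le (γ : Isom n) : ‖linCLM γ‖ ≤ 1 :=
  ContinuousLinearMap.opNorm_le_bound _ zero_le_one fun x => by simp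

theorem linearPart_inv_apply (γ : Isom n) (x : E n) :
    linearPart n γ⁻¹ x = (linearPart n γ).symm x := by
  rw [map_inv]; rfl

/-- Rotation parts at distance `η` differ by an isometry with rotation part `η`-close to `1`. -/
theorem norm_linearPart_mul_inv_sub_le (γ γ' : Isom n) (x : E n) :
    ‖linearPart n (γ * γ'⁻¹) x - x‖ ≤ ‖linCLM γ - linCLM γ'‖ * ‖x‖ := by
  have h : linearPart n (γ * γ'⁻¹) x - x =
      (linCLM γ - linCLM γ') ((linearPart n γ').symm x) := by
    rw [map_mul]
    change linearPart n γ (linearPart n γ'⁻¹ x) - x = _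
    rw [linearPart_inv_apply]
    simp
  rw [h]
  refine (ContinuousLinearMap.le_opNorm _ _).trans ?_
  simp

theorem eq_constVAdd_of_linearPart_eq_one {γ : Isom n} (h : linearPart n γ = 1) :
    γ = AffineIsometryEquiv.constVAdd ℝ (E n) (γ 0) := by
  ext1 x
  rw [apply_eq_add γ x, h]
  simp [add_comm]

@[simp] theorem linearPart_constVAdd (v : E n) :
    linearPart n (AffineIsometryEquiv.constVAdd ℝ (E n) v) = 1 := by
  ext1 x
  have h := apply_eq_add (AffineIsometryEquiv.constVAdd ℝ (E n) v) x
  simp only [AffineIsometryEquiv.coe_constVAdd, vadd_eq_add, add_zero] at h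
  rw [add_comm] at h
  exact (add_right_cancel h).symm

theorem mem_lattice {Γ : Subgroup (Isom n)} {v : E n} :
    v ∈ lattice Γ ↔ AffineIsometryEquiv.constVAdd ℝ (E n) v ∈ Γ := Iff.rfl

theorem apply_zero_mem_lattice {Γ : Subgroup (Isom n)} {γ : Isom n} (hγ : γ ∈ Γ)
    (h : linearPart n γ = 1) : γ 0 ∈ lattice Γ := by
  rw [mem_lattice, ← eq_constVAdd_of_linearPart_eq_one h]; exact hγ

end Basics

section Gap

variable {n : ℕ}

/-- A linear map of a finite-dimensional space attains its norm on the unit sphere of a nonzero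
subspace. -/
theorem exists_norm_bound_attained (T : E n →L[ℝ] E n) (U : Submodule ℝ (E n)) (hU : U ≠ ⊥) :
    ∃ x ∈ U, x ≠ 0 ∧ ∃ c : ℝ, 0 ≤ c ∧ ‖T x‖ = c * ‖x‖ ∧ ∀ y ∈ U, ‖T y‖ ≤ c * ‖y‖ := by
  obtain ⟨z, hzU, hz⟩ := U.exists_mem_ne_zero_of_ne_bot hU
  have hz' : ‖z‖ ≠ 0 := norm_ne_zero_iff.2 hz
  have hK : IsCompact (Metric.sphere (0 : E n) 1 ∩ (U : Set (E n))) :=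
    (isCompact_sphere 0 1).inter_right U.closed_of_finiteDimensional
  have hne : (Metric.sphere (0 : E n) 1 ∩ (U : Set (E n))).Nonempty := by
    refine ⟨‖z‖⁻¹ • z, ?_, U.smul_mem _ hzU⟩
    simp [norm_smul, hz']
  obtain ⟨x, ⟨hx1, hxU⟩, hmax⟩ := hK.exists_isMaxOn hne (T.continuous.norm.continuousOn)
  have hx1 : ‖x‖ = 1 := by simpa using hx1
  refine ⟨x, hxU, ?_, ‖T x‖, norm_nonneg _, by rw [hx1, mul_one], fun y hy => ?_⟩
  · rintro rfl; simp at hx1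
  · by_cases hy0 : y = 0
    · simp [hy0]
    have hy' : ‖y‖ ≠ 0 := norm_ne_zero_iff.2 hy0
    have h := hmax (a := ‖y‖⁻¹ • y) ⟨by simp [norm_smul, hy'], U.smul_mem _ hy⟩
    simp only [Set.mem_ofPred_eq, map_smul, norm_smul, norm_inv, norm_norm] at h
    rw [inv_mul_le_iff₀ (by positivity)] at h
    linarith

/-- For a nonzero normal map `T` the vectors on which `T` attains its norm form a nonzero subspace
`U`, which reduces `T`, and on the complement of which `T` has a strictly smaller norm. -/
theorem exists_top_subspace (T : E n →L[ℝ] E n)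
    (hT : T * ContinuousLinearMap.adjoint T = ContinuousLinearMap.adjoint T * T) (hT0 : T ≠ 0) :
    ∃ (U : Submodule ℝ (E n)) (m m' : ℝ), U ≠ ⊥ ∧ 0 < m ∧ 0 ≤ m' ∧ m' < m ∧
      (∀ x, ‖T x‖ ≤ m * ‖x‖) ∧ (∀ x ∈ U, ‖T x‖ = m * ‖x‖) ∧ (∀ x ∈ Uᗮ, ‖T x‖ ≤ m' * ‖x‖) ∧
      (∀ x ∈ U, T x ∈ U) ∧ (∀ x ∈ Uᗮ, T x ∈ Uᗮ) := by
  set T' := ContinuousLinearMap.adjoint T with hT'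
  have hcomm : ∀ x, T (T' x) = T' (T x) := fun x => DFunLike.congr_fun hT x
  have htop : (⊤ : Submodule ℝ (E n)) ≠ ⊥ := by
    intro h
    apply hT0
    ext1 x
    have hx : x ∈ (⊤ : Submodule ℝ (E n)) := trivial
    rw [h, Submodule.mem_bot] at hx
    simp [hx]
  obtain ⟨x₀, -, hx₀, m, hm, hxm, hle⟩ := exists_norm_bound_attained T ⊤ htop
  have hle : ∀ x, ‖T x‖ ≤ m * ‖x‖ := fun x => hle x trivial
  have hin : ∀ x y, ⟪T' x, y⟫ = ⟪x, T y⟫ := fun x y => ContinuousLinearMap.adjoint_inner_left T y x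
  have hnorm' : ∀ x, ‖T' x‖ ≤ m * ‖x‖ := by
    intro x
    have h1 : ‖T' x‖ ^ 2 = ⟪x, T (T' x)⟫ := by rw [← real_inner_self_eq_norm_sq, hin]
    have h2 : ⟪x, T (T' x)⟫ ≤ ‖x‖ * (m * ‖T' x‖) :=
      (real_inner_le_norm _ _).trans (mul_le_mul_of_nonneg_left (hle _) (norm_nonneg _))
    by_contra! hlt
    have h3 : 0 < ‖T' x‖ := lt_of_le_of_lt (by positivity) hlt
    nlinarith
  have hmpos : 0 < m := by
    rcases hm.eq_or_lt with h | h
    · exfalso; apply hT0; ext1 x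
      have := hle x
      rw [← h, zero_mul] at this
      simpa using norm_le_zero_iff.1 this
    · exact h
  let U : Submodule ℝ (E n) := LinearMap.ker ((T' * T - (m ^ 2) • (1 : E n →L[ℝ] E n)) :
    E n →L[ℝ] E n).toLinearMap
  have hmemU : ∀ x, x ∈ U ↔ T' (T x) = m ^ 2 • x := by
    intro x
    simp only [U, LinearMap.mem_ker]
    exact sub_eq_zero
  have hU1 : ∀ x, ‖T x‖ = m * ‖x‖ → x ∈ U := by
    intro x hx
    rw [hmemU, ← sub_eq_zero, ← norm_le_zero_iff]
    have h1 : ‖T' (T x) - m ^ 2 • x‖ ^ 2 =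
        ‖T' (T x)‖ ^ 2 - 2 * (m ^ 2 * ‖T x‖ ^ 2) + m ^ 4 * ‖x‖ ^ 2 := by
      rw [norm_sub_sq_real, inner_smul_right, hin, real_inner_self_eq_norm_sq, norm_smul]
      simp only [norm_pow, Real.norm_eq_abs, sq_abs, mul_pow]
      ring
    have h2 : ‖T' (T x)‖ ≤ m * (m * ‖x‖) := by rw [← hx]; exact hnorm' _
    have h3 : ‖T' (T x)‖ ^ 2 ≤ (m * (m * ‖x‖)) ^ 2 := by gcongr
    have h4 : ‖T' (T x) - m ^ 2 • x‖ ^ 2 ≤ 0 := by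
      rw [h1, hx]; nlinarith
    nlinarith [norm_nonneg (T' (T x) - m ^ 2 • x)]
  have hU2 : ∀ x ∈ U, ‖T x‖ = m * ‖x‖ := by
    intro x hx
    rw [hmemU] at hx
    have h1 : ‖T x‖ ^ 2 = (m * ‖x‖) ^ 2 := by
      rw [← real_inner_self_eq_norm_sq, ← hin, hx, inner_smul_left, real_inner_self_eq_norm_sq]
      simp; ring
    exact (sq_eq_sq₀ (norm_nonneg _) (by positivity)).1 h1
  have hU : U ≠ ⊥ := by
    intro h
    have := hU1 x₀ hxm
    rw [h, Submodule.mem_bot] at this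
    exact hx₀ this
  have hTU : ∀ x ∈ U, T x ∈ U := by
    intro x hx
    rw [hmemU] at hx ⊢
    rw [← hcomm, hx, map_smul]
  have hT'U : ∀ x ∈ U, T' x ∈ U := by
    intro x hx
    rw [hmemU] at hx ⊢
    rw [hcomm, hx, map_smul]
  have hTU' : ∀ x ∈ Uᗮ, T x ∈ Uᗮ := by
    intro x hx
    rw [Submodule.mem_orthogonal] at hx ⊢
    intro u hu
    rw [← hin]
    exact hx _ (hT'U u hu)
  by_cases hperp : Uᗮ = ⊥
  · refine ⟨U, m, 0, hU, hmpos, le_rfl, hmpos, hle, hU2, fun x hx => ?_, hTU, hTU'⟩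
    rw [hperp, Submodule.mem_bot] at hx
    simp [hx]
  · obtain ⟨y, hy, hy0, m', hm', hym, hle'⟩ := exists_norm_bound_attained T Uᗮ hperp
    refine ⟨U, m, m', hU, hmpos, hm', ?_, hle, hU2, hle', hTU, hTU'⟩
    have hypos : 0 < ‖y‖ := norm_pos_iff.2 hy0
    refine lt_of_le_of_ne (le_of_mul_le_mul_right (hym ▸ hle y) hypos) ?_
    rintro rfl
    have := (Submodule.orthogonal_disjoint U).le_bot ⟨hU1 y hym, hy⟩
    exact hy0 (by simpa using this)

end Gap

section Bieberbach

variable {n : ℕ} {Γ : Subgroup (Isom n)}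

/-- A discrete group of isometries moves the origin into a given ball only finitely often. -/
theorem IsBieberbach.finite_ball (hΓ : IsBieberbach Γ) (R : ℝ) :
    {γ : Isom n | γ ∈ Γ ∧ ‖γ 0‖ ≤ R}.Finite := by
  obtain ⟨ε, hε, h⟩ := hΓ.discrete
  rcases lt_or_ge R 0 with hR | hR
  · convert Set.finite_empty
    ext γ
    simp only [Set.mem_ofPred_eq, Set.mem_empty_iff_false, iff_false, not_and, not_le]
    exact fun _ => hR.trans_le (norm_nonneg _)
  refine finite_of_separated (fun γ : Isom n => (linCLM γ, γ 0)) ?_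
    (δ := ε / (2 + R)) (by positivity) ?_
  · refine (Metric.isBounded_closedBall (x := ((0, 0) : (E n →L[ℝ] E n) × E n))
      (r := max 1 R)).subset ?_
    rintro _ ⟨γ, hγ, rfl⟩
    rw [Metric.mem_closedBall, Prod.dist_eq, dist_zero_right, dist_zero_right]
    exact max_le_max (norm_linCLM_le γ) hγ.2
  · rintro γ ⟨hγ, hγR⟩ γ' ⟨hγ', hγR'⟩ hd
    rw [Prod.dist_eq, max_lt_iff, dist_eq_norm, dist_eq_norm] at hd
    rw [← mul_inv_eq_one]
    refine h _ (Γ.mul_mem hγ (Γ.inv_mem hγ')) fun x hx => ?_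
    set y := γ'⁻¹ x with hy
    have hyx : γ' y = x := γ'.apply_symm_apply x
    have hyn : ‖y‖ ≤ 1 + R := by
      have := apply_sub_apply γ' y 0
      have h2 := congrArg norm this
      rw [LinearIsometryEquiv.norm_map, sub_zero, hyx] at h2
      rw [← h2]
      exact (norm_sub_le _ _).trans (add_le_add hx hγR')
    have e : (γ * γ'⁻¹) x - x = (linCLM γ - linCLM γ') y + (γ 0 - γ' 0) := by
      change γ y - x = _
      rw [← hyx, apply_eq_add γ y, apply_eq_add γ' y]
      simp; abel
    rw [e]
    calc _ ≤ ‖(linCLM γ - linCLM γ') y‖ + ‖γ 0 - γ' 0‖ := norm_add_le _ _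
      _ ≤ ‖linCLM γ - linCLM γ'‖ * (1 + R) + ‖γ 0 - γ' 0‖ := by
          gcongr
          exact (ContinuousLinearMap.le_opNorm _ _).trans (by gcongr)
      _ < ε / (2 + R) * (1 + R) + ε / (2 + R) := by
          apply add_lt_add_of_le_of_lt _ hd.2
          gcongr
          exact hd.1.le
      _ = ε := by field_simp; ring

/-- Among the elements of a discrete group with a given property there is one which moves the
origin least. -/
theorem IsBieberbach.exists_minimal (hΓ : IsBieberbach Γ) (P : Isom n → Prop)
    (hP : ∃ γ ∈ Γ, P γ) : ∃ γ ∈ Γ, P γ ∧ ∀ γ' ∈ Γ, P γ' → ‖γ 0‖ ≤ ‖γ' 0‖ := by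
  obtain ⟨γ₀, hγ₀, hP₀⟩ := hP
  have hfin : {γ | (γ ∈ Γ ∧ ‖γ 0‖ ≤ ‖γ₀ 0‖) ∧ P γ}.Finite :=
    (hΓ.finite_ball ‖γ₀ 0‖).subset fun γ h => h.1
  obtain ⟨γ, ⟨⟨hγ, hγ'⟩, hPγ⟩, hmin⟩ := Set.exists_min_image _ (fun γ : Isom n => ‖γ 0‖) hfin
    ⟨γ₀, ⟨hγ₀, le_rfl⟩, hP₀⟩
  refine ⟨γ, hγ, hPγ, fun γ' h h' => ?_⟩
  by_cases hle : ‖γ' 0‖ ≤ ‖γ₀ 0‖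
  · exact hmin γ' ⟨⟨h, hle⟩, h'⟩
  · exact hγ'.trans (le_of_not_ge hle)

theorem IsBieberbach.exists_orbit_near (hΓ : IsBieberbach Γ) :
    ∃ R : ℝ, 0 ≤ R ∧ ∀ x : E n, ∃ γ ∈ Γ, ‖γ x‖ ≤ R := by
  obtain ⟨K, hK, h⟩ := hΓ.cocompact
  obtain ⟨R, hR⟩ := hK.isBounded.exists_norm_le
  refine ⟨max R 0, le_max_right _ _, fun x => ?_⟩
  obtain ⟨γ, hγ, hx⟩ := h x
  exact ⟨γ, hγ, (hR _ hx).trans (le_max_left _ _)⟩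

/-- A cocompact group contains elements with arbitrarily small rotation part which move the origin
in a direction arbitrarily close to a given one. -/
theorem IsBieberbach.exists_near_direction (hΓ : IsBieberbach Γ) (u : E n) {ε : ℝ}
    (hε : 0 < ε) : ∃ γ ∈ Γ, (∀ x, ‖linearPart n γ x - x‖ ≤ ε * ‖x‖) ∧
      ∃ t : ℝ, 0 < t ∧ ‖γ 0 - t • u‖ ≤ ε * t := by
  obtain ⟨R, hR0, hR⟩ := hΓ.exists_orbit_near
  have hex : ∀ k : ℕ, ∃ γ ∈ Γ, ‖γ 0 - (k : ℝ) • u‖ ≤ R := by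
    intro k
    obtain ⟨γ, hγ, h⟩ := hR ((k : ℝ) • u)
    refine ⟨γ⁻¹, Γ.inv_mem hγ, ?_⟩
    have e := apply_sub_apply γ (γ⁻¹ 0) ((k : ℝ) • u)
    have h0 : γ (γ⁻¹ 0) = 0 := γ.apply_symm_apply 0
    rw [h0, zero_sub] at e
    have := congrArg norm e
    rw [norm_neg, LinearIsometryEquiv.norm_map] at this
    rw [← this]; exact h
  choose g hg hgR using hex
  obtain ⟨a, -, φ, hφ, hlim⟩ := tendsto_subseq_of_bounded
    (Metric.isBounded_closedBall (x := (0 : E n →L[ℝ] E n)) (r := 1))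
    (x := fun k => linCLM (g k)) (fun k => by simpa using norm_linCLM_le (g k))
  obtain ⟨N, hN⟩ := Metric.cauchySeq_iff.1 hlim.cauchySeq ε hε
  obtain ⟨M, hM⟩ := exists_nat_gt (max 0 ((‖g (φ N) 0‖ + R) / ε))
  set j := max M N with hj
  have hjM : (M : ℝ) ≤ φ j := by
    exact_mod_cast (le_max_left M N).trans (hφ.id_le j)
  have hjpos : (0 : ℝ) < φ j := (le_max_left _ _).trans_lt (hM.trans_le hjM)
  refine ⟨g (φ j) * (g (φ N))⁻¹, Γ.mul_mem (hg _) (Γ.inv_mem (hg _)), fun x => ?_, φ j, hjpos, ?_⟩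
  · refine (norm_linearPart_mul_inv_sub_le _ _ _).trans ?_
    gcongr
    have := hN j (le_max_right _ _) N le_rfl
    rw [dist_eq_norm] at this
    exact this.le
  · have e : (g (φ j) * (g (φ N))⁻¹) 0 - (φ j : ℝ) • u =
        linearPart n (g (φ j)) ((g (φ N))⁻¹ 0) + (g (φ j) 0 - (φ j : ℝ) • u) := by
      change g (φ j) ((g (φ N))⁻¹ 0) - _ = _
      rw [apply_eq_add (g (φ j)) ((g (φ N))⁻¹ 0)]; abel
    rw [e]
    refine (norm_add_le _ _).trans ?_
    rw [LinearIsometryEquiv.norm_map, norm_inv_apply_zero]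
    have h1 : (‖g (φ N) 0‖ + R) / ε < φ j := (le_max_right _ _).trans_lt (hM.trans_le hjM)
    rw [div_lt_iff₀ hε] at h1
    linarith [hgR (φ j)]

/-- The rotation part of the commutator of two isometries whose rotation parts are close to `1`. -/
theorem norm_linearPart_commutator_sub_le {α β : Isom n} {m η : ℝ} (hm : 0 ≤ m) (hη : 0 ≤ η)
    (hα : ∀ x, ‖linearPart n α x - x‖ ≤ m * ‖x‖) (hβ : ∀ x, ‖linearPart n β x - x‖ ≤ η * ‖x‖)
    (x : E n) : ‖linearPart n (α * β * α⁻¹ * β⁻¹) x - x‖ ≤ 2 * m * η * ‖x‖ := by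
  set A := linearPart n α
  set B := linearPart n β
  set y := A.symm (B.symm x) with hy
  have hx : x = B (A y) := by simp [hy]
  have hyn : ‖y‖ = ‖x‖ := by simp [hy]
  have e : linearPart n (α * β * α⁻¹ * β⁻¹) x = A (B y) := by
    simp only [map_mul, map_inv]; rfl
  rw [e]
  have e2 : A (B y) - x = (A (B y - y) - (B y - y)) - (B (A y - y) - (A y - y)) := by
    rw [hx]; simp only [map_sub]; abel
  rw [e2, ← hyn]
  calc _ ≤ ‖A (B y - y) - (B y - y)‖ + ‖B (A y - y) - (A y - y)‖ := norm_sub_le _ _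
    _ ≤ m * (η * ‖y‖) + η * (m * ‖y‖) := by
      refine add_le_add ((hα _).trans ?_) ((hβ _).trans ?_)
      · gcongr; exact hβ y
      · gcongr; exact hα y
    _ = _ := by ring

/-- The translation part of a commutator, up to an error governed by the rotation parts. -/
theorem norm_commutator_apply_zero_sub_le {α β : Isom n} {m η : ℝ} (hm : 0 ≤ m) (hη : 0 ≤ η)
    (hα : ∀ x, ‖linearPart n α x - x‖ ≤ m * ‖x‖) (hβ : ∀ x, ‖linearPart n β x - x‖ ≤ η * ‖x‖) :
    ‖(α * β * α⁻¹ * β⁻¹) 0 - (linearPart n α (β 0) - β 0)‖ ≤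
      2 * m * η * ‖β 0‖ + η * ‖α 0‖ := by
  have hC := norm_linearPart_commutator_sub_le hm hη hα hβ
  set A := linearPart n α with hA
  set B := linearPart n β with hB
  set κ := α * β * α⁻¹ * β⁻¹ with hκ
  have h1 : κ (β (α 0)) = α (β 0) := by
    have : κ * (β * α) = α * β := by rw [hκ]; group
    exact DFunLike.congr_fun this 0
  rw [apply_eq_add κ, apply_eq_add β (α 0), apply_eq_add α (β 0), map_add] at h1
  have h2 : linearPart n κ (B (α 0)) = A (B (A.symm (α 0))) := by
    have : linearPart n κ * B = A * B * A⁻¹ := by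
      rw [hκ, map_mul, map_mul, map_mul, map_inv, map_inv, hA, hB, inv_mul_cancel_right]
    exact DFunLike.congr_fun this (α 0)
  rw [h2] at h1
  have h3 : κ 0 - (A (β 0) - β 0) =
      -(linearPart n κ (β 0) - β 0) - A (B (A.symm (α 0)) - A.symm (α 0)) := by
    rw [map_sub, LinearIsometryEquiv.apply_symm_apply, eq_sub_of_add_eq' h1]
    abel
  rw [h3]
  refine (norm_sub_le _ _).trans (add_le_add ?_ ?_)
  · rw [norm_neg]; exact hC _
  · rw [LinearIsometryEquiv.norm_map]
    exact (hβ _).trans (by simp)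

/-- An element of a discrete cocompact group of isometries whose rotation part is at distance at
most `1/2` from the identity is a translation. Otherwise let `α` be a counterexample which moves the
origin least, let `U` be the subspace on which `A - 1` is largest, and let `β` be an element with
translation part near `U` and rotation part near `1` which moves the origin least; the commutator of
`α` and `β` has the same properties as `β` and moves the origin less. -/
theorem IsBieberbach.linearPart_eq_one_of_near (hΓ : IsBieberbach Γ) {γ : Isom n} (hγ : γ ∈ Γ)
    (h : ∀ x, ‖linearPart n γ x - x‖ ≤ 1 / 2 * ‖x‖) : linearPart n γ = 1 := by
  by_contra hne
  obtain ⟨α, hα, ⟨hαne, hαle⟩, hmin⟩ := hΓ.exists_minimal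
    (fun γ => linearPart n γ ≠ 1 ∧ ∀ x, ‖linearPart n γ x - x‖ ≤ 1 / 2 * ‖x‖) ⟨γ, hγ, hne, h⟩
  set T : E n →L[ℝ] E n := linCLM α - 1 with hT
  have hTx : ∀ x, T x = linearPart n α x - x := fun x => rfl
  have hT0 : T ≠ 0 := by
    intro h0
    apply hαne
    ext1 x
    have := DFunLike.congr_fun h0 x
    rw [hTx] at this
    exact sub_eq_zero.1 this
  have hnormal : T * ContinuousLinearMap.adjoint T = ContinuousLinearMap.adjoint T * T := by
    have hadj : ContinuousLinearMap.adjoint T =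
        (((linearPart n α).symm.toContinuousLinearEquiv : E n →L[ℝ] E n)) - 1 := by
      symm
      rw [ContinuousLinearMap.eq_adjoint_iff]
      intro x y
      rw [hTx]
      change ⟪(linearPart n α).symm x - x, y⟫ = _
      rw [inner_sub_left, inner_sub_right, LinearIsometryEquiv.inner_map_eq_flip]
      simp
    rw [hadj]
    ext1 x
    change T ((linearPart n α).symm x - x) = (linearPart n α).symm (T x) - T x
    simp only [hTx, map_sub, LinearIsometryEquiv.apply_symm_apply,
      LinearIsometryEquiv.symm_apply_apply]
    abel
  obtain ⟨U, m, m', hU, hm, hm', hmm', hle, hUeq, hUle, hTU, hTU'⟩ :=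
    exists_top_subspace T hnormal hT0
  obtain ⟨u₀, hu₀, hu₀0⟩ := U.exists_mem_ne_zero_of_ne_bot hU
  have hm2 : m ≤ 1 / 2 := by
    have h1 := hαle u₀
    rw [← hTx, hUeq _ hu₀] at h1
    exact le_of_mul_le_mul_right h1 (norm_pos_iff.2 hu₀0)
  set p := U.starProjection with hp
  have hpU : ∀ x, p x ∈ U := fun x => Submodule.starProjection_apply_mem _ x
  have hqU : ∀ x, x - p x ∈ Uᗮ := fun x => Submodule.sub_starProjection_mem_orthogonal x
  have hpT : ∀ x, p (T x) = T (p x) := by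
    intro x
    refine Submodule.eq_starProjection_of_mem_of_inner_eq_zero (hTU _ (hpU x)) ?_
    intro w hw
    rw [← map_sub, real_inner_comm]
    exact (Submodule.mem_orthogonal _ _).1 (hTU' _ (hqU x)) w hw
  have hpn : ∀ x, ‖p x‖ ≤ ‖x‖ := fun x => Submodule.norm_starProjection_apply_le _ x
  have hqn : ∀ x, ‖x - p x‖ ≤ ‖x‖ := by
    intro x
    have := Submodule.norm_starProjection_apply_le Uᗮ x
    rwa [Submodule.starProjection_orthogonal_val] at this
  set η := (m - m') / 8 with hη
  have hηpos : 0 < η := by rw [hη]; linarith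
  obtain ⟨β, hβ, ⟨hβlt, hβle⟩, hβmin⟩ := hΓ.exists_minimal
    (fun β => ‖β 0 - p (β 0)‖ < ‖p (β 0)‖ ∧ ∀ x, ‖linearPart n β x - x‖ ≤ η * ‖x‖) (by
      set u := ‖u₀‖⁻¹ • u₀
      have hu : u ∈ U := U.smul_mem _ hu₀
      have hun : ‖u‖ = 1 := by simp [u, norm_smul, norm_ne_zero_iff.2 hu₀0]
      obtain ⟨β, hβ, h1, t, ht, h2⟩ := hΓ.exists_near_direction u (ε := min (1 / 4) η)
        (by positivity)
      refine ⟨β, hβ, ?_, fun x => (h1 x).trans (by gcongr; exact min_le_right _ _)⟩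
      have h2 : ‖β 0 - t • u‖ ≤ 1 / 4 * t := h2.trans (by gcongr; exact min_le_left _ _)
      have hpu : p (t • u) = t • u := Submodule.starProjection_eq_self_iff.2 (U.smul_mem _ hu)
      have h3 : ‖β 0 - p (β 0)‖ ≤ 1 / 4 * t := by
        have e : β 0 - p (β 0) = (β 0 - t • u) - p (β 0 - t • u) := by
          rw [map_sub, hpu]; abel
        rw [e]; exact (hqn _).trans h2
      have h4 : t ≤ ‖p (β 0)‖ + 1 / 4 * t := by
        have e : t • u = p (β 0) - p (β 0 - t • u) := by rw [map_sub, hpu]; abel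
        calc t = ‖t • u‖ := by rw [norm_smul, hun, Real.norm_of_nonneg ht.le, mul_one]
          _ ≤ ‖p (β 0)‖ + ‖p (β 0 - t • u)‖ := by
            conv_lhs => rw [e]
            exact norm_sub_le _ _
          _ ≤ _ := by gcongr; exact (hpn _).trans h2
      linarith)
  set b := β 0 with hb
  have hpb : 0 < ‖p b‖ := (norm_nonneg _).trans_lt hβlt
  have hbpos : 0 < ‖b‖ := hpb.trans_le (hpn _)
  set κ := α * β * α⁻¹ * β⁻¹ with hκ
  set r := κ 0 - T b with hr
  -- Either `β` is a translation, and the error vanishes, or `‖α 0‖ ≤ ‖β 0‖` by minimality of `α`.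
  have hrle : ‖r‖ ≤ 2 * η * ‖b‖ := by
    by_cases hB : linearPart n β = 1
    · have := norm_commutator_apply_zero_sub_le hm.le le_rfl hle (β := β) (η := 0)
        (fun x => by simp [hB])
      simp only [mul_zero, zero_mul, add_zero] at this
      exact this.trans (by positivity)
    · have hab : ‖α 0‖ ≤ ‖b‖ :=
        hmin β hβ ⟨hB, fun x => (hβle x).trans (by gcongr; linarith)⟩
      have := norm_commutator_apply_zero_sub_le hm.le hηpos.le hle hβle
      refine this.trans ?_
      have h1 : 2 * m * η * ‖b‖ ≤ 1 * η * ‖b‖ := by gcongr; linarith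
      have h2 : η * ‖α 0‖ ≤ η * ‖b‖ := by gcongr
      linarith
  have hκ0 : κ 0 = T b + r := by rw [hr]; abel
  have hbn : ‖b‖ < 2 * ‖p b‖ := by
    have e : b = p b + (b - p b) := by abel
    have : ‖b‖ ≤ ‖p b‖ + ‖b - p b‖ := by
      conv_lhs => rw [e]
      exact norm_add_le _ _
    linarith
  have hr2 : 2 * ‖r‖ < (m - m') * ‖p b‖ := by
    have h1 : 2 * ‖r‖ ≤ (m - m') / 2 * ‖b‖ := by rw [hη] at hrle; linarith
    have h2 : (m - m') / 2 * ‖b‖ < (m - m') / 2 * (2 * ‖p b‖) := by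
      apply mul_lt_mul_of_pos_left hbn; linarith
    linarith
  have h1 : m * ‖p b‖ - ‖r‖ ≤ ‖p (κ 0)‖ := by
    rw [hκ0, map_add, hpT, ← hUeq _ (hpU b)]
    have := norm_sub_norm_le (T (p b)) (-p r)
    rw [sub_neg_eq_add, norm_neg] at this
    linarith [hpn r]
  have h2 : ‖κ 0 - p (κ 0)‖ ≤ m' * ‖b - p b‖ + ‖r‖ := by
    have e : κ 0 - p (κ 0) = T (b - p b) + (r - p r) := by
      rw [hκ0, map_add, hpT, map_sub T]; abel
    rw [e]
    exact (norm_add_le _ _).trans (add_le_add (hUle _ (hqU b)) (hqn r))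
  have h3 : m' * ‖b - p b‖ ≤ m' * ‖p b‖ := by gcongr
  have hκle : ∀ x, ‖linearPart n κ x - x‖ ≤ η * ‖x‖ := by
    intro x
    refine (norm_linearPart_commutator_sub_le hm.le hηpos.le hle hβle x).trans ?_
    have : 2 * m * η * ‖x‖ ≤ 1 * η * ‖x‖ := by gcongr; linarith
    linarith
  have h4 := hβmin κ (Γ.mul_mem (Γ.mul_mem (Γ.mul_mem hα hβ) (Γ.inv_mem hα)) (Γ.inv_mem hβ))
    ⟨by nlinarith, hκle⟩
  have h5 : ‖κ 0‖ ≤ m * ‖b‖ + ‖r‖ := by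
    rw [hκ0]; exact (norm_add_le _ _).trans (by gcongr; exact hle b)
  have h6 : m * ‖b‖ ≤ 1 / 2 * ‖b‖ := by gcongr
  have h7 : 2 * η * ‖b‖ ≤ 1 / 8 * ‖b‖ := by
    gcongr; rw [hη]; linarith
  linarith

theorem holonomyHom_apply (γ : Γ) : holonomyHom Γ γ = linearPart n γ := rfl

theorem holonomyLin_mk (γ : Γ) : holonomyLin Γ (QuotientGroup.mk γ) = linearPart n γ := rfl

theorem holonomyLin_injective : Function.Injective (holonomyLin Γ) :=
  QuotientGroup.kerLift_injective _

/-- The holonomy group is finite: its elements are uniformly separated in the compact group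
`O(n)`. -/
theorem IsBieberbach.finite_holonomy (hΓ : IsBieberbach Γ) : Finite (Holonomy Γ) := by
  rw [← Set.finite_univ_iff]
  refine finite_of_separated (fun q : Holonomy Γ => linCLM (Quotient.out q : Γ).1) ?_
    (δ := 1 / 2) (by norm_num) ?_
  · refine (Metric.isBounded_closedBall (x := (0 : E n →L[ℝ] E n)) (r := 1)).subset ?_
    rintro _ ⟨γ, -, rfl⟩
    rw [Metric.mem_closedBall, dist_zero_right]
    exact norm_linCLM_le _
  · intro q _ q' _ hd
    rw [dist_eq_norm] at hd
    have h1 := hΓ.linearPart_eq_one_of_near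
      (Γ.mul_mem (Quotient.out q : Γ).2 (Γ.inv_mem (Quotient.out q' : Γ).2)) fun x =>
        (norm_linearPart_mul_inv_sub_le _ _ x).trans (by gcongr)
    rw [map_mul, map_inv, mul_inv_eq_one] at h1
    apply holonomyLin_injective
    rw [← QuotientGroup.out_eq' q, ← QuotientGroup.out_eq' q']
    exact h1

theorem IsBieberbach.exists_lattice_gap (hΓ : IsBieberbach Γ) :
    ∃ ε > 0, ∀ v ∈ lattice Γ, ‖v‖ < ε → v = 0 := by
  obtain ⟨ε, hε, h⟩ := hΓ.discrete
  refine ⟨ε, hε, fun v hv hlt => ?_⟩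
  have := h _ hv fun x _ => by simpa using hlt
  have h0 := DFunLike.congr_fun this 0
  simpa using h0

theorem IsBieberbach.discreteTopology_lattice (hΓ : IsBieberbach Γ) :
    DiscreteTopology (lattice Γ) := by
  obtain ⟨ε, hε, key⟩ := hΓ.exists_lattice_gap
  rw [discreteTopology_iff_isOpen_singleton_zero]
  rw [Metric.isOpen_singleton_iff]
  refine ⟨ε, hε, fun y hy => ?_⟩
  rw [dist_zero_right] at hy
  exact Subtype.ext (key y y.2 hy)

/-- The translations of a Bieberbach group are cobounded. -/
theorem IsBieberbach.exists_lattice_near (hΓ : IsBieberbach Γ) :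
    ∃ R : ℝ, ∀ x : E n, ∃ v ∈ lattice Γ, ‖x - v‖ ≤ R := by
  obtain ⟨R, hR0, hR⟩ := hΓ.exists_orbit_near
  have := hΓ.finite_holonomy
  obtain ⟨M, hM⟩ := (Set.finite_range fun q : Holonomy Γ => ‖(Quotient.out q : Γ).1 0‖).bddAbove
  refine ⟨R + M, fun x => ?_⟩
  obtain ⟨γ, hγ, hx⟩ := hR x
  let q : Holonomy Γ := QuotientGroup.mk (⟨γ, hγ⟩ : Γ)
  set g : Γ := Quotient.out q with hg
  have hq : linearPart n g.1 = linearPart n γ := by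
    have : (QuotientGroup.mk g : Holonomy Γ) = QuotientGroup.mk (⟨γ, hγ⟩ : Γ) :=
      QuotientGroup.out_eq' q
    exact congrArg (holonomyLin Γ) this
  have hmem : (γ⁻¹ * g.1) ∈ Γ := Γ.mul_mem (Γ.inv_mem hγ) g.2
  have h1 : linearPart n (γ⁻¹ * g.1) = 1 := by rw [map_mul, map_inv, hq, inv_mul_cancel]
  refine ⟨_, apply_zero_mem_lattice hmem h1, ?_⟩
  have e := apply_sub_apply γ x (γ⁻¹ (g.1 0))
  have e2 : γ (γ⁻¹ (g.1 0)) = g.1 0 := γ.apply_symm_apply _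
  rw [e2] at e
  have e3 := congrArg norm e
  rw [LinearIsometryEquiv.norm_map] at e3
  change ‖x - γ⁻¹ (g.1 0)‖ ≤ _
  rw [← e3]
  exact (norm_sub_le _ _).trans (add_le_add hx (hM ⟨q, rfl⟩))

/-- The translations of a Bieberbach group span `ℝⁿ`. -/
theorem IsBieberbach.span_lattice (hΓ : IsBieberbach Γ) :
    Submodule.span ℝ (lattice Γ : Set (E n)) = ⊤ := by
  obtain ⟨R, hR⟩ := hΓ.exists_lattice_near
  by_contra hne
  have hperp : (Submodule.span ℝ (lattice Γ : Set (E n)))ᗮ ≠ ⊥ := by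
    intro h
    exact hne (Submodule.orthogonal_eq_bot_iff.1 h)
  obtain ⟨u, hu, hu0⟩ := Submodule.exists_mem_ne_zero_of_ne_bot hperp
  have hun : 0 < ‖u‖ := norm_pos_iff.2 hu0
  set t : ℝ := (|R| + 1) / ‖u‖
  obtain ⟨v, hv, hle⟩ := hR (t • u)
  have h0 : ⟪v, u⟫ = 0 := (Submodule.mem_orthogonal _ _).1 hu v (Submodule.subset_span hv)
  have h1 : ⟪t • u - v, u⟫ = t * ‖u‖ ^ 2 := by
    rw [inner_sub_left, h0, inner_smul_left, real_inner_self_eq_norm_sq]; simp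
  have h2 : t * ‖u‖ ^ 2 ≤ R * ‖u‖ := by
    rw [← h1]
    exact (real_inner_le_norm _ _).trans (by gcongr)
  have h3 : t * ‖u‖ ^ 2 = (|R| + 1) * ‖u‖ := by simp only [t]; field_simp
  rw [h3] at h2
  have := le_of_mul_le_mul_right h2 hun
  linarith [le_abs_self R]

theorem IsBieberbach.isZLattice (hΓ : IsBieberbach Γ) [DiscreteTopology (lattice Γ)] :
    IsZLattice ℝ (lattice Γ) := ⟨hΓ.span_lattice⟩

/-- The rotation parts of `Γ` preserve the lattice of translations. -/
theorem linearPart_mem_lattice {γ : Isom n} (hγ : γ ∈ Γ) {v : E n} (hv : v ∈ lattice Γ) :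
    linearPart n γ v ∈ lattice Γ := by
  rw [mem_lattice] at hv ⊢
  have h := Γ.mul_mem (Γ.mul_mem hγ hv) (Γ.inv_mem hγ)
  convert h using 1
  ext1 x
  change _ = γ (v + γ⁻¹ x)
  have h1 := apply_sub_apply γ (v + γ⁻¹ x) (γ⁻¹ x)
  have h2 : γ (γ⁻¹ x) = x := γ.apply_symm_apply x
  rw [h2, add_sub_cancel_right, sub_eq_iff_eq_add] at h1
  rw [h1]; rfl

end Bieberbach

/-! ### Fourier series on a lattice -/

section Dual

variable {W : Type*} [NormedAddCommGroup W] [InnerProductSpace ℝ W]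

/-- The dual of a lattice `L` in a Euclidean space `W`. The space is arbitrary, and not `ℝⁿ`, because
Poisson summation takes place in the subspaces `ker (B - Id)`. -/
def dualOf (L : Submodule ℤ W) : Submodule ℤ W :=
  LinearMap.BilinForm.dualSubmodule (innerₗ W : LinearMap.BilinForm ℝ W) L

theorem mem_dualOf {L : Submodule ℤ W} {v : W} :
    v ∈ dualOf L ↔ ∀ l ∈ L, ∃ k : ℤ, ⟪v, l⟫ = (k : ℝ) := by
  rw [dualOf, LinearMap.BilinForm.mem_dualSubmodule]
  simp only [Submodule.mem_one, innerₗ_apply_apply, algebraMap_int_eq, eq_intCast, eq_comm]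

theorem nondegenerate_innerₗ : (innerₗ W : LinearMap.BilinForm ℝ W).Nondegenerate := by
  constructor
  · intro x hx
    exact inner_self_eq_zero.1 (hx x)
  · intro x hx
    exact inner_self_eq_zero.1 (hx x)

variable [FiniteDimensional ℝ W] (L : Submodule ℤ W) [DiscreteTopology L] [IsZLattice ℝ L]

theorem dualOf_eq_span : dualOf L = Submodule.span ℤ (Set.range
    (LinearMap.BilinForm.dualBasis (innerₗ W : LinearMap.BilinForm ℝ W) nondegenerate_innerₗ
      ((Free.chooseBasis ℤ L).ofZLatticeBasis ℝ))) := by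
  classical
  rw [← LinearMap.BilinForm.dualSubmodule_span_of_basis, Basis.ofZLatticeBasis_span, dualOf]

instance discreteTopology_dualOf : DiscreteTopology (dualOf L) := by
  rw [dualOf_eq_span]; infer_instance

instance isZLattice_dualOf : IsZLattice ℝ (dualOf L) where
  span_top := by rw [dualOf_eq_span]; exact ZSpan.span_top _

theorem dualOf_dualOf : dualOf (dualOf L) = L := by
  have h := LinearMap.BilinForm.dualSubmodule_dualSubmodule_of_basis (R := ℤ)
    (B := (innerₗ W : LinearMap.BilinForm ℝ W)) nondegenerate_innerₗ
    ⟨fun x y => real_inner_comm _ _⟩ ((Free.chooseBasis ℤ L).ofZLatticeBasis ℝ)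
  rwa [Basis.ofZLatticeBasis_span] at h

end Dual

section Chr

variable {W : Type*} [NormedAddCommGroup W] [InnerProductSpace ℝ W]

/-- The character `x ↦ exp (2πi⟨v, x⟩)` of `W` with frequency `v`. -/
def chr (v x : W) : ℂ := Complex.exp ((2 * Real.pi * ⟪v, x⟫ : ℝ) * Complex.I)

theorem chr_add (v x y : W) : chr v (x + y) = chr v x * chr v y := by
  rw [chr, chr, chr, ← Complex.exp_add, inner_add_right]; push_cast; ring_nf

theorem chr_add_left (v w x : W) : chr (v + w) x = chr v x * chr w x := by
  rw [chr, chr, chr, ← Complex.exp_add, inner_add_left]; push_cast; ring_nf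

@[simp] theorem chr_zero (v : W) : chr v 0 = 1 := by simp [chr]

@[simp] theorem chr_zero_left (v : W) : chr 0 v = 1 := by simp [chr]

theorem norm_chr (v x : W) : ‖chr v x‖ = 1 := Complex.norm_exp_ofReal_mul_I _

theorem chr_eq_one {L : Submodule ℤ W} {v l : W} (hv : v ∈ dualOf L) (hl : l ∈ L) :
    chr v l = 1 := by
  obtain ⟨k, hk⟩ := mem_dualOf.1 hv l hl
  rw [chr, hk, Complex.exp_eq_one_iff]
  exact ⟨k, by push_cast; ring⟩

theorem continuous_chr (v : W) : Continuous (chr v) := by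
  unfold chr; fun_prop

end Chr

section Freq

variable {W : Type*} [NormedAddCommGroup W] [InnerProductSpace ℝ W] [FiniteDimensional ℝ W]
  (L : Submodule ℤ W) [DiscreteTopology L] [IsZLattice ℝ L]

/-- A fundamental parallelepiped of `L`, spanned by an arbitrary basis. -/
def fundDom : Set W := ZSpan.fundamentalDomain ((Free.chooseBasis ℤ L).ofZLatticeBasis ℝ)

theorem isBounded_fundDom : Bornology.IsBounded (fundDom L) :=
  ZSpan.fundamentalDomain_isBounded _

/-- The vector with coordinates `k` in the dual of the chosen basis of `L`. -/
def freq (k : Free.ChooseBasisIndex ℤ L → ℤ) : W :=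
  ∑ i, (k i : ℝ) • LinearMap.BilinForm.dualBasis (innerₗ W : LinearMap.BilinForm ℝ W)
    nondegenerate_innerₗ ((Free.chooseBasis ℤ L).ofZLatticeBasis ℝ) i

theorem inner_freq (k : Free.ChooseBasisIndex ℤ L → ℤ) (t : Free.ChooseBasisIndex ℤ L → ℝ) :
    ⟪freq L k, ((Free.chooseBasis ℤ L).ofZLatticeBasis ℝ).equivFun.symm t⟫ =
      ∑ i, k i * t i := by
  classical
  rw [Basis.equivFun_symm_apply, freq, sum_inner]
  refine Finset.sum_congr rfl fun i _ => ?_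
  rw [inner_sum, Finset.sum_eq_single i]
  · rw [inner_smul_left, inner_smul_right]
    have := LinearMap.BilinForm.apply_dualBasis_left (B := (innerₗ W : LinearMap.BilinForm ℝ W))
      nondegenerate_innerₗ ((Free.chooseBasis ℤ L).ofZLatticeBasis ℝ) i i
    rw [innerₗ_apply_apply] at this
    rw [this]; simp
  · intro j _ hj
    rw [inner_smul_left, inner_smul_right]
    have := LinearMap.BilinForm.apply_dualBasis_left (B := (innerₗ W : LinearMap.BilinForm ℝ W))
      nondegenerate_innerₗ ((Free.chooseBasis ℤ L).ofZLatticeBasis ℝ) i j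
    rw [innerₗ_apply_apply] at this
    rw [this, if_neg hj]; simp
  · simp

theorem freq_bijective : ∃ h : ∀ k, freq L k ∈ dualOf L,
    Function.Bijective fun k => (⟨freq L k, h k⟩ : dualOf L) := by
  have h : ∀ k, freq L k ∈ dualOf L := by
    intro k
    rw [dualOf_eq_span, Submodule.mem_span_range_iff_exists_fun]
    exact ⟨k, by simp only [freq, Int.cast_smul_eq_zsmul]⟩
  refine ⟨h, ?_, ?_⟩
  · intro k k' hkk
    have hkk := congrArg Subtype.val hkk
    ext i
    have := (LinearMap.BilinForm.dualBasis (B := (innerₗ W : LinearMap.BilinForm ℝ W))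
      nondegenerate_innerₗ ((Free.chooseBasis ℤ L).ofZLatticeBasis ℝ)).linearIndependent
    have h2 := (Fintype.linearIndependent_iffₛ.1 this) (fun i => (k i : ℝ)) (fun i => (k' i : ℝ))
      hkk i
    exact_mod_cast h2
  · rintro ⟨v, hv⟩
    have hv' := hv
    rw [dualOf_eq_span, Submodule.mem_span_range_iff_exists_fun] at hv'
    obtain ⟨c, hc⟩ := hv'
    exact ⟨c, Subtype.ext (by simpa only [freq, Int.cast_smul_eq_zsmul] using hc)⟩

/-- The dual lattice is parametrized by integral coordinates. -/
def freqEquiv : (Free.ChooseBasisIndex ℤ L → ℤ) ≃ dualOf L :=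
  Equiv.ofBijective _ (freq_bijective L).choose_spec

@[simp] theorem coe_freqEquiv (k : Free.ChooseBasisIndex ℤ L → ℤ) :
    (freqEquiv L k : W) = freq L k := rfl

theorem mFourier_coe (k : Free.ChooseBasisIndex ℤ L → ℤ) (t : Free.ChooseBasisIndex ℤ L → ℝ) :
    UnitAddTorus.mFourier k (fun i => (t i : UnitAddCircle)) =
      chr (freq L k) (((Free.chooseBasis ℤ L).ofZLatticeBasis ℝ).equivFun.symm t) := by
  rw [chr, inner_freq]
  simp only [UnitAddTorus.mFourier, ContinuousMap.coe_mk, fourier_coe_apply]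
  rw [← Complex.exp_sum]
  congr 1
  push_cast
  rw [Finset.mul_sum, Finset.sum_mul]
  refine Finset.sum_congr rfl fun i _ => ?_
  simp; ring

/-- An `L`-periodic continuous function, in coordinates, factors through the standard torus. -/
theorem exists_torus_lift {f : W → ℂ} (hf : Continuous f) (hper : ∀ l ∈ L, ∀ x, f (x + l) = f x) :
    ∃ F : C(UnitAddTorus (Free.ChooseBasisIndex ℤ L), ℂ), ∀ t : Free.ChooseBasisIndex ℤ L → ℝ,
      F (fun i => (t i : UnitAddCircle)) =
        f (((Free.chooseBasis ℤ L).ofZLatticeBasis ℝ).equivFun.symm t) := by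
  set B := (Free.chooseBasis ℤ L).ofZLatticeBasis ℝ with hB
  let π : (Free.ChooseBasisIndex ℤ L → ℝ) → UnitAddTorus (Free.ChooseBasisIndex ℤ L) :=
    fun t i => (t i : UnitAddCircle)
  have hπ : IsOpenQuotientMap π :=
    IsOpenQuotientMap.piMap fun _ => QuotientAddGroup.isOpenQuotientMap_mk
  let g : (Free.ChooseBasisIndex ℤ L → ℝ) → ℂ := fun t => f (B.equivFun.symm t)
  have hg : Continuous g := hf.comp B.equivFun.symm.toLinearMap.continuous_of_finiteDimensional
  have hfac : ∀ s t, π s = π t → g s = g t := by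
    intro s t hst
    have hk : ∀ i, ∃ k : ℤ, s i - t i = k := by
      intro i
      have h1 : ((s i : ℝ) : UnitAddCircle) = (t i : ℝ) := congrFun hst i
      rw [← sub_eq_zero, ← AddCircle.coe_sub, AddCircle.coe_eq_zero_iff] at h1
      obtain ⟨k, hk⟩ := h1
      exact ⟨k, by rw [← hk]; simp⟩
    choose k hk using hk
    have h1 : B.equivFun.symm s = B.equivFun.symm t + ∑ i, (k i) • B i := by
      simp only [Basis.equivFun_symm_apply, ← Finset.sum_add_distrib]
      refine Finset.sum_congr rfl fun i _ => ?_
      rw [← Int.cast_smul_eq_zsmul ℝ, ← hk, ← add_smul]; congr 1; ring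
    change f _ = f _
    rw [h1]
    refine hper _ (Submodule.sum_mem _ fun i _ => L.smul_mem _ ?_) _
    rw [hB, Basis.ofZLatticeBasis_apply]
    exact (Free.chooseBasis ℤ L i).2
  let π' : C(_, UnitAddTorus (Free.ChooseBasisIndex ℤ L)) := ⟨π, hπ.continuous⟩
  have hq : Topology.IsQuotientMap π' := hπ.isQuotientMap
  refine ⟨hq.lift ⟨g, hg⟩ fun s t h => hfac s t h, fun t => ?_⟩
  exact DFunLike.congr_fun (hq.lift_comp ⟨g, hg⟩ fun s t h => hfac s t h) t

end Freq

section Fourier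

variable {W : Type*} [NormedAddCommGroup W] [InnerProductSpace ℝ W] [FiniteDimensional ℝ W]
  [MeasurableSpace W] [BorelSpace W]

/-- Integrals over a fundamental parallelepiped in terms of the coordinates. -/
theorem setIntegral_fundamentalDomain {ι : Type*} [Fintype ι] (b : Basis ι ℝ W) (h : W → ℂ) :
    ∫ x in ZSpan.fundamentalDomain b, h x = (volume.real (ZSpan.fundamentalDomain b) : ℂ) *
      ∫ t in {t : ι → ℝ | ∀ i, t i ∈ Set.Ioc ((0 : ι → ℝ) i) ((0 : ι → ℝ) i + 1)},
        h (b.equivFun.symm t) := by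
  let φ : W ≃L[ℝ] (ι → ℝ) := b.equivFun.toContinuousLinearEquiv
  have hφ : MeasurableEmbedding φ := φ.toHomeomorph.measurableEmbedding
  let ν : Measure (ι → ℝ) := (volume : Measure W).map φ
  have hν : ν.IsAddHaarMeasure := φ.isAddHaarMeasure_map volume
  obtain ⟨c, hc⟩ : ∃ c : NNReal, ν = c • (volume : Measure (ι → ℝ)) :=
    ⟨_, Measure.isAddLeftInvariant_eq_smul ν volume⟩
  let Q : Set (ι → ℝ) := Set.univ.pi fun _ => Set.Ico 0 1
  have hQ : φ ⁻¹' Q = ZSpan.fundamentalDomain b := by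
    ext x
    simp [Q, φ, ZSpan.mem_fundamentalDomain]
  have hmp : MeasurePreserving φ volume (c • (volume : Measure (ι → ℝ))) :=
    ⟨hφ.measurable, hc⟩
  have hQm : MeasurableSet Q := MeasurableSet.univ_pi fun _ => measurableSet_Ico
  have hvol : volume.real (ZSpan.fundamentalDomain b) = c := by
    have h1 : volume (ZSpan.fundamentalDomain b) = c := by
      rw [← hQ, hmp.measure_preimage hQm.nullMeasurableSet, Measure.smul_apply, volume_pi_pi]
      simp
    rw [measureReal_def, h1, ENNReal.coe_toReal]
  have hae : Q =ᵐ[volume]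
      {t : ι → ℝ | ∀ i, t i ∈ Set.Ioc ((0 : ι → ℝ) i) ((0 : ι → ℝ) i + 1)} := by
    have h1 := Measure.univ_pi_Ico_ae_eq_Icc (μ := fun _ : ι => (volume : Measure ℝ))
      (f := fun _ => 0) (g := fun _ => 1)
    have h2 := Measure.univ_pi_Ioc_ae_eq_Icc (μ := fun _ : ι => (volume : Measure ℝ))
      (f := fun _ => 0) (g := fun _ => 1)
    have e : {t : ι → ℝ | ∀ i, t i ∈ Set.Ioc ((0 : ι → ℝ) i) ((0 : ι → ℝ) i + 1)} =
        Set.univ.pi fun _ => Set.Ioc 0 1 := by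
      ext t; simp
    rw [e]
    exact h1.trans h2.symm
  have h1 := hmp.setIntegral_preimage_emb hφ (fun t => h (b.equivFun.symm t)) Q
  rw [hQ] at h1
  have h2 : ∀ x, h (b.equivFun.symm (φ x)) = h x := fun x => by
    congr 1
    exact b.equivFun.symm_apply_apply x
  simp only [h2] at h1
  rw [h1, Measure.restrict_smul, integral_smul_nnreal_measure, hvol, setIntegral_congr_set hae]
  rfl

variable (L : Submodule ℤ W) [DiscreteTopology L] [IsZLattice ℝ L]

theorem isAddFundamentalDomain_fundDom : IsAddFundamentalDomain L (fundDom L) volume :=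
  ZLattice.isAddFundamentalDomain _ _

theorem measureReal_fundDom : volume.real (fundDom L) = ZLattice.covolume L volume :=
  (ZLattice.covolume_eq_measure_fundamentalDomain L volume
    (isAddFundamentalDomain_fundDom L)).symm

theorem volume_fundDom_lt_top : volume (fundDom L) < ⊤ :=
  (isBounded_fundDom L).measure_lt_top

theorem measurableSet_fundDom : MeasurableSet (fundDom L) :=
  ZSpan.fundamentalDomain_measurableSet _

/-- The Fourier coefficient, for the frequency `v`, of an `L`-periodic function `f`: the mean of
`chr (-v) * f` over a period. -/
def fourierCoef (f : W → ℂ) (v : W) : ℂ :=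
  (ZLattice.covolume L volume : ℂ)⁻¹ * ∫ x in fundDom L, chr (-v) x * f x

/-- A continuous `L`-periodic function with summable Fourier coefficients is the sum of its Fourier
series. -/
theorem hasSum_fourierCoef {f : W → ℂ} (hf : Continuous f)
    (hper : ∀ l ∈ L, ∀ x, f (x + l) = f x)
    (hsum : Summable fun v : dualOf L => fourierCoef L f v) (x : W) :
    HasSum (fun v : dualOf L => fourierCoef L f v * chr (v : W) x) (f x) := by
  obtain ⟨F, hF⟩ := exists_torus_lift L hf hper
  set B := (Free.chooseBasis ℤ L).ofZLatticeBasis ℝ with hB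
  have hcov : (ZLattice.covolume L volume : ℂ) ≠ 0 := by
    exact_mod_cast ZLattice.covolume_ne_zero L volume
  have hcoef : ∀ k, UnitAddTorus.mFourierCoeff F k = fourierCoef L f (freqEquiv L k) := by
    intro k
    rw [UnitAddTorus.mFourierCoeff_eq_integral F k 0, fourierCoef, fundDom,
      setIntegral_fundamentalDomain, ← fundDom, measureReal_fundDom, inv_mul_cancel_left₀ hcov]
    congr 1
    ext t
    rw [mFourier_coe, hF, coe_freqEquiv, smul_eq_mul]
    congr 2
    simp [freq]
  have hs : Summable (UnitAddTorus.mFourierCoeff F) := by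
    have : UnitAddTorus.mFourierCoeff F = (fun v : dualOf L => fourierCoef L f v) ∘ freqEquiv L :=
      funext hcoef
    rw [this]
    exact (freqEquiv L).summable_iff.2 hsum
  have h := UnitAddTorus.hasSum_mFourier_series_apply_of_summable hs
    (fun i => (B.equivFun x i : UnitAddCircle))
  rw [hF, LinearEquiv.symm_apply_apply] at h
  rw [← (freqEquiv L).hasSum_iff]
  convert h using 1
  ext k
  rw [mFourier_coe, hcoef, LinearEquiv.symm_apply_apply, smul_eq_mul]
  rfl

end Fourier

/-! ### Poisson summation for Gaussians -/

section Gauss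

variable {W : Type*} [NormedAddCommGroup W] [InnerProductSpace ℝ W] [FiniteDimensional ℝ W]
  (L : Submodule ℤ W) [DiscreteTopology L]

theorem summable_gaussian_lattice {c : ℝ} (hc : 0 < c) :
    Summable fun l : L => Real.exp (-(c * ‖(l : W)‖ ^ 2)) := by
  set k := finrank ℤ L + 1 with hk
  have h := ZLattice.summable_norm_pow_inv L (2 * k) (by omega)
  refine Summable.of_norm_bounded_eventually (h.mul_left (k.factorial * (c ^ k)⁻¹)) ?_
  have hfin : ({0} : Set L).Finite := Set.finite_singleton 0
  filter_upwards [hfin.compl_mem_cofinite] with l hl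
  have hl0 : 0 < ‖(l : W)‖ := norm_pos_iff.2 fun h => hl (Subtype.ext h)
  have hx : 0 < c * ‖(l : W)‖ ^ 2 := by positivity
  have h1 := Real.pow_div_factorial_le_exp _ hx.le k
  rw [Real.norm_of_nonneg (Real.exp_pos _).le, Real.exp_neg]
  have h2 : (0 : ℝ) < (c * ‖(l : W)‖ ^ 2) ^ k / k.factorial := by positivity
  refine (inv_anti₀ h2 h1).trans (le_of_eq ?_)
  change _ = _ * ‖(l : W)‖⁻¹ ^ (2 * k)
  rw [mul_pow, ← pow_mul, inv_pow]
  field_simp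

theorem gaussian_translate_le {U : Type*} [NormedAddCommGroup U] {c : ℝ} (hc : 0 < c) {R : ℝ} {x : U}
    (hx : ‖x‖ ≤ R) (l : U) :
    Real.exp (-(c * ‖l + x‖ ^ 2)) ≤ Real.exp (c * R ^ 2) * Real.exp (-(c / 2 * ‖l‖ ^ 2)) := by
  rw [← Real.exp_add, Real.exp_le_exp]
  have h1 : ‖l‖ ≤ ‖l + x‖ + ‖x‖ := by
    have := norm_sub_le (l + x) x
    rwa [add_sub_cancel_right] at this
  have h2 : ‖l‖ ^ 2 ≤ (‖l + x‖ + R) ^ 2 := by gcongr; linarith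
  have h3 : ‖l‖ ^ 2 ≤ 2 * ‖l + x‖ ^ 2 + 2 * R ^ 2 := by nlinarith [sq_nonneg (‖l + x‖ - R)]
  nlinarith

theorem summable_gaussian_translate {c : ℝ} (hc : 0 < c) (x : W) :
    Summable fun l : L => Real.exp (-(c * ‖(l : W) + x‖ ^ 2)) :=
  Summable.of_nonneg_of_le (fun _ => (Real.exp_pos _).le)
    (fun l => gaussian_translate_le hc le_rfl (l : W))
    ((summable_gaussian_lattice L (half_pos hc)).mul_left _)

theorem continuous_tsum_gaussian {c : ℝ} (hc : 0 < c) :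
    Continuous fun x : W => ∑' l : L, Real.exp (-(c * ‖(l : W) + x‖ ^ 2)) := by
  rw [continuous_iff_continuousAt]
  intro x₀
  have h : ContinuousOn (fun x : W => ∑' l : L, Real.exp (-(c * ‖(l : W) + x‖ ^ 2)))
      (Metric.ball 0 (‖x₀‖ + 1)) := by
    refine continuousOn_tsum (fun l => ?_)
      ((summable_gaussian_lattice L (half_pos hc)).mul_left (Real.exp (c * (‖x₀‖ + 1) ^ 2))) ?_
    · fun_prop
    · intro l x hx
      rw [Real.norm_of_nonneg (Real.exp_pos _).le]
      exact gaussian_translate_le hc (by simpa using (mem_ball_zero_iff.1 hx).le) _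
  exact h.continuousAt (Metric.isOpen_ball.mem_nhds (by simp))

theorem summable_dual_gaussian {s : ℝ} (hs : 0 < s) (x : W) :
    Summable fun v : L => chr (v : W) x * (Real.exp (-(4 * Real.pi ^ 2 * ‖(v : W)‖ ^ 2 * s)) : ℂ) := by
  refine Summable.of_norm ?_
  have := summable_gaussian_lattice L (c := 4 * Real.pi ^ 2 * s) (by positivity)
  refine this.congr fun v => ?_
  rw [norm_mul, norm_chr, one_mul, Complex.norm_real, Real.norm_of_nonneg (Real.exp_pos _).le]
  congr 1; ring

/-- For large times only the zero frequency contributes. -/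
theorem tendsto_tsum_dual_gaussian (x : W) :
    Tendsto (fun s : ℝ => ∑' v : L, chr (v : W) x *
      (Real.exp (-(4 * Real.pi ^ 2 * ‖(v : W)‖ ^ 2 * s)) : ℂ)) atTop (𝓝 1) := by
  classical
  have h : Tendsto (fun s : ℝ => ∑' v : L, chr (v : W) x *
      (Real.exp (-(4 * Real.pi ^ 2 * ‖(v : W)‖ ^ 2 * s)) : ℂ)) atTop
      (𝓝 (∑' v : L, if v = 0 then 1 else 0)) := by
    refine tendsto_tsum_of_dominated_convergence
      (summable_gaussian_lattice L (c := 4 * Real.pi ^ 2 * 1) (by positivity)) (fun v => ?_) ?_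
    · by_cases hv : v = 0
      · simp [hv]
      · rw [if_neg hv]
        have hv0 : 0 < ‖(v : W)‖ := norm_pos_iff.2 fun h => hv (Subtype.ext h)
        have h1 : Tendsto (fun s : ℝ => Real.exp (-(4 * Real.pi ^ 2 * ‖(v : W)‖ ^ 2 * s)))
            atTop (𝓝 0) := by
          refine Real.tendsto_exp_atBot.comp (tendsto_neg_atTop_atBot.comp ?_)
          exact tendsto_id.const_mul_atTop (by positivity)
        have h2 := (Complex.continuous_ofReal.tendsto 0).comp h1
        simpa using h2.const_mul (chr (v : W) x)
    · filter_upwards [eventually_ge_atTop 1] with s hs v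
      rw [norm_mul, norm_chr, one_mul, Complex.norm_real, Real.norm_of_nonneg (Real.exp_pos _).le,
        Real.exp_le_exp]
      have : 4 * Real.pi ^ 2 * ‖(v : W)‖ ^ 2 * 1 ≤ 4 * Real.pi ^ 2 * ‖(v : W)‖ ^ 2 * s := by gcongr
      linarith
  rwa [tsum_ite_eq] at h

variable [IsZLattice ℝ L] [MeasurableSpace W] [BorelSpace W]

theorem integrable_gaussian {c : ℝ} (hc : 0 < c) (v : W) :
    Integrable fun x : W => chr v x * (Real.exp (-(c * ‖x‖ ^ 2)) : ℂ) := by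
  have h := GaussianFourier.integrable_cexp_neg_mul_sq_norm_add (V := W) (b := (c : ℂ))
    (by simpa using hc) (2 * Real.pi * Complex.I) v
  refine h.congr (Eventually.of_forall fun x => ?_)
  simp only [chr]
  rw [Complex.ofReal_exp, ← Complex.exp_add]
  congr 1; push_cast; ring

theorem integral_chr_mul_gaussian {s : ℝ} (hs : 0 < s) (v : W) :
    ∫ x : W, chr v x * (Real.exp (-((4 * s)⁻¹ * ‖x‖ ^ 2)) : ℂ) =
      ((4 * Real.pi * s) ^ ((finrank ℝ W : ℝ) / 2) *
        Real.exp (-(4 * Real.pi ^ 2 * ‖v‖ ^ 2 * s)) : ℝ) := by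
  have h := GaussianFourier.integral_cexp_neg_mul_sq_norm_add (V := W)
    (b := (((4 * s)⁻¹ : ℝ) : ℂ)) (by rw [Complex.ofReal_re]; positivity)
    (2 * Real.pi * Complex.I) v
  have hs' : (s : ℂ) ≠ 0 := by exact_mod_cast hs.ne'
  convert h using 1
  · congr 1
    ext x
    rw [chr, Complex.ofReal_exp, ← Complex.exp_add]
    congr 1; push_cast; ring
  · rw [Complex.ofReal_mul, Complex.ofReal_exp, Complex.ofReal_cpow (by positivity)]
    congr 2
    · push_cast; field_simp
    · push_cast; rfl
    · push_cast
      rw [mul_pow, Complex.I_sq]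
      field_simp
      ring

/-- The Fourier coefficients of the periodization of a Gaussian. -/
theorem fourierCoef_tsum_gaussian {s : ℝ} (hs : 0 < s) {v : W} (hv : v ∈ dualOf L) :
    fourierCoef L (fun x => ((∑' l : L, Real.exp (-((4 * s)⁻¹ * ‖(l : W) + x‖ ^ 2)) : ℝ) : ℂ)) v =
      ((ZLattice.covolume L volume)⁻¹ * ((4 * Real.pi * s) ^ ((finrank ℝ W : ℝ) / 2) *
        Real.exp (-(4 * Real.pi ^ 2 * ‖v‖ ^ 2 * s))) : ℝ) := by
  have hc : 0 < (4 * s)⁻¹ := by positivity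
  set c := (4 * s)⁻¹ with hcdef
  let h : W → ℂ := fun x => chr (-v) x * (Real.exp (-(c * ‖x‖ ^ 2)) : ℂ)
  have hint : Integrable h := integrable_gaussian hc (-v)
  have hmeas : MeasurableVAdd L W := (inferInstance : MeasurableVAdd L.toAddSubgroup W)
  have hinv : VAddInvariantMeasure L W volume :=
    (inferInstance : VAddInvariantMeasure L.toAddSubgroup W volume)
  have hunfold := (isAddFundamentalDomain_fundDom L).integral_eq_tsum' h hint
  rw [← (Equiv.neg L).tsum_eq] at hunfold
  have hterm : ∀ l : L, ∀ x : W, h (-(Equiv.neg L l) +ᵥ x) =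
      chr (-v) x * (Real.exp (-(c * ‖(l : W) + x‖ ^ 2)) : ℂ) := by
    intro l x
    have e : (-(Equiv.neg L l) +ᵥ x : W) = (l : W) + x := by
      rw [Equiv.neg_apply, neg_neg]; rfl
    rw [e]
    simp only [h]
    rw [chr_add, chr_eq_one (neg_mem hv) l.2, one_mul]
  simp only [hterm] at hunfold
  obtain ⟨R, hR⟩ := (isBounded_fundDom L).exists_norm_le
  have hbound : ∀ l : L, ∀ x ∈ fundDom L,
      ‖chr (-v) x * (Real.exp (-(c * ‖(l : W) + x‖ ^ 2)) : ℂ)‖ ≤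
        Real.exp (c * R ^ 2) * Real.exp (-(c / 2 * ‖(l : W)‖ ^ 2)) := by
    intro l x hx
    rw [norm_mul, norm_chr, one_mul, Complex.norm_real, Real.norm_of_nonneg (Real.exp_pos _).le]
    exact gaussian_translate_le hc (hR x hx) _
  have hfin : IsFiniteMeasure ((volume : Measure W).restrict (fundDom L)) :=
    ⟨by rw [Measure.restrict_apply_univ]; exact volume_fundDom_lt_top L⟩
  have hbound' : ∀ l : L, ∀ᵐ x ∂((volume : Measure W).restrict (fundDom L)),
      ‖chr (-v) x * (Real.exp (-(c * ‖(l : W) + x‖ ^ 2)) : ℂ)‖ ≤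
        Real.exp (c * R ^ 2) * Real.exp (-(c / 2 * ‖(l : W)‖ ^ 2)) := fun l =>
    (ae_restrict_iff' (measurableSet_fundDom L)).2 (Eventually.of_forall fun x hx => hbound l x hx)
  have hcont : ∀ l : L, Continuous fun x : W =>
      chr (-v) x * (Real.exp (-(c * ‖(l : W) + x‖ ^ 2)) : ℂ) := fun l =>
    (continuous_chr _).mul (Complex.continuous_ofReal.comp (by fun_prop))
  have hswap := integral_tsum_of_summable_integral_norm
    (μ := (volume : Measure W).restrict (fundDom L))
    (F := fun (l : L) (x : W) => chr (-v) x * (Real.exp (-(c * ‖(l : W) + x‖ ^ 2)) : ℂ))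
    (fun l => Integrable.of_bound (hcont l).aestronglyMeasurable _ (hbound' l)) (by
      refine Summable.of_nonneg_of_le (fun l => integral_nonneg fun _ => norm_nonneg _) (fun l => ?_)
        (((summable_gaussian_lattice L (half_pos hc)).mul_left
          (Real.exp (c * R ^ 2))).mul_left (volume.real (fundDom L)))
      refine (integral_mono_ae ((Integrable.of_bound (hcont l).aestronglyMeasurable _
        (hbound' l)).norm) (integrable_const _) (hbound' l)).trans (le_of_eq ?_)
      rw [integral_const, smul_eq_mul, measureReal_restrict_apply_univ])
  rw [← hunfold] at hswap
  have hval : ∫ x, h x = _ := integral_chr_mul_gaussian hs (-v)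
  rw [hval, norm_neg] at hswap
  rw [fourierCoef, Complex.ofReal_mul, hswap]
  push_cast
  congr 1
  refine setIntegral_congr_fun (measurableSet_fundDom L) fun x _ => ?_
  rw [tsum_mul_left]

/-- Poisson summation, with the covolume of the lattice that is summed over in space. -/
theorem poisson_aux {s : ℝ} (hs : 0 < s) (x : W) :
    (((4 * Real.pi * s) ^ (-(finrank ℝ W : ℝ) / 2) * ZLattice.covolume L volume *
      ∑' l : L, Real.exp (-((4 * s)⁻¹ * ‖(l : W) + x‖ ^ 2)) : ℝ) : ℂ) =
      ∑' v : dualOf L, chr (v : W) x *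
        (Real.exp (-(4 * Real.pi ^ 2 * ‖(v : W)‖ ^ 2 * s)) : ℂ) := by
  have hc : 0 < (4 * s)⁻¹ := by positivity
  have hcov : ZLattice.covolume L volume ≠ 0 := ZLattice.covolume_ne_zero L volume
  have hper : ∀ l ∈ L, ∀ x : W,
      ((∑' l' : L, Real.exp (-((4 * s)⁻¹ * ‖(l' : W) + (x + l)‖ ^ 2)) : ℝ) : ℂ) =
      ((∑' l' : L, Real.exp (-((4 * s)⁻¹ * ‖(l' : W) + x‖ ^ 2)) : ℝ) : ℂ) := by
    intro l hl x
    congr 1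
    rw [← (Equiv.addRight (⟨l, hl⟩ : L)).tsum_eq
      (fun l' : L => Real.exp (-((4 * s)⁻¹ * ‖(l' : W) + x‖ ^ 2)))]
    refine tsum_congr fun l' => ?_
    have e : (l' : W) + (x + l) = ((Equiv.addRight (⟨l, hl⟩ : L) l' : L) : W) + x := by
      simp; abel
    rw [e]
  have hK : (0 : ℝ) < (4 * Real.pi * s) ^ ((finrank ℝ W : ℝ) / 2) := by positivity
  have h := hasSum_fourierCoef L
    (f := fun x => ((∑' l : L, Real.exp (-((4 * s)⁻¹ * ‖(l : W) + x‖ ^ 2)) : ℝ) : ℂ))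
    (Complex.continuous_ofReal.comp (continuous_tsum_gaussian L hc)) hper (by
      simp only [fourierCoef_tsum_gaussian L hs (Subtype.prop _)]
      have := (summable_dual_gaussian (dualOf L) hs (0 : W)).mul_left
        (((ZLattice.covolume L volume)⁻¹ * (4 * Real.pi * s) ^ ((finrank ℝ W : ℝ) / 2) : ℝ) : ℂ)
      refine this.congr fun v => ?_
      rw [chr_zero]; push_cast; ring) x
  simp only [fourierCoef_tsum_gaussian L hs (Subtype.prop _)] at h
  rw [Complex.ofReal_mul, ← h.tsum_eq, ← tsum_mul_left]
  refine tsum_congr fun v => ?_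
  have e : (4 * Real.pi * s) ^ (-(finrank ℝ W : ℝ) / 2) =
      ((4 * Real.pi * s) ^ ((finrank ℝ W : ℝ) / 2))⁻¹ := by
    rw [← Real.rpow_neg (by positivity)]; congr 1; ring
  rw [e, ← mul_assoc, ← Complex.ofReal_mul, mul_comm]
  congr 2
  field_simp

/-- The covolumes of a lattice and its dual are reciprocal: compare the Poisson summation formulas
of the two lattices. -/
theorem covolume_mul_covolume_dualOf :
    ZLattice.covolume L volume * ZLattice.covolume (dualOf L) volume = 1 := by
  have hπ := Real.pi_pos
  set d : ℝ := (finrank ℝ W : ℝ) with hd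
  have hs : (0 : ℝ) < 1 / (4 * Real.pi) := by positivity
  have h1 := poisson_aux L hs (0 : W)
  have h2 := poisson_aux (dualOf L) hs (0 : W)
  -- at `4πs = 1` both Gaussians are `exp (-π‖·‖²)`
  have e1 : 4 * Real.pi * (1 / (4 * Real.pi)) = 1 := by field_simp
  have e2 : ∀ w : W, Real.exp (-((4 * (1 / (4 * Real.pi)))⁻¹ * ‖w + 0‖ ^ 2)) =
      Real.exp (-(Real.pi * ‖w‖ ^ 2)) := by
    intro w; congr 2; rw [add_zero]; field_simp
  have e3 : ∀ w : W, Real.exp (-(4 * Real.pi ^ 2 * ‖w‖ ^ 2 * (1 / (4 * Real.pi)))) =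
      Real.exp (-(Real.pi * ‖w‖ ^ 2)) := by
    intro w; congr 2; field_simp
  simp only [e1, e2, e3, Real.one_rpow, one_mul, chr_zero] at h1 h2
  rw [dualOf_dualOf] at h2
  rw [← Complex.ofReal_tsum, Complex.ofReal_inj] at h1 h2
  have hpos : 0 < ∑' l : L, Real.exp (-(Real.pi * ‖(l : W)‖ ^ 2)) :=
    (summable_gaussian_lattice L hπ).tsum_pos (fun _ => (Real.exp_pos _).le) 0 (Real.exp_pos _)
  rw [← h1] at h2
  have : (ZLattice.covolume (dualOf L) volume * ZLattice.covolume L volume - 1) *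
      ∑' l : L, Real.exp (-(Real.pi * ‖(l : W)‖ ^ 2)) = 0 := by linear_combination h2
  rcases mul_eq_zero.1 this with h | h
  · linarith
  · exact absurd h hpos.ne'

/-- **Poisson summation** for Gaussians. -/
theorem hasSum_poisson {s : ℝ} (hs : 0 < s) (x : W) :
    HasSum (fun v : dualOf L => chr (v : W) x *
        (Real.exp (-(4 * Real.pi ^ 2 * ‖(v : W)‖ ^ 2 * s)) : ℂ))
      (((ZLattice.covolume (dualOf L) volume)⁻¹ * (4 * Real.pi * s) ^ (-(finrank ℝ W : ℝ) / 2) *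
      ∑' l : L, Real.exp (-((4 * s)⁻¹ * ‖(l : W) + x‖ ^ 2)) : ℝ) : ℂ) := by
  have h1 : (ZLattice.covolume (dualOf L) volume)⁻¹ = ZLattice.covolume L volume :=
    inv_eq_of_mul_eq_one_left (covolume_mul_covolume_dualOf L)
  rw [h1, mul_comm (ZLattice.covolume L volume), poisson_aux L hs x]
  exact (summable_dual_gaussian (dualOf L) hs x).hasSum

end Gauss

/-! ### Eigenfunctions of the Laplacian on a torus -/

section Parts

theorem fderiv_periodic {W F : Type*} [NormedAddCommGroup W] [NormedSpace ℝ W]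
    [NormedAddCommGroup F] [NormedSpace ℝ F] {f : W → F} {l : W} (hper : ∀ x, f (x + l) = f x)
    (x : W) : fderiv ℝ f (x + l) = fderiv ℝ f x := by
  rw [← fderiv_comp_add_right]
  simp only [hper]

variable {W : Type*} [NormedAddCommGroup W] [InnerProductSpace ℝ W]

theorem hasFDerivAt_chr (v x : W) :
    HasFDerivAt (chr v) (chr v x • ((innerSL ℝ v).smulRight (2 * Real.pi * Complex.I : ℂ))) x := by
  have h1 : HasFDerivAt (fun y : W => ((2 * Real.pi * ⟪v, y⟫ : ℝ) : ℂ) * Complex.I)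
      ((innerSL ℝ v).smulRight (2 * Real.pi * Complex.I : ℂ)) x := by
    have h := ((innerSL ℝ v).smulRight (2 * Real.pi * Complex.I : ℂ)).hasFDerivAt (x := x)
    refine h.congr_of_eventuallyEq (Eventually.of_forall fun y => ?_)
    simp only [ContinuousLinearMap.smulRight_apply, innerSL_apply_apply, Complex.real_smul]
    push_cast; ring
  exact h1.cexp

theorem contDiff_chr (v : W) {k : WithTop ℕ∞} : ContDiff ℝ k (chr v) := by
  have h1 : ContDiff ℝ k (fun y : W => ((2 * Real.pi * ⟪v, y⟫ : ℝ) : ℂ) * Complex.I) := by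
    have h := ((innerSL ℝ v).smulRight (2 * Real.pi * Complex.I : ℂ)).contDiff (n := k)
    convert h using 2 with y
    simp only [ContinuousLinearMap.smulRight_apply, innerSL_apply_apply, Complex.real_smul]
    push_cast; ring
  exact h1.cexp

theorem fderiv_chr (v x u : W) :
    fderiv ℝ (chr v) x u = (2 * Real.pi * Complex.I * ⟪v, u⟫ : ℂ) * chr v x := by
  rw [(hasFDerivAt_chr v x).fderiv]
  simp; ring

variable [FiniteDimensional ℝ W]

theorem laplacian_eq_sum {F : Type*} [NormedAddCommGroup F] [NormedSpace ℝ F] {f : W → F}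
    (hf : ContDiff ℝ 2 f) (x : W) :
    Laplacian.laplacian f x = ∑ i, fderiv ℝ (fun y => fderiv ℝ f y (stdOrthonormalBasis ℝ W i)) x
      (stdOrthonormalBasis ℝ W i) := by
  rw [InnerProductSpace.laplacian_eq_iteratedFDeriv_stdOrthonormalBasis]
  refine Finset.sum_congr rfl fun i _ => ?_
  rw [iteratedFDeriv_two_apply]
  have hd : DifferentiableAt ℝ (fderiv ℝ f) x :=
    ((hf.fderiv_right (m := 1) (by norm_num)).differentiable one_ne_zero).differentiableAt
  rw [fderiv_clm_apply hd (differentiableAt_const _)]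
  simp

theorem sum_sq_inner_stdOrthonormalBasis (v : W) :
    ∑ i, ⟪v, stdOrthonormalBasis ℝ W i⟫ ^ 2 = ‖v‖ ^ 2 := by
  rw [← (stdOrthonormalBasis ℝ W).sum_sq_norm_inner_left v]
  simp

theorem laplacian_chr (v x : W) :
    Laplacian.laplacian (chr v) x = -(4 * Real.pi ^ 2 * ‖v‖ ^ 2 : ℝ) * chr v x := by
  rw [laplacian_eq_sum (contDiff_chr v)]
  simp only [fderiv_chr]
  have h : ∀ u : W, fderiv ℝ (fun y => (2 * Real.pi * Complex.I * ⟪v, u⟫ : ℂ) * chr v y) x u =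
      ((-(4 * Real.pi ^ 2 * ⟪v, u⟫ ^ 2) : ℝ) : ℂ) * chr v x := by
    intro u
    rw [fderiv_const_mul (hasFDerivAt_chr v x).differentiableAt, smul_apply,
      fderiv_chr, smul_eq_mul]
    push_cast
    linear_combination (4 * Real.pi ^ 2 * (⟪v, u⟫ : ℂ) ^ 2 * chr v x) * Complex.I_sq
  simp only [h]
  rw [← Finset.sum_mul, ← Complex.ofReal_sum, Finset.sum_neg_distrib, ← Finset.mul_sum,
    sum_sq_inner_stdOrthonormalBasis]
  push_cast; rfl

variable [MeasurableSpace W] [BorelSpace W] (L : Submodule ℤ W) [DiscreteTopology L]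
  [IsZLattice ℝ L]

/-- The integral of a derivative of a periodic function over a period vanishes: the integral of
the function over a period is invariant under translations. -/
theorem integral_fderiv_eq_zero {g : W → ℂ} (hg : ContDiff ℝ 1 g)
    (hper : ∀ l ∈ L, ∀ x, g (x + l) = g x) (u : W) :
    ∫ x in fundDom L, fderiv ℝ g x u = 0 := by
  have hmeas : MeasurableVAdd L W := (inferInstance : MeasurableVAdd L.toAddSubgroup W)
  have hinv : VAddInvariantMeasure L W volume :=
    (inferInstance : VAddInvariantMeasure L.toAddSubgroup W volume)
  have hconst : ∀ t : ℝ, ∫ x in fundDom L, g (x + t • u) = ∫ x in fundDom L, g x := by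
    intro t
    have hcomm : VAddCommClass W L W := ⟨fun a b c => by
      change a + ((b : W) + c) = (b : W) + (a + c); abel⟩
    have hD := isAddFundamentalDomain_fundDom L
    have h1 := (hD.vadd_of_comm (t • u)).setIntegral_eq hD (f := g) fun l x => by
      change g ((l : W) + x) = g x
      rw [add_comm]; exact hper l l.2 x
    rw [← h1]
    have h2 := (measurePreserving_vadd (t • u) (volume : Measure W)).setIntegral_image_emb
      (measurableEmbedding_const_vadd _) g (fundDom L)
    refine Eq.trans ?_ h2.symm
    simp only [vadd_eq_add, add_comm]
  obtain ⟨R, hR⟩ := (isBounded_fundDom L).exists_norm_le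
  have hcd : Continuous fun x => fderiv ℝ g x u :=
    (hg.continuous_fderiv one_ne_zero).clm_apply continuous_const
  obtain ⟨C, hC⟩ := (isCompact_closedBall (0 : W) (R + ‖u‖)).exists_bound_of_continuousOn
    hcd.continuousOn
  obtain ⟨C', hC'⟩ := (isCompact_closedBall (0 : W) R).exists_bound_of_continuousOn
    hg.continuous.continuousOn
  have hfin : IsFiniteMeasure ((volume : Measure W).restrict (fundDom L)) :=
    ⟨by rw [Measure.restrict_apply_univ]; exact volume_fundDom_lt_top L⟩
  have hderiv := hasDerivAt_integral_of_dominated_loc_of_deriv_le (𝕜 := ℝ)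
    (μ := (volume : Measure W).restrict (fundDom L))
    (F := fun (t : ℝ) (x : W) => g (x + t • u)) (F' := fun t x => fderiv ℝ g (x + t • u) u)
    (x₀ := 0) (s := Metric.ball 0 1) (bound := fun _ => C)
    (Metric.ball_mem_nhds _ one_pos)
    (Eventually.of_forall fun t =>
      (hg.continuous.comp (continuous_id.add continuous_const)).aestronglyMeasurable)
    (by
      simp only [zero_smul, add_zero]
      refine Integrable.of_bound hg.continuous.aestronglyMeasurable C' ?_
      exact (ae_restrict_iff' (measurableSet_fundDom L)).2 (Eventually.of_forall fun x hx =>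
        hC' x (by simpa using hR x hx)))
    (hcd.comp (continuous_id.add continuous_const)).aestronglyMeasurable
    ((ae_restrict_iff' (measurableSet_fundDom L)).2 (Eventually.of_forall fun x hx t ht => by
      refine hC _ ?_
      rw [mem_closedBall_zero_iff]
      refine (norm_add_le _ _).trans (add_le_add (hR x hx) ?_)
      rw [norm_smul]
      have : ‖t‖ ≤ 1 := (mem_ball_zero_iff.1 ht).le
      exact mul_le_of_le_one_left (norm_nonneg _) this))
    (integrable_const _)
    (Eventually.of_forall fun x t _ => by
      have h1 : HasDerivAt (fun t : ℝ => x + t • u) u t := by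
        simpa using ((hasDerivAt_id t).smul_const u).const_add x
      exact ((hg.differentiable one_ne_zero).differentiableAt.hasFDerivAt).comp_hasDerivAt t h1)
  have h := hderiv.2
  simp only [hconst, zero_smul, add_zero] at h
  exact h.unique (hasDerivAt_const _ _)

/-- Integration by parts over a period. -/
theorem fourierCoef_fderiv {f : W → ℂ} (hf : ContDiff ℝ 1 f)
    (hper : ∀ l ∈ L, ∀ x, f (x + l) = f x) {v : W} (hv : v ∈ dualOf L) (u : W) :
    fourierCoef L (fun x => fderiv ℝ f x u) v =
      (2 * Real.pi * Complex.I * ⟪v, u⟫ : ℂ) * fourierCoef L f v := by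
  have h := integral_fderiv_eq_zero L (g := fun x => chr (-v) x * f x)
    ((contDiff_chr _).mul hf) (fun l hl x => by
      rw [chr_add, chr_eq_one (neg_mem hv) hl, mul_one, hper l hl]) u
  have hfd : Continuous fun x => fderiv ℝ f x u :=
    (hf.continuous_fderiv one_ne_zero).clm_apply continuous_const
  have hint : ∀ g : W → ℂ, Continuous g → IntegrableOn g (fundDom L) := fun g hg =>
    ((hg.continuousOn.integrableOn_compact (isBounded_fundDom L).isCompact_closure)).mono_set
      subset_closure
  have e : ∀ x, fderiv ℝ (fun x => chr (-v) x * f x) x u =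
      chr (-v) x * fderiv ℝ f x u + -(2 * Real.pi * Complex.I * ⟪v, u⟫ : ℂ) * (chr (-v) x * f x) := by
    intro x
    rw [fderiv_fun_mul (hasFDerivAt_chr _ x).differentiableAt
      (hf.differentiable one_ne_zero).differentiableAt]
    simp only [add_apply, smul_apply, smul_eq_mul,
      fderiv_chr, inner_neg_left]
    push_cast; ring
  simp only [e] at h
  have h1 : IntegrableOn (fun x => chr (-v) x * fderiv ℝ f x u) (fundDom L) :=
    hint _ ((continuous_chr _).mul hfd)
  have h2 : IntegrableOn (fun x => chr (-v) x * f x) (fundDom L) :=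
    hint _ ((continuous_chr _).mul hf.continuous)
  rw [integral_add h1 (h2.const_mul _), integral_const_mul] at h
  rw [fourierCoef, fourierCoef]
  linear_combination (ZLattice.covolume L volume : ℂ)⁻¹ * h

theorem fourierCoef_sum {ι : Type*} (s : Finset ι) {f : ι → W → ℂ} (hf : ∀ i, Continuous (f i))
    (v : W) : fourierCoef L (fun x => ∑ i ∈ s, f i x) v = ∑ i ∈ s, fourierCoef L (f i) v := by
  simp only [fourierCoef, Finset.mul_sum]
  rw [integral_finsetSum, Finset.mul_sum]
  intro i _
  exact ((((continuous_chr _).mul (hf i)).continuousOn.integrableOn_compact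
    (isBounded_fundDom L).isCompact_closure)).mono_set subset_closure

theorem fourierCoef_laplacian {f : W → ℂ} (hf : ContDiff ℝ 2 f)
    (hper : ∀ l ∈ L, ∀ x, f (x + l) = f x) {v : W} (hv : v ∈ dualOf L) :
    fourierCoef L (Laplacian.laplacian f) v =
      -(4 * Real.pi ^ 2 * ‖v‖ ^ 2 : ℝ) * fourierCoef L f v := by
  have e : Laplacian.laplacian f = fun x => ∑ i, fderiv ℝ
      (fun y => fderiv ℝ f y (stdOrthonormalBasis ℝ W i)) x (stdOrthonormalBasis ℝ W i) :=
    funext fun x => laplacian_eq_sum hf x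
  have h1 : ∀ u, ContDiff ℝ 1 fun y => fderiv ℝ f y u := fun u =>
    (hf.fderiv_right (m := 1) (by norm_num)).clm_apply contDiff_const
  rw [e, fourierCoef_sum L _ fun i => ((h1 _).continuous_fderiv one_ne_zero).clm_apply
    continuous_const]
  have h2 : ∀ u, fourierCoef L (fun x => fderiv ℝ (fun y => fderiv ℝ f y u) x u) v =
      ((-(4 * Real.pi ^ 2 * ⟪v, u⟫ ^ 2) : ℝ) : ℂ) * fourierCoef L f v := by
    intro u
    rw [fourierCoef_fderiv L (h1 u) (fun l hl x => by rw [fderiv_periodic (hper l hl)]) hv,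
      fourierCoef_fderiv L (hf.of_le (by norm_num)) hper hv]
    push_cast
    linear_combination (4 * Real.pi ^ 2 * (⟪v, u⟫ : ℂ) ^ 2 * fourierCoef L f v) * Complex.I_sq
  simp only [h2]
  rw [← Finset.sum_mul, ← Complex.ofReal_sum, Finset.sum_neg_distrib, ← Finset.mul_sum,
    sum_sq_inner_stdOrthonormalBasis]
  push_cast; rfl

end Parts

section FreqSphere

variable {W : Type*} [NormedAddCommGroup W] [InnerProductSpace ℝ W] [FiniteDimensional ℝ W]

/-- The frequencies `v` of the dual lattice with `4π²‖v‖² = a`. -/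
def freqSphere (L : Submodule ℤ W) (a : ℝ) : Set W :=
  {v | v ∈ dualOf L ∧ 4 * Real.pi ^ 2 * ‖v‖ ^ 2 = a}

variable (L : Submodule ℤ W) [DiscreteTopology L] [IsZLattice ℝ L]

theorem finite_freqSphere (a : ℝ) : (freqSphere L a).Finite := by
  have h : (Metric.closedBall (0 : W) (max 1 a) ∩ (dualOf L : Set W)).Finite := by
    rw [dualOf_eq_span]
    exact ZSpan.setFinite_inter _ Metric.isBounded_closedBall
  refine h.subset fun v hv => ⟨?_, hv.1⟩
  rw [mem_closedBall_zero_iff]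
  by_contra! hlt
  have h1 : 1 < ‖v‖ := (le_max_left _ _).trans_lt hlt
  have h2 : a < ‖v‖ := (le_max_right _ _).trans_lt hlt
  have h3 : ‖v‖ ≤ ‖v‖ ^ 2 := by nlinarith
  have h4 : 1 ≤ 4 * Real.pi ^ 2 := by nlinarith [Real.pi_gt_three]
  have h5 : ‖v‖ ^ 2 ≤ 4 * Real.pi ^ 2 * ‖v‖ ^ 2 := le_mul_of_one_le_left (by positivity) h4
  have := hv.2
  linarith

instance fintypeFreqSphere (a : ℝ) : Fintype (freqSphere L a) :=
  (finite_freqSphere L a).fintype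

variable [MeasurableSpace W] [BorelSpace W]

/-- A periodic eigenfunction of the Laplacian is a trigonometric polynomial: by integration by parts
its Fourier coefficients vanish outside the finite set of frequencies with the right eigenvalue. -/
theorem eigenfunction_eq_sum {f : W → ℂ} (hf : ContDiff ℝ 2 f)
    (hper : ∀ l ∈ L, ∀ x, f (x + l) = f x) {a : ℝ}
    (hlap : ∀ x, -(Laplacian.laplacian f x) = (a : ℂ) * f x) (x : W) :
    f x = ∑ v : freqSphere L a, chr (v : W) x * fourierCoef L f v := by
  have hz : ∀ v : dualOf L, (v : W) ∉ freqSphere L a → fourierCoef L f v = 0 := by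
    intro v hv
    have h1 := fourierCoef_laplacian L hf hper v.2
    have e : Laplacian.laplacian f = fun x => -(a : ℂ) * f x := by
      ext x; rw [neg_mul, ← hlap, neg_neg]
    have h2 : fourierCoef L (fun x => -(a : ℂ) * f x) v = -(a : ℂ) * fourierCoef L f v := by
      simp only [fourierCoef, mul_left_comm (chr (-(v : W)) _), integral_const_mul]
      ring
    rw [e, h2] at h1
    have h3 : (((4 * Real.pi ^ 2 * ‖(v : W)‖ ^ 2 - a : ℝ)) : ℂ) * fourierCoef L f v = 0 := by
      push_cast at h1 ⊢
      linear_combination h1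
    rcases mul_eq_zero.1 h3 with h | h
    · exact absurd ⟨v.2, sub_eq_zero.1 (Complex.ofReal_eq_zero.1 h)⟩ hv
    · exact h
  let ι : freqSphere L a → dualOf L := fun v => ⟨v, v.2.1⟩
  have hι : Function.Injective ι := fun v w h => Subtype.ext (congrArg (Subtype.val : dualOf L → W) h)
  have hrange : ∀ v ∉ Set.range ι, fourierCoef L f v = 0 := fun v hv =>
    hz v fun h => hv ⟨⟨v, h⟩, rfl⟩
  have hs : Summable fun v : dualOf L => fourierCoef L f v :=
    (hι.summable_iff hrange).1 (Summable.of_finite)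
  have h := hasSum_fourierCoef L hf.continuous hper hs x
  rw [← hι.hasSum_iff (fun v hv => by rw [hrange v hv, zero_mul])] at h
  rw [h.unique (hasSum_fintype _)]
  exact Finset.sum_congr rfl fun v _ => mul_comm _ _

end FreqSphere

/-! ### Eigenspaces of the connection Laplacian -/

section TrigPoly

variable {n : ℕ} (L : Submodule ℤ (E n)) [DiscreteTopology L] [IsZLattice ℝ L]
  {V : Type*} [NormedAddCommGroup V] [NormedSpace ℂ V]

theorem dualLattice_eq_dualOf (L : Submodule ℤ (E n)) : dualLattice L = dualOf L := by
  ext v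
  rw [mem_dualOf]
  rfl

/-- The `V`-valued trigonometric polynomial with coefficients `w` at the frequencies `v ∈ L*` with
`4π²‖v‖² = a`. -/
def trigPoly (a : ℝ) : (freqSphere L a → V) →ₗ[ℂ] (E n → V) where
  toFun w x := ∑ v : freqSphere L a, chr (v : E n) x • w v
  map_add' w w' := by
    ext x; simp [Finset.sum_add_distrib]
  map_smul' c w := by
    ext x
    simp only [Pi.smul_apply, RingHom.id_apply, Finset.smul_sum]
    exact Finset.sum_congr rfl fun v _ => smul_comm _ _ _

theorem trigPoly_apply (a : ℝ) (w : freqSphere L a → V) (x : E n) :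
    trigPoly L a w x = ∑ v : freqSphere L a, chr (v : E n) x • w v := rfl

/-- `chr v` as a multiplicative character. -/
def chrHom (v : E n) : Multiplicative (E n) →* ℂ where
  toFun x := chr v x.toAdd
  map_one' := chr_zero v
  map_mul' _ _ := chr_add v _ _

theorem chrHom_injective : Function.Injective (chrHom : E n → Multiplicative (E n) →* ℂ) := by
  intro v w h
  have h1 : ∀ x : E n, chr v x = chr w x := fun x => DFunLike.congr_fun h (Multiplicative.ofAdd x)
  have h2 : chr v = chr w := funext h1
  refine ext_inner_right ℝ fun u => ?_
  have h3 := fderiv_chr v 0 u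
  rw [h2, fderiv_chr] at h3
  simp only [chr_zero, mul_one] at h3
  have h4 : (2 * Real.pi * Complex.I : ℂ) ≠ 0 := by
    simp [Real.pi_ne_zero, Complex.I_ne_zero]
  exact_mod_cast (mul_left_cancel₀ h4 h3).symm

/-- Distinct characters are linearly independent. -/
theorem trigPoly_injective [FiniteDimensional ℂ V] (a : ℝ) :
    Function.Injective (trigPoly L a : (freqSphere L a → V) →ₗ[ℂ] (E n → V)) := by
  rw [← LinearMap.ker_eq_bot, LinearMap.ker_eq_bot']
  intro w hw
  have hli : LinearIndependent ℂ fun v : freqSphere L a =>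
      (chrHom (v : E n) : Multiplicative (E n) → ℂ) :=
    (linearIndependent_monoidHom (Multiplicative (E n)) ℂ).comp
      (fun v : freqSphere L a => chrHom (v : E n))
      (fun v v' h => Subtype.ext (chrHom_injective h))
  ext v
  apply (finBasis ℂ V).ext_elem
  intro j
  have h := Fintype.linearIndependent_iff.1 hli (fun v => (finBasis ℂ V).coord j (w v)) (by
    ext x
    have h1 := congrArg ((finBasis ℂ V).coord j) (congrFun hw x.toAdd)
    rw [trigPoly_apply, map_sum] at h1
    simp only [map_smul, smul_eq_mul, Pi.zero_apply, map_zero] at h1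
    rw [Finset.sum_apply, Pi.zero_apply, ← h1]
    exact Finset.sum_congr rfl fun v _ => mul_comm _ _) v
  simpa using h

variable (τ : Representation ℂ (O n) V)

theorem trigPoly_mem_eigenspace_bot (a : ℝ) (w : freqSphere L a → V) :
    trigPoly L a w ∈ eigenspace τ ⊥ a := by
  have h : trigPoly L a w = ∑ v : freqSphere L a, fun x => chr (v : E n) x • w v := by
    ext x; rw [Finset.sum_apply]; rfl
  rw [h]
  refine Submodule.sum_mem _ fun v _ => ⟨(contDiff_chr _).smul contDiff_const, ?_, fun x => ?_⟩
  · intro γ hγ x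
    rw [Subgroup.mem_bot] at hγ
    rw [hγ, map_one, map_one]; rfl
  · have h1 := ((contDiff_chr (v : E n)).contDiffAt (n := 2)).laplacian_CLM_comp_left (x := x)
      (l := ((ContinuousLinearMap.id ℂ ℂ).smulRight (w v)).restrictScalars ℝ)
    have h2 : ((((ContinuousLinearMap.id ℂ ℂ).smulRight (w v)).restrictScalars ℝ) ∘ chr (v : E n)) =
      fun x => chr (v : E n) x • w v := rfl
    rw [h2] at h1
    rw [h1]
    change -(Laplacian.laplacian (chr (v : E n)) x • w v) = _
    rw [laplacian_chr, v.2.2, smul_smul, ← neg_smul]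
    ring_nf

/-- A periodic vector-valued eigenfunction is a trigonometric polynomial. -/
theorem exists_trigPoly_eq [FiniteDimensional ℂ V] {f : E n → V} (hf : ContDiff ℝ 2 f)
    (hper : ∀ l ∈ L, ∀ x, f (x + l) = f x) {a : ℝ}
    (hlap : ∀ x, -(Laplacian.laplacian f x) = (a : ℂ) • f x) : ∃ w, trigPoly L a w = f := by
  set b := finBasis ℂ V with hb
  let ℓ : Fin (finrank ℂ V) → V →L[ℂ] ℂ := fun j => LinearMap.toContinuousLinearMap (b.coord j)
  have hℓ : ∀ j x, f x ∈ Set.univ → (ℓ j) (f x) =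
      ∑ v : freqSphere L a, chr (v : E n) x * fourierCoef L (fun y => ℓ j (f y)) v := by
    intro j x _
    have hc : ContDiff ℝ 2 fun y => ℓ j (f y) := ((ℓ j).restrictScalars ℝ).contDiff.comp hf
    refine eigenfunction_eq_sum L hc (fun l hl x => by rw [hper l hl]) (fun x => ?_) x
    have h1 := (hf.contDiffAt (x := x)).laplacian_CLM_comp_left (l := (ℓ j).restrictScalars ℝ)
    have h2 : (((ℓ j).restrictScalars ℝ) ∘ f) = fun y => ℓ j (f y) := rfl
    rw [h2] at h1
    rw [h1]
    change -(ℓ j (Laplacian.laplacian f x)) = _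
    rw [← map_neg, hlap, map_smul, smul_eq_mul]
  refine ⟨fun v => ∑ j, fourierCoef L (fun y => ℓ j (f y)) v • b j, ?_⟩
  ext x
  rw [trigPoly_apply]
  simp only [Finset.smul_sum, smul_smul]
  rw [Finset.sum_comm]
  simp only [← Finset.sum_smul]
  conv_rhs => rw [← b.sum_repr (f x)]
  refine Finset.sum_congr rfl fun j _ => ?_
  rw [← hℓ j x trivial]; rfl

theorem trigPoly_add {a : ℝ} (w : freqSphere L a → V) {l : E n} (hl : l ∈ L) (x : E n) :
    trigPoly L a w (x + l) = trigPoly L a w x := by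
  simp only [trigPoly_apply]
  refine Finset.sum_congr rfl fun v _ => ?_
  rw [chr_add, chr_eq_one v.2.1 hl, mul_one]

end TrigPoly

section Action

variable {n : ℕ} (Γ : Subgroup (Isom n)) {V : Type*} [NormedAddCommGroup V] [NormedSpace ℂ V]
  (τ : Representation ℂ (O n) V)

/-- A section over `M_Γ` is periodic with respect to the lattice of translations. -/
theorem eigenspace_periodic {Γ : Subgroup (Isom n)} {τ : Representation ℂ (O n) V} {a : ℝ}
    {f : E n → V} (hf : f ∈ eigenspace τ Γ a) {l : E n} (hl : l ∈ lattice Γ) (x : E n) :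
    f (x + l) = f x := by
  have h := hf.2.1 _ hl x
  rw [linearPart_constVAdd, map_one] at h
  simpa [add_comm] using h

theorem inner_symm_left (B : O n) (v x : E n) : ⟪B.symm v, x⟫ = ⟪v, B x⟫ := by
  rw [← B.inner_map_map, LinearIsometryEquiv.apply_symm_apply]

theorem linearPart_symm_mem_freqSphere {Γ : Subgroup (Isom n)} {γ : Isom n} (hγ : γ ∈ Γ) {a : ℝ}
    {v : E n} (hv : v ∈ freqSphere (lattice Γ) a) :
    (linearPart n γ).symm v ∈ freqSphere (lattice Γ) a := by
  refine ⟨mem_dualOf.2 fun l hl => ?_, by rw [LinearIsometryEquiv.norm_map]; exact hv.2⟩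
  obtain ⟨k, hk⟩ := mem_dualOf.1 hv.1 _ (linearPart_mem_lattice hγ hl)
  exact ⟨k, by rw [← hk, inner_symm_left]⟩

/-- The permutation of the frequencies by the inverse of a rotation part. -/
def freqPerm (a : ℝ) (γ : Γ) : Equiv.Perm (freqSphere (lattice Γ) a) where
  toFun v := ⟨(linearPart n γ).symm v, linearPart_symm_mem_freqSphere γ.2 v.2⟩
  invFun v := ⟨linearPart n γ v, by
    have := linearPart_symm_mem_freqSphere (γ⁻¹).2 v.2
    rwa [InvMemClass.coe_inv, map_inv] at this⟩
  left_inv v := by simp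
  right_inv v := by simp

@[simp] theorem coe_freqPerm (a : ℝ) (γ : Γ) (v : freqSphere (lattice Γ) a) :
    (freqPerm Γ a γ v : E n) = (linearPart n γ).symm v := rfl

/-- The action on the coefficients of trigonometric polynomials which corresponds to the action
`f ↦ τ(B) ∘ f ∘ γ⁻¹` of an isometry `γ = B L_b` on functions. -/
def coeffAct (a : ℝ) (γ : Γ) :
    (freqSphere (lattice Γ) a → V) →ₗ[ℂ] (freqSphere (lattice Γ) a → V) where
  toFun w v := chr (-(v : E n)) (γ.1 0) • τ (linearPart n γ) (w (freqPerm Γ a γ v))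
  map_add' w w' := by ext v; simp
  map_smul' c w := by ext v; simp [smul_comm c]

theorem coeffAct_apply (a : ℝ) (γ : Γ) (w : freqSphere (lattice Γ) a → V)
    (v : freqSphere (lattice Γ) a) : coeffAct Γ τ a γ w v =
      chr (-(v : E n)) (γ.1 0) • τ (linearPart n γ) (w (freqPerm Γ a γ v)) := rfl

variable [DiscreteTopology (lattice Γ)] [IsZLattice ℝ (lattice Γ)]

theorem trigPoly_coeffAct (a : ℝ) (γ : Γ) (w : freqSphere (lattice Γ) a → V) (x : E n) :
    trigPoly (lattice Γ) a (coeffAct Γ τ a γ w) (γ.1 x) =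
      τ (linearPart n γ) (trigPoly (lattice Γ) a w x) := by
  rw [trigPoly_apply, trigPoly_apply, map_sum, ← Equiv.sum_comp (freqPerm Γ a γ)
    fun v => τ (linearPart n γ) (chr (v : E n) x • w v)]
  refine Finset.sum_congr rfl fun v _ => ?_
  rw [coeffAct_apply, smul_smul, map_smul]
  congr 1
  rw [apply_eq_add γ.1 x, chr_add, mul_assoc, ← chr_add_left, add_neg_cancel, chr_zero_left,
    mul_one, coe_freqPerm, chr, chr, inner_symm_left]

variable [FiniteDimensional ℂ V]

/-- The action of `Γ` on the coefficients of trigonometric polynomials, as a representation. -/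
def coeffRep (a : ℝ) : Representation ℂ Γ (freqSphere (lattice Γ) a → V) where
  toFun := coeffAct Γ τ a
  map_one' := by
    refine LinearMap.ext fun w => trigPoly_injective (lattice Γ) a (funext fun x => ?_)
    have h := trigPoly_coeffAct Γ τ a 1 w x
    simpa using h
  map_mul' γ γ' := by
    refine LinearMap.ext fun w => trigPoly_injective (lattice Γ) a (funext fun x => ?_)
    obtain ⟨y, rfl⟩ := (γ * γ').1.surjective x
    rw [trigPoly_coeffAct]
    have h1 := trigPoly_coeffAct Γ τ a γ (coeffAct Γ τ a γ' w) (γ'.1 y)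
    rw [trigPoly_coeffAct Γ τ a γ' w y] at h1
    refine Eq.trans ?_ h1.symm
    rw [Subgroup.coe_mul, map_mul, map_mul]; rfl

theorem coeffRep_apply (a : ℝ) (γ : Γ) : coeffRep Γ τ a γ = coeffAct Γ τ a γ := rfl

theorem coeffRep_eq_one (a : ℝ) (γ : Γ) (h : γ ∈ (holonomyHom Γ).ker) : coeffRep Γ τ a γ = 1 := by
  rw [MonoidHom.mem_ker, holonomyHom_apply] at h
  refine LinearMap.ext fun w => trigPoly_injective (lattice Γ) a (funext fun x => ?_)
  obtain ⟨y, rfl⟩ := γ.1.surjective x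
  rw [coeffRep_apply, trigPoly_coeffAct, h, map_one, apply_eq_add γ.1 y, h]
  exact (trigPoly_add _ w (apply_zero_mem_lattice γ.2 h) y).symm

/-- The induced representation of the holonomy group. -/
def holonomyRep (a : ℝ) : Representation ℂ (Holonomy Γ) (freqSphere (lattice Γ) a → V) :=
  QuotientGroup.lift (holonomyHom Γ).ker (coeffRep Γ τ a) (coeffRep_eq_one Γ τ a)

theorem holonomyRep_mk (a : ℝ) (γ : Γ) :
    holonomyRep Γ τ a (QuotientGroup.mk γ) = coeffAct Γ τ a γ := rfl

theorem trigPoly_mem_eigenspace_iff (a : ℝ) (w : freqSphere (lattice Γ) a → V) :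
    trigPoly (lattice Γ) a w ∈ eigenspace τ Γ a ↔ w ∈ (holonomyRep Γ τ a).invariants := by
  have hbot := trigPoly_mem_eigenspace_bot (lattice Γ) τ a w
  constructor
  · intro h q
    obtain ⟨γ, rfl⟩ := QuotientGroup.mk_surjective q
    refine trigPoly_injective (lattice Γ) a (funext fun x => ?_)
    obtain ⟨y, rfl⟩ := γ.1.surjective x
    rw [holonomyRep_mk, trigPoly_coeffAct, h.2.1 _ γ.2]
  · intro h
    refine ⟨hbot.1, fun γ hγ x => ?_, hbot.2.2⟩
    have h1 := h (QuotientGroup.mk (⟨γ, hγ⟩ : Γ))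
    rw [holonomyRep_mk] at h1
    have h2 := trigPoly_coeffAct Γ τ a ⟨γ, hγ⟩ w x
    rwa [h1] at h2

/-- The eigenspace of the connection Laplacian consists of the trigonometric polynomials whose
coefficients are invariant under the holonomy group. -/
theorem map_trigPoly_invariants (a : ℝ) :
    (holonomyRep Γ τ a).invariants.map (trigPoly (lattice Γ) a) = eigenspace τ Γ a := by
  ext f
  constructor
  · rintro ⟨w, hw, rfl⟩
    exact (trigPoly_mem_eigenspace_iff Γ τ a w).2 hw
  · intro hf
    have h2 : (2 : WithTop ℕ∞) ≤ ∞ := WithTop.coe_le_coe.2 (le_top : (2 : ℕ∞) ≤ ⊤)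
    obtain ⟨w, rfl⟩ := exists_trigPoly_eq (lattice Γ) (hf.1.of_le h2)
      (fun l hl x => eigenspace_periodic hf hl x) hf.2.2
    exact ⟨w, (trigPoly_mem_eigenspace_iff Γ τ a w).1 hf, rfl⟩

theorem finiteDimensional_eigenspace (a : ℝ) : FiniteDimensional ℂ (eigenspace τ Γ a) := by
  rw [← map_trigPoly_invariants]; infer_instance

theorem mult_eq_finrank_invariants (a : ℝ) :
    mult τ Γ a = finrank ℂ (holonomyRep Γ τ a).invariants := by
  rw [mult, ← map_trigPoly_invariants]
  exact (Submodule.equivMapOfInjective _ (trigPoly_injective (lattice Γ) a) _).finrank_eq.symm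

/-- The trace of a weighted permutation of the coordinates. -/
theorem trace_coeffAct (a : ℝ) (γ : Γ) : LinearMap.trace ℂ _ (coeffAct Γ τ a γ) =
    LinearMap.trace ℂ V (τ (linearPart n γ)) *
      ∑ v : freqSphere (lattice Γ) a, open Classical in
        if linearPart n γ v = (v : E n) then chr (-(v : E n)) (γ.1 0) else 0 := by
  classical
  have h : coeffAct Γ τ a γ = ∑ v : freqSphere (lattice Γ) a, chr (-(v : E n)) (γ.1 0) •
      (LinearMap.single ℂ (fun _ : freqSphere (lattice Γ) a => V) v ∘ₗ
        (τ (linearPart n γ) ∘ₗ LinearMap.proj (freqPerm Γ a γ v))) := by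
    refine LinearMap.ext fun w => funext fun u => ?_
    simp only [LinearMap.sum_apply, Finset.sum_apply, LinearMap.smul_apply, Pi.smul_apply,
      LinearMap.comp_apply, LinearMap.proj_apply, LinearMap.single_apply, coeffAct_apply]
    rw [Finset.sum_eq_single u]
    · simp
    · intro v _ hv
      rw [Pi.single_eq_of_ne hv.symm, smul_zero]
    · simp
  rw [h, map_sum, Finset.mul_sum]
  refine Finset.sum_congr rfl fun v _ => ?_
  rw [map_smul, LinearMap.trace_comp_comm', LinearMap.comp_assoc]
  have hiff : linearPart n γ v = (v : E n) ↔ freqPerm Γ a γ v = v := by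
    rw [← Subtype.coe_inj, coe_freqPerm, LinearIsometryEquiv.symm_apply_eq, eq_comm]
  by_cases hv : freqPerm Γ a γ v = v
  · rw [if_pos (hiff.2 hv), hv, LinearMap.proj_comp_single_same, LinearMap.comp_id, smul_eq_mul,
      mul_comm]
  · rw [if_neg (mt hiff.1 hv), LinearMap.proj_comp_single_ne ℂ _ _ _ hv]
    simp

/-- The dimension of the invariants of the holonomy group is the average of the traces. -/
theorem mult_eq_sum [Finite (Holonomy Γ)] (rep : Holonomy Γ → Γ)
    (hrep : ∀ q, (QuotientGroup.mk (rep q) : Holonomy Γ) = q) (a : ℝ) :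
    (mult τ Γ a : ℂ) = (Nat.card (Holonomy Γ) : ℂ)⁻¹ * ∑ᶠ q : Holonomy Γ,
      LinearMap.trace ℂ V (τ (linearPart n (rep q))) *
        ∑ v : freqSphere (lattice Γ) a, open Classical in
          if linearPart n (rep q) v = (v : E n) then chr (-(v : E n)) ((rep q).1 0) else 0 := by
  have := Fintype.ofFinite (Holonomy Γ)
  have hne : (Nat.card (Holonomy Γ) : ℂ) ≠ 0 := by exact_mod_cast Nat.card_pos.ne'
  have : Invertible (Nat.card (Holonomy Γ) : ℂ) := invertibleOfNonzero hne
  rw [mult_eq_finrank_invariants, ← Representation.card_inv_mul_sum_char_eq_finrank,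
    finsum_eq_sum_of_fintype]
  congr 1
  refine Finset.sum_congr rfl fun q _ => ?_
  rw [← trace_coeffAct, ← holonomyRep_mk, hrep]; rfl

end Action

section Torus

variable {n : ℕ} (Γ : Subgroup (Isom n)) [DiscreteTopology (lattice Γ)] [IsZLattice ℝ (lattice Γ)]
  {V : Type*} [NormedAddCommGroup V] [NormedSpace ℂ V] [FiniteDimensional ℂ V]
  (τ : Representation ℂ (O n) V)

/-- For the group of translations, all coefficients of trigonometric polynomials are invariant. -/
theorem mult_translationGroup (a : ℝ) : mult τ (translationGroup Γ) a =
    Fintype.card (freqSphere (lattice Γ) a) * finrank ℂ V := by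
  have h : (eigenspace τ (translationGroup Γ) a) = LinearMap.range (trigPoly (lattice Γ) a) := by
    ext f
    constructor
    · intro hf
      have h2 : (2 : WithTop ℕ∞) ≤ ∞ := WithTop.coe_le_coe.2 (le_top : (2 : ℕ∞) ≤ ⊤)
      obtain ⟨w, rfl⟩ := exists_trigPoly_eq (lattice Γ) (hf.1.of_le h2)
        (fun l hl x => eigenspace_periodic hf (l := l) ⟨hl, linearPart_constVAdd l⟩ x) hf.2.2
      exact ⟨w, rfl⟩
    · rintro ⟨w, rfl⟩
      have hbot := trigPoly_mem_eigenspace_bot (lattice Γ) τ a w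
      refine ⟨hbot.1, fun γ hγ x => ?_, hbot.2.2⟩
      have h1 : linearPart n γ = 1 := hγ.2
      rw [h1, map_one, apply_eq_add γ x, h1]
      exact trigPoly_add _ w (apply_zero_mem_lattice hγ.1 h1) x
  rw [mult, h, LinearMap.finrank_range_of_inj (trigPoly_injective _ a), finrank_pi_fintype,
    Finset.sum_const, smul_eq_mul, Finset.card_univ]

end Torus

/-! ### The heat trace -/

section Fixed

variable {n : ℕ}

theorem mem_fixedSpace {B : O n} {x : E n} : x ∈ fixedSpace B ↔ B x = x := by
  rw [fixedSpace, LinearMap.mem_ker]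
  exact sub_eq_zero

/-- The orthogonal projection onto `ker (B - Id)`, with values in this subspace. -/
def projFixed (B : O n) : E n →L[ℝ] fixedSpace B := (fixedSpace B).orthogonalProjectionOnto

theorem coe_projFixed (B : O n) (x : E n) : (projFixed B x : E n) = fixedProj B x := rfl

theorem inner_projFixed (B : O n) (w : fixedSpace B) (x : E n) :
    ⟪w, projFixed B x⟫ = ⟪(w : E n), x⟫ :=
  Submodule.inner_orthogonalProjectionOnto_eq_of_mem_left w x

theorem projFixed_of_mem {B : O n} {x : E n} (hx : B x = x) : (projFixed B x : E n) = x :=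
  Submodule.starProjection_eq_self_iff.2 (mem_fixedSpace.2 hx)

theorem projFixed_apply (B : O n) (x : E n) : projFixed B (B x) = projFixed B x := by
  refine ext_inner_left ℝ fun w => ?_
  rw [inner_projFixed, inner_projFixed]
  have hw : B w = (w : E n) := mem_fixedSpace.1 w.2
  conv_lhs => rw [← hw]
  exact B.inner_map_map _ _

theorem projFixed_pow_apply (B : O n) (k : ℕ) (x : E n) :
    projFixed B ((B ^ k) x) = projFixed B x := by
  induction k with
  | zero => rfl
  | succ k ih => rw [pow_succ', LinearIsometryEquiv.coe_mul, Function.comp_apply, projFixed_apply, ih]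

variable (Γ : Subgroup (Isom n)) (B : O n)

/-- The projection `p_B(Λ)` of the lattice of translations to `ker (B - Id)`. -/
def projLattice : Submodule ℤ (fixedSpace B) :=
  (lattice Γ).map ((projFixed B).toLinearMap.restrictScalars ℤ)

theorem dualOf_projLattice :
    dualOf (projLattice Γ B) = fixedLattice (dualLattice (lattice Γ)) B := by
  ext w
  rw [mem_dualOf]
  constructor
  · intro h l hl
    obtain ⟨k, hk⟩ := h _ ⟨l, hl, rfl⟩
    exact ⟨k, by rw [← hk]; exact (inner_projFixed B w l).symm⟩
  · rintro h _ ⟨l, hl, rfl⟩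
    obtain ⟨k, hk⟩ := h l hl
    exact ⟨k, by rw [← hk]; exact inner_projFixed B w l⟩

variable {Γ} {γ : Isom n}

theorem IsBieberbach.exists_pow_linearPart_eq_one (hΓ : IsBieberbach Γ) (hγ : γ ∈ Γ) :
    ∃ N : ℕ, 0 < N ∧ linearPart n γ ^ N = 1 := by
  have := hΓ.finite_holonomy
  obtain ⟨N, hN, h⟩ :=
    (isOfFinOrder_of_finite (QuotientGroup.mk (⟨γ, hγ⟩ : Γ) : Holonomy Γ)).exists_pow_eq_one
  refine ⟨N, hN, ?_⟩
  have h1 := congrArg (holonomyLin Γ) h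
  rwa [map_pow, map_one] at h1

/-- A multiple of the projection `p_B(λ)` of a lattice vector is again a lattice vector, namely the
sum of the orbit of `λ` under `B`. -/
theorem IsBieberbach.exists_nsmul_projFixed_mem (hΓ : IsBieberbach Γ) (hγ : γ ∈ Γ) :
    ∃ N : ℕ, 0 < N ∧ ∀ l ∈ lattice Γ,
      N • (projFixed (linearPart n γ) l : E n) ∈ lattice Γ := by
  obtain ⟨N, hN, hpow⟩ := hΓ.exists_pow_linearPart_eq_one hγ
  refine ⟨N, hN, fun l hl => ?_⟩
  set B := linearPart n γ with hB
  set z := ∑ k ∈ Finset.range N, (B ^ k) l with hz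
  have hzmem : z ∈ lattice Γ := by
    refine Submodule.sum_mem _ fun k _ => ?_
    rw [hB, ← map_pow]
    exact linearPart_mem_lattice (Γ.pow_mem hγ k) hl
  have hBz : B z = z := by
    have h1 : ∑ k ∈ Finset.range N, (B ^ (k + 1)) l = z := by
      have h2 := Finset.sum_range_succ' (fun k => (B ^ k) l) N
      rw [Finset.sum_range_succ, hpow, pow_zero] at h2
      exact (add_right_cancel h2).symm
    conv_rhs => rw [← h1]
    rw [hz, map_sum]
    refine Finset.sum_congr rfl fun k _ => ?_
    rw [pow_succ', LinearIsometryEquiv.coe_mul, Function.comp_apply]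
  have hpz : projFixed B z = N • projFixed B l := by
    rw [hz, map_sum]
    simp [projFixed_pow_apply]
  have h3 := projFixed_of_mem hBz
  rw [hpz] at h3
  change ((N • projFixed B l : fixedSpace B) : E n) ∈ _
  rw [h3]; exact hzmem

theorem IsBieberbach.discreteTopology_projLattice (hΓ : IsBieberbach Γ) (hγ : γ ∈ Γ) :
    DiscreteTopology (projLattice Γ (linearPart n γ)) := by
  obtain ⟨ε, hε, h⟩ := hΓ.exists_lattice_gap
  obtain ⟨N, hN, hmem⟩ := hΓ.exists_nsmul_projFixed_mem hγ
  have hN' : (0 : ℝ) < N := by exact_mod_cast hN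
  rw [discreteTopology_iff_isOpen_singleton_zero, Metric.isOpen_singleton_iff]
  refine ⟨ε / N, by positivity, ?_⟩
  rintro ⟨_, l, hl, rfl⟩ hy
  rw [dist_zero_right] at hy
  have hy : ‖(projFixed (linearPart n γ) l : E n)‖ < ε / N := hy
  have h1 := h _ (hmem l hl) (by
    rw [← Nat.cast_smul_eq_nsmul ℝ, norm_smul, Real.norm_of_nonneg hN'.le]
    rwa [lt_div_iff₀' hN'] at hy)
  rw [← Nat.cast_smul_eq_nsmul ℝ, smul_eq_zero] at h1
  exact Subtype.ext (Subtype.ext (h1.resolve_left hN'.ne'))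

theorem IsBieberbach.isZLattice_projLattice (hΓ : IsBieberbach Γ) (B : O n)
    [DiscreteTopology (projLattice Γ B)] : IsZLattice ℝ (projLattice Γ B) where
  span_top := by
    have h : (projLattice Γ B : Set (fixedSpace B)) =
        (projFixed B).toLinearMap '' (lattice Γ : Set (E n)) := rfl
    rw [h, Submodule.span_image, hΓ.span_lattice, Submodule.map_top, LinearMap.range_eq_top]
    intro w
    exact ⟨w, Subtype.ext (projFixed_of_mem (mem_fixedSpace.1 w.2))⟩

/-- The index set of the inner sum of the heat trace, as a lattice in `ker (B - Id)`. -/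
def projLatticeEquiv (Γ : Subgroup (Isom n)) (B : O n) : projLattice Γ B ≃
    (fixedProj B '' (lattice Γ : Set (E n)) : Set (E n)) where
  toFun w := ⟨w, by
    obtain ⟨l, hl, h⟩ := w.2
    exact ⟨l, hl, congrArg Subtype.val h⟩⟩
  invFun v := ⟨⟨v, by
    obtain ⟨l, hl, h⟩ := v.2
    rw [← h]
    exact (projFixed B l).2⟩, by
    obtain ⟨l, hl, h⟩ := v.2
    exact ⟨l, hl, Subtype.ext h⟩⟩
  left_inv w := rfl
  right_inv v := rfl

theorem heatTerm_projLatticeEquiv (s : ℝ) (w : projLattice Γ (linearPart n γ)) :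
    heatTerm Γ γ s (projLatticeEquiv Γ _ w) = Real.exp (-((4 * s)⁻¹ *
      ‖(w : fixedSpace (linearPart n γ)) + projFixed (linearPart n γ) (transPart γ)‖ ^ 2)) := by
  rw [heatTerm]
  congr 1
  rw [neg_div, div_eq_inv_mul]
  rfl

theorem IsBieberbach.summable_heatTerm (hΓ : IsBieberbach Γ) (hγ : γ ∈ Γ) {s : ℝ} (hs : 0 < s) :
    Summable (heatTerm Γ γ s) := by
  have := hΓ.discreteTopology_projLattice hγ
  have := hΓ.isZLattice_projLattice (linearPart n γ)
  rw [← (projLatticeEquiv Γ (linearPart n γ)).summable_iff]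
  refine (summable_gaussian_translate (projLattice Γ (linearPart n γ)) (c := (4 * s)⁻¹)
    (by positivity) (projFixed _ (transPart γ))).congr fun w => ?_
  exact (heatTerm_projLatticeEquiv s w).symm

theorem IsBieberbach.latticeVol_pos (hΓ : IsBieberbach Γ) (hγ : γ ∈ Γ) :
    0 < latticeVol (fixedLattice (dualLattice (lattice Γ)) (linearPart n γ)) := by
  have := hΓ.discreteTopology_projLattice hγ
  have := hΓ.isZLattice_projLattice (linearPart n γ)
  rw [← dualOf_projLattice]
  exact ZLattice.covolume_pos (dualOf (projLattice Γ (linearPart n γ))) volume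

/-- The contribution of `γ = B L_b` to the heat trace, as a sum over the fixed frequencies. -/
theorem IsBieberbach.hasSum_fixedLattice (hΓ : IsBieberbach Γ) (hγ : γ ∈ Γ) {s : ℝ} (hs : 0 < s) :
    HasSum (fun v : fixedLattice (dualLattice (lattice Γ)) (linearPart n γ) =>
        chr (-(v : E n)) (transPart γ) *
          (Real.exp (-(4 * Real.pi ^ 2 * ‖(v : E n)‖ ^ 2 * s)) : ℂ))
      (((latticeVol (fixedLattice (dualLattice (lattice Γ)) (linearPart n γ)))⁻¹ *
        (4 * Real.pi * s) ^ (-(fixedDim (linearPart n γ) : ℝ) / 2) *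
        ∑' v, heatTerm Γ γ s v : ℝ) : ℂ) := by
  have := hΓ.discreteTopology_projLattice hγ
  have := hΓ.isZLattice_projLattice (linearPart n γ)
  have h := hasSum_poisson (projLattice Γ (linearPart n γ)) hs (projFixed _ (transPart γ))
  rw [← (Equiv.neg _).hasSum_iff] at h
  have e : ∑' v, heatTerm Γ γ s v = ∑' w : projLattice Γ (linearPart n γ),
      Real.exp (-((4 * s)⁻¹ * ‖(w : fixedSpace (linearPart n γ)) +
        projFixed (linearPart n γ) (transPart γ)‖ ^ 2)) := by
    rw [← (projLatticeEquiv Γ (linearPart n γ)).tsum_eq]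
    exact tsum_congr fun w => heatTerm_projLatticeEquiv s w
  rw [e, ← dualOf_projLattice]
  refine Eq.mp ?_ h
  congr 1
  ext v
  simp only [Function.comp_apply, Equiv.neg_apply, chr, Submodule.coe_neg, norm_neg]
  rw [inner_projFixed]
  rfl

end Fixed

section Trace

variable {n : ℕ} {Γ : Subgroup (Isom n)}

theorem transPart_eq (γ : Isom n) : linearPart n γ (transPart γ) = γ 0 := by
  rw [transPart, LinearIsometryEquiv.apply_symm_apply]

theorem chr_apply_zero_of_fixed {γ : Isom n} {v : E n} (hv : linearPart n γ v = v) :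
    chr (-v) (γ 0) = chr (-v) (transPart γ) := by
  have h : ⟪-v, γ 0⟫ = ⟪-v, transPart γ⟫ := by
    rw [← transPart_eq]
    conv_lhs => rw [← hv, ← map_neg]
    exact (linearPart n γ).inner_map_map _ _
  rw [chr, chr, h]

/-- A sum over the dual lattice, grouped by the norm of the frequency. -/
theorem hasSum_freqSphere (L : Submodule ℤ (E n)) [DiscreteTopology L] [IsZLattice ℝ L]
    {F : E n → ℂ} {z : ℂ} (h : HasSum (fun v : dualOf L => F v) z) :
    HasSum (fun μ : NNReal => ∑ v : freqSphere L (4 * Real.pi ^ 2 * μ), F v) z := by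
  let f : dualOf L → NNReal := fun v => ‖(v : E n)‖₊ ^ 2
  rw [← (Equiv.sigmaFiberEquiv f).hasSum_iff] at h
  refine h.sigma fun μ => ?_
  let e : {v : dualOf L // f v = μ} ≃ freqSphere L (4 * Real.pi ^ 2 * μ) :=
    { toFun := fun v => ⟨v.1, v.1.2, by
        have := congrArg NNReal.toReal v.2
        simp only [f, NNReal.coe_pow, coe_nnnorm] at this
        rw [this]⟩
      invFun := fun v => ⟨⟨v, v.2.1⟩, by
        have h := v.2.2
        have h4 : (4 * Real.pi ^ 2 : ℝ) ≠ 0 := by positivity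
        apply NNReal.coe_injective
        simp only [f, NNReal.coe_pow, coe_nnnorm]
        exact mul_left_cancel₀ h4 h⟩
      left_inv := fun v => rfl
      right_inv := fun v => rfl }
  have h1 := hasSum_fintype fun v : freqSphere L (4 * Real.pi ^ 2 * μ) => F v
  rw [← e.hasSum_iff] at h1
  exact h1

theorem IsBieberbach.hasSum_fixed_freqSphere (hΓ : IsBieberbach Γ)
    [DiscreteTopology (lattice Γ)] [IsZLattice ℝ (lattice Γ)] {γ : Isom n} (hγ : γ ∈ Γ) {s : ℝ}
    (hs : 0 < s) :
    HasSum (fun μ : NNReal => (∑ v : freqSphere (lattice Γ) (4 * Real.pi ^ 2 * μ),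
        open Classical in if linearPart n γ v = (v : E n) then chr (-(v : E n)) (γ 0) else 0) *
        (Real.exp (-(4 * Real.pi ^ 2 * μ * s)) : ℂ))
      (((latticeVol (fixedLattice (dualLattice (lattice Γ)) (linearPart n γ)))⁻¹ *
        (4 * Real.pi * s) ^ (-(fixedDim (linearPart n γ) : ℝ) / 2) *
        ∑' v, heatTerm Γ γ s v : ℝ) : ℂ) := by
  classical
  have h := hΓ.hasSum_fixedLattice hγ hs
  let F : E n → ℂ := fun v => (if linearPart n γ v = v then chr (-v) (γ 0) else 0) *
    (Real.exp (-(4 * Real.pi ^ 2 * ‖v‖ ^ 2 * s)) : ℂ)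
  have e : (fun μ : NNReal => (∑ v : freqSphere (lattice Γ) (4 * Real.pi ^ 2 * μ),
        if linearPart n γ v = (v : E n) then chr (-(v : E n)) (γ 0) else 0) *
        (Real.exp (-(4 * Real.pi ^ 2 * μ * s)) : ℂ)) =
      fun μ : NNReal => ∑ v : freqSphere (lattice Γ) (4 * Real.pi ^ 2 * μ), F v := by
    ext μ
    rw [Finset.sum_mul]
    refine Finset.sum_congr rfl fun v _ => ?_
    simp only [F]
    rw [v.2.2]
  rw [e]
  refine hasSum_freqSphere (lattice Γ) ?_
  · let ι : fixedLattice (dualLattice (lattice Γ)) (linearPart n γ) → dualOf (lattice Γ) :=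
      fun v => ⟨(v : fixedSpace (linearPart n γ)), by
        rw [← dualLattice_eq_dualOf]; exact v.2⟩
    have hι : Function.Injective ι := fun v w hvw =>
      Subtype.ext (Subtype.ext (congrArg (Subtype.val : dualOf (lattice Γ) → E n) hvw))
    rw [← hι.hasSum_iff]
    · refine Eq.mp ?_ h
      congr 1
      ext v
      have hv : linearPart n γ (v : fixedSpace (linearPart n γ)) =
        ((v : fixedSpace (linearPart n γ)) : E n) := mem_fixedSpace.1 v.1.2
      simp only [Function.comp_apply, F, ι]
      rw [if_pos hv, chr_apply_zero_of_fixed hv]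
    · intro v hv
      simp only [F]
      rw [if_neg, zero_mul]
      intro hfix
      apply hv
      exact ⟨⟨⟨v, mem_fixedSpace.2 hfix⟩, by
        exact (SetLike.ext_iff.1 (dualLattice_eq_dualOf (lattice Γ)) (v : E n)).2 v.2⟩, rfl⟩

/-- The heat trace of the connection Laplacian. -/
theorem IsBieberbach.hasSum_heatTrace (hΓ : IsBieberbach Γ) {V : Type*} [NormedAddCommGroup V]
    [NormedSpace ℂ V] [FiniteDimensional ℂ V] (τ : Representation ℂ (O n) V)
    (rep : Holonomy Γ → Γ) (hrep : ∀ q, (QuotientGroup.mk (rep q) : Holonomy Γ) = q) {s : ℝ}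
    (hs : 0 < s) :
    HasSum (fun μ : NNReal => (dmult τ Γ μ : ℂ) * (Real.exp (-(4 * Real.pi ^ 2 * μ * s)) : ℂ))
      ((Nat.card (Holonomy Γ) : ℂ)⁻¹ * ∑ᶠ q : Holonomy Γ,
        LinearMap.trace ℂ V (τ (linearPart n (rep q))) *
          (((latticeVol (fixedLattice (dualLattice (lattice Γ)) (linearPart n (rep q))))⁻¹ *
            (4 * Real.pi * s) ^ (-(fixedDim (linearPart n (rep q)) : ℝ) / 2) *
            ∑' v, heatTerm Γ (rep q) s v : ℝ) : ℂ)) := by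
  have := hΓ.discreteTopology_lattice
  have := hΓ.isZLattice
  have := hΓ.finite_holonomy
  have := Fintype.ofFinite (Holonomy Γ)
  rw [finsum_eq_sum_of_fintype]
  have h := (hasSum_sum (s := Finset.univ) fun q (_ : q ∈ Finset.univ) =>
    (hΓ.hasSum_fixed_freqSphere (rep q).2 hs).mul_left
      (LinearMap.trace ℂ V (τ (linearPart n (rep q))))).mul_left
        ((Nat.card (Holonomy Γ) : ℂ)⁻¹)
  refine Eq.mp ?_ h
  congr 1
  ext μ
  have hd : dmult τ Γ μ = mult τ Γ (4 * Real.pi ^ 2 * μ) := rfl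
  rw [hd, mult_eq_sum Γ τ rep hrep, finsum_eq_sum_of_fintype,
    mul_assoc (Nat.card (Holonomy Γ) : ℂ)⁻¹, Finset.sum_mul]
  simp only [mul_assoc]

end Trace

/-! ### Uniqueness of heat trace expansions -/

section Uniqueness

theorem finite_of_summable_exp {X : Type*} {r : X → ℝ}
    (hs : Summable fun x => Real.exp (-(r x))) (R : ℝ) : {x | r x ≤ R}.Finite := by
  have h := hs.tendsto_cofinite_zero.eventually (gt_mem_nhds (Real.exp_pos (-R)))
  rw [eventually_cofinite] at h
  refine h.subset fun x hx => ?_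
  simp only [Set.mem_ofPred_eq, not_lt, Real.exp_le_exp, neg_le_neg_iff]
  exact hx

theorem tendsto_pow_mul_exp_neg_mul_sq (N : ℕ) {δ : ℝ} (hδ : 0 < δ) :
    Tendsto (fun u : ℝ => u ^ N * Real.exp (-(δ * u ^ 2))) atTop (𝓝 0) := by
  have h1 : Tendsto (fun u : ℝ => (δ * u) ^ N * Real.exp (-(δ * u))) atTop (𝓝 0) :=
    (Real.tendsto_pow_mul_exp_neg_atTop_nhds_zero N).comp (tendsto_id.const_mul_atTop hδ)
  have h2 := h1.const_mul ((δ ^ N)⁻¹)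
  rw [mul_zero] at h2
  refine squeeze_zero' ?_ ?_ h2
  · filter_upwards [eventually_ge_atTop 1] with u hu
    positivity
  · filter_upwards [eventually_ge_atTop 1] with u hu
    rw [mul_pow, ← mul_assoc, inv_mul_cancel_left₀ (by positivity)]
    gcongr
    nlinarith

variable {X : Type*} {c : X → ℝ} {d : X → ℕ} {r : X → ℝ} {N : ℕ} {C : ℝ}

/-- If `∑ cₓ u^{dₓ} exp (-rₓ u²)` vanishes for all large `u`, then the coefficients with equal
exponents add up to zero. Otherwise, for the smallest exponent `ρ` for which this fails,
multiplication by `exp (ρ u²)` exhibits a nonzero polynomial in `u` which tends to `0`. -/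
theorem sum_coeff_eq_zero (hN : ∀ x, d x ≤ N) (hC : ∀ x, |c x| ≤ C)
    (hs : Summable fun x => Real.exp (-(r x)))
    (h : ∀ u : ℝ, 1 ≤ u → ∑' x, c x * u ^ d x * Real.exp (-(r x * u ^ 2)) = 0) (k : ℕ) (ρ : ℝ) :
    ∑' x, (open Classical in if d x = k ∧ r x = ρ then c x else 0) = 0 := by
  classical
  have hfin := finite_of_summable_exp hs
  set S : ℕ → ℝ → ℝ := fun k ρ => ∑' x, if d x = k ∧ r x = ρ then c x else 0 with hS
  by_contra hne
  have hbad : ∃ x, ∃ k, S k (r x) ≠ 0 := by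
    by_contra! hall
    have : ∃ x, r x = ρ := by
      by_contra! hx
      exact hne (by simp [hx])
    obtain ⟨x, rfl⟩ := this
    exact hne (hall x k)
  obtain ⟨x₁, hx₁⟩ := hbad
  have hsub : {x | r x ≤ r x₁ ∧ ∃ k, S k (r x) ≠ 0}.Finite :=
    (hfin (r x₁)).subset fun x hx => hx.1
  obtain ⟨x₀, ⟨hx₀1, k₀, hk₀⟩, hmin⟩ := Set.exists_min_image _ r hsub ⟨x₁, le_rfl, hx₁⟩
  set ρ₀ := r x₀ with hρ₀
  have hbelow : ∀ x, r x < ρ₀ → ∀ k, S k (r x) = 0 := by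
    intro x hx k
    by_contra hk
    exact absurd (hmin x ⟨hx.le.trans hx₀1, k, hk⟩) (not_le.2 hx)
  set T := (hfin ρ₀).toFinset with hT
  have hmemT : ∀ x, x ∈ T ↔ r x ≤ ρ₀ := fun x => by simp [hT]
  have hSfin : ∀ k, ∀ ρ ≤ ρ₀, S k ρ = ∑ x ∈ T with r x = ρ ∧ d x = k, c x := by
    intro k ρ hρ
    rw [hS, Finset.sum_filter]
    simp only [and_comm (a := d _ = k)]
    refine tsum_eq_sum fun x hx => if_neg fun hx' => hx ?_
    rw [hmemT, hx'.1]; exact hρ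
  -- the finite part of the sum
  have hfinpart : ∀ u : ℝ, ∑ x ∈ T, c x * u ^ d x * Real.exp (-(r x * u ^ 2)) =
      (∑ k ∈ Finset.range (N + 1), S k ρ₀ * u ^ k) * Real.exp (-(ρ₀ * u ^ 2)) := by
    intro u
    have hgroup : ∀ ρ ≤ ρ₀, ∑ x ∈ T with r x = ρ, c x * u ^ d x * Real.exp (-(r x * u ^ 2)) =
        (∑ k ∈ Finset.range (N + 1), S k ρ * u ^ k) * Real.exp (-(ρ * u ^ 2)) := by
      intro ρ hρ
      rw [← Finset.sum_fiberwise_of_maps_to (t := Finset.range (N + 1)) (g := d)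
        (fun x _ => Finset.mem_range.2 (Nat.lt_succ_of_le (hN x))), Finset.sum_mul]
      refine Finset.sum_congr rfl fun k _ => ?_
      rw [hSfin k ρ hρ, Finset.sum_mul, Finset.sum_mul, Finset.filter_filter]
      refine Finset.sum_congr rfl fun x hx => ?_
      rw [Finset.mem_filter] at hx
      rw [hx.2.1, hx.2.2]
    rw [← Finset.sum_fiberwise_of_maps_to (t := T.image r) (g := r)
      (fun x hx => Finset.mem_image_of_mem r hx)]
    rw [Finset.sum_eq_single ρ₀]
    · exact hgroup ρ₀ le_rfl
    · intro ρ hρ hne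
      obtain ⟨x, hx, rfl⟩ := Finset.mem_image.1 hρ
      have hle := (hmemT x).1 hx
      rw [hgroup _ hle]
      simp [hbelow x (lt_of_le_of_ne hle hne)]
    · intro h0
      exact absurd (Finset.mem_image_of_mem r ((hmemT x₀).2 le_rfl)) h0
  -- a gap above the smallest exponent
  obtain ⟨δ, hδ, hgap⟩ : ∃ δ > 0, ∀ x ∉ T, ρ₀ + δ ≤ r x := by
    by_cases hY : {x | r x ≤ ρ₀ + 1 ∧ ρ₀ < r x}.Nonempty
    · obtain ⟨y, hy, hymin⟩ := Set.exists_min_image _ r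
        ((hfin (ρ₀ + 1)).subset fun x (hx : r x ≤ ρ₀ + 1 ∧ ρ₀ < r x) => hx.1) hY
      refine ⟨r y - ρ₀, sub_pos.2 hy.2, fun x hx => ?_⟩
      rw [hmemT, not_le] at hx
      by_cases hx1 : r x ≤ ρ₀ + 1
      · linarith [hymin x ⟨hx1, hx⟩]
      · linarith [hy.1]
    · refine ⟨1, one_pos, fun x hx => ?_⟩
      rw [hmemT, not_le] at hx
      by_contra! hlt
      exact hY ⟨x, hlt.le, hx⟩
  set K := ∑' x : {x // x ∉ T}, Real.exp (-(r x)) with hK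
  have hC0 : 0 ≤ C := (abs_nonneg _).trans (hC x₀)
  have hterm : ∀ u : ℝ, 1 ≤ u → ∀ x ∉ T, ‖c x * u ^ d x * Real.exp (-(r x * u ^ 2))‖ ≤
      C * u ^ N * Real.exp (-((ρ₀ + δ) * (u ^ 2 - 1))) * Real.exp (-(r x)) := by
    intro u hu x hx
    have h1 : Real.exp (-(r x * u ^ 2)) =
        Real.exp (-(r x * (u ^ 2 - 1))) * Real.exp (-(r x)) := by
      rw [← Real.exp_add]; congr 1; ring
    have hu2 : 0 ≤ u ^ 2 - 1 := by nlinarith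
    rw [h1, ← mul_assoc, norm_mul, norm_mul, norm_mul, Real.norm_of_nonneg (Real.exp_pos _).le,
      Real.norm_of_nonneg (Real.exp_pos _).le, norm_pow, Real.norm_of_nonneg (by linarith : 0 ≤ u)]
    gcongr
    · exact hC x
    · exact hN x
    · exact hgap x hx
  have hsumm : ∀ u : ℝ, 1 ≤ u → Summable fun x => c x * u ^ d x * Real.exp (-(r x * u ^ 2)) := by
    intro u hu
    rw [← (T.finite_toSet).summable_compl_iff]
    exact Summable.of_norm_bounded ((hs.subtype _).mul_left _) fun x => hterm u hu x x.2
  have hbound : ∀ u : ℝ, 1 ≤ u → ‖∑ k ∈ Finset.range (N + 1), S k ρ₀ * u ^ k‖ ≤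
      C * K * Real.exp (ρ₀ + δ) * (u ^ N * Real.exp (-(δ * u ^ 2))) := by
    intro u hu
    have h1 := (hsumm u hu).sum_add_tsum_subtype_compl T
    rw [h u hu, hfinpart] at h1
    have h2 : ‖∑' x : {x // x ∉ T}, c x * u ^ d x * Real.exp (-(r x * u ^ 2))‖ ≤
        C * u ^ N * Real.exp (-((ρ₀ + δ) * (u ^ 2 - 1))) * K := by
      refine tsum_of_norm_bounded ?_ fun x => hterm u hu x x.2
      exact (hs.subtype _).hasSum.mul_left _
    have h3 : (∑ k ∈ Finset.range (N + 1), S k ρ₀ * u ^ k) =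
        -(∑' x : {x // x ∉ T}, c x * u ^ d x * Real.exp (-(r x * u ^ 2))) *
          Real.exp (ρ₀ * u ^ 2) := by
      have h4 : Real.exp (-(ρ₀ * u ^ 2)) * Real.exp (ρ₀ * u ^ 2) = 1 := by
        rw [← Real.exp_add]; simp
      linear_combination Real.exp (ρ₀ * u ^ 2) * h1 -
        (∑ k ∈ Finset.range (N + 1), S k ρ₀ * u ^ k) * h4
    rw [h3, norm_mul, norm_neg, Real.norm_of_nonneg (Real.exp_pos _).le]
    refine (mul_le_mul_of_nonneg_right h2 (Real.exp_pos _).le).trans (le_of_eq ?_)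
    have h5 : Real.exp (-((ρ₀ + δ) * (u ^ 2 - 1))) * Real.exp (ρ₀ * u ^ 2) =
        Real.exp (ρ₀ + δ) * Real.exp (-(δ * u ^ 2)) := by
      rw [← Real.exp_add, ← Real.exp_add]; congr 1; ring
    linear_combination C * u ^ N * K * h5
  have hlim : Tendsto (fun u : ℝ => ∑ k ∈ Finset.range (N + 1), S k ρ₀ * u ^ k) atTop (𝓝 0) := by
    have h1 := (tendsto_pow_mul_exp_neg_mul_sq N hδ).const_mul (C * K * Real.exp (ρ₀ + δ))
    rw [mul_zero] at h1
    refine squeeze_zero_norm' ?_ h1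
    filter_upwards [eventually_ge_atTop 1] with u hu using hbound u hu
  let P : Polynomial ℝ := ∑ k ∈ Finset.range (N + 1), Polynomial.monomial k (S k ρ₀)
  have hP : ∀ u : ℝ, P.eval u = ∑ k ∈ Finset.range (N + 1), S k ρ₀ * u ^ k := fun u => by
    simp [P, Polynomial.eval_finsetSum]
  simp only [← hP] at hlim
  have hP0 : P = 0 := Polynomial.leadingCoeff_eq_zero.1 ((Polynomial.tendsto_nhds_iff P).1 hlim).1
  have hcoef : P.coeff k₀ = S k₀ ρ₀ := by
    simp only [P, Polynomial.finsetSum_coeff, Polynomial.coeff_monomial]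
    rw [Finset.sum_ite_eq']
    split_ifs with hk
    · rfl
    · rw [hSfin k₀ ρ₀ le_rfl, Finset.sum_eq_zero]
      intro x hx
      rw [Finset.mem_filter] at hx
      refine absurd (Finset.mem_range.2 (Nat.lt_succ_of_le ?_)) hk
      rw [← hx.2.2]; exact hN x
  rw [hP0, Polynomial.coeff_zero] at hcoef
  exact hk₀ hcoef.symm

theorem summable_ite_coeff_mul (hC : ∀ x, |c x| ≤ C) {g : ℝ → ℝ}
    (hg : Summable fun x => g (r x)) (k : ℕ) :
    Summable fun x => if d x = k then c x * g (r x) else 0 := by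
  refine Summable.of_norm_bounded (hg.norm.mul_left C) fun x => ?_
  split_ifs
  · rw [norm_mul]; gcongr; exact hC x
  · rw [norm_zero]; exact mul_nonneg ((abs_nonneg _).trans (hC x)) (norm_nonneg _)

theorem tsum_coeff_mul_eq_zero (hN : ∀ x, d x ≤ N) (hC : ∀ x, |c x| ≤ C)
    (hs : Summable fun x => Real.exp (-(r x)))
    (h : ∀ u : ℝ, 1 ≤ u → ∑' x, c x * u ^ d x * Real.exp (-(r x * u ^ 2)) = 0) (k : ℕ) (g : ℝ → ℝ)
    (hg : Summable fun x => g (r x)) :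
    ∑' x, (if d x = k then c x * g (r x) else 0) = 0 := by
  classical
  have hsum := summable_ite_coeff_mul (d := d) hC hg k
  refine ((Equiv.sigmaFiberEquiv r).tsum_eq _).symm.trans
    ((((Equiv.sigmaFiberEquiv r).summable_iff.2 hsum).tsum_sigma).trans ?_)
  refine (tsum_congr fun ρ => ?_).trans tsum_zero
  have h1 := sum_coeff_eq_zero hN hC hs h k ρ
  have h2 : ∑' x : {x // r x = ρ}, (if d (x : X) = k then c x * g (r x) else 0) =
      g ρ * ∑' x, (if d x = k ∧ r x = ρ then c x else 0) := by
    rw [← tsum_mul_left]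
    refine (tsum_subtype {x | r x = ρ} fun x => if d x = k then c x * g (r x) else 0).trans ?_
    refine tsum_congr fun x => ?_
    simp only [Set.indicator_apply, Set.mem_ofPred_eq]
    by_cases hx : r x = ρ
    · by_cases hd : d x = k
      · simp [hx, hd, mul_comm]
      · simp [hx, hd]
    · simp [hx]
  refine Eq.trans h2 ?_
  rw [h1, mul_zero]

theorem summable_coeff_mul (hN : ∀ x, d x ≤ N) (hC : ∀ x, |c x| ≤ C) (hr : ∀ x, 0 ≤ r x)
    (hs : Summable fun x => Real.exp (-(r x))) {u : ℝ} (hu : 1 ≤ u) :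
    Summable fun x => c x * u ^ d x * Real.exp (-(r x * u ^ 2)) := by
  refine Summable.of_norm_bounded (hs.mul_left (C * u ^ N)) fun x => ?_
  rw [norm_mul, norm_mul, Real.norm_of_nonneg (Real.exp_pos _).le, norm_pow,
    Real.norm_of_nonneg (by linarith : 0 ≤ u)]
  have hC0 : 0 ≤ C := (abs_nonneg _).trans (hC x)
  have hu2 : r x ≤ r x * u ^ 2 := le_mul_of_one_le_right (hr x) (by nlinarith)
  gcongr
  · exact hC x
  · exact hN x

/-- Equality of two expansions `∑ cₓ u^{dₓ} exp (-rₓ u²)` is an equality of the coefficients. -/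
theorem tsum_coeff_mul_eq {X' : Type*} {c' : X' → ℝ} {d' : X' → ℕ} {r' : X' → ℝ}
    (hN : ∀ x, d x ≤ N) (hN' : ∀ x, d' x ≤ N) (hC : ∀ x, |c x| ≤ C) (hC' : ∀ x, |c' x| ≤ C)
    (hr : ∀ x, 0 ≤ r x) (hr' : ∀ x, 0 ≤ r' x)
    (hs : Summable fun x => Real.exp (-(r x))) (hs' : Summable fun x => Real.exp (-(r' x)))
    (h : ∀ u : ℝ, 1 ≤ u → ∑' x, c x * u ^ d x * Real.exp (-(r x * u ^ 2)) =
      ∑' x, c' x * u ^ d' x * Real.exp (-(r' x * u ^ 2))) (k : ℕ) (g : ℝ → ℝ)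
    (hg : Summable fun x => g (r x)) (hg' : Summable fun x => g (r' x)) :
    ∑' x, (if d x = k then c x * g (r x) else 0) =
      ∑' x, (if d' x = k then c' x * g (r' x) else 0) := by
  let c₂ : X ⊕ X' → ℝ := Sum.elim c fun x => -c' x
  let d₂ : X ⊕ X' → ℕ := Sum.elim d d'
  let r₂ : X ⊕ X' → ℝ := Sum.elim r r'
  have hN₂ : ∀ x, d₂ x ≤ N := by
    rintro (x | x)
    exacts [hN x, hN' x]
  have hC₂ : ∀ x, |c₂ x| ≤ C := by
    rintro (x | x)
    exacts [hC x, (abs_neg (c' x)).le.trans (hC' x)]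
  have key := tsum_coeff_mul_eq_zero (c := c₂) (d := d₂) (r := r₂) hN₂ hC₂
    (Summable.sum (fun x => Real.exp (-(r₂ x))) hs hs') (fun u hu => ?_) k g
    (Summable.sum (fun x => g (r₂ x)) hg hg')
  · have h1 := HasSum.sum (f := fun x => if d₂ x = k then c₂ x * g (r₂ x) else 0)
      (summable_ite_coeff_mul (d := d) hC hg k).hasSum
      ((summable_ite_coeff_mul (d := d') hC' hg' k).hasSum.neg.congr_fun fun x => ?_)
    · rw [h1.tsum_eq] at key
      linarith
    · simp only [Function.comp_apply, c₂, d₂, r₂, Sum.elim_inr]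
      by_cases hk : d' x = k <;> simp [hk]
  · have h1 := HasSum.sum (f := fun x => c₂ x * u ^ d₂ x * Real.exp (-(r₂ x * u ^ 2)))
      (summable_coeff_mul hN hC hr hs hu).hasSum
      ((summable_coeff_mul hN' hC' hr' hs' hu).hasSum.neg.congr_fun fun x => ?_)
    · rw [h1.tsum_eq, h u hu, add_neg_cancel]
    · simp only [Function.comp_apply, c₂, d₂, r₂, Sum.elim_inr]
      ring

end Uniqueness

/-! ### Lengths of closed geodesics -/

section Geodesics

variable {n : ℕ}

/-- `B - Id` maps onto the orthogonal complement of `ker (B - Id)`. -/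
theorem exists_apply_sub_eq (B : O n) {w : E n} (hw : projFixed B w = 0) : ∃ x, B x - x = w := by
  let T : E n →ₗ[ℝ] E n := (B.toLinearEquiv : E n →ₗ[ℝ] E n) - LinearMap.id
  have hle : (LinearMap.range T)ᗮ ≤ fixedSpace B := by
    intro y hy
    rw [mem_fixedSpace]
    have h : ∀ x, ⟪B x, y⟫ = ⟪x, y⟫ := fun x => by
      have h1 := (Submodule.mem_orthogonal _ _).1 hy (T x) ⟨x, rfl⟩
      have h2 : T x = B x - x := rfl
      rw [h2, inner_sub_left, sub_eq_zero] at h1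
      exact h1
    refine ext_inner_left ℝ fun x => ?_
    obtain ⟨x, rfl⟩ := B.surjective x
    rw [B.inner_map_map, h]
  have hmem : w ∈ (fixedSpace B)ᗮ := by
    rw [Submodule.mem_orthogonal]
    intro u hu
    have h := inner_projFixed B ⟨u, hu⟩ w
    rw [hw, inner_zero_right] at h
    exact h.symm
  have h := Submodule.orthogonal_le hle hmem
  rw [Submodule.orthogonal_orthogonal] at h
  exact h

/-- The lengths of the closed geodesics are the numbers `‖b₊‖`: the geodesics closed up by
`γ = B L_b` have direction `b₊`. -/
theorem IsBieberbach.mem_geodesicLengths {Γ : Subgroup (Isom n)} (hΓ : IsBieberbach Γ) {l : ℝ} :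
    l ∈ geodesicLengths Γ ↔
      ∃ γ ∈ Γ, ‖fixedProj (linearPart n γ) (transPart γ)‖ = l := by
  constructor
  · rintro ⟨x, v, h, rfl⟩
    have hcount : (Γ : Set (Isom n)).Countable := by
      refine (Set.countable_iUnion fun k : ℕ => (hΓ.finite_ball k).countable).mono fun γ hγ => ?_
      obtain ⟨k, hk⟩ := exists_nat_ge ‖γ 0‖
      exact Set.mem_iUnion.2 ⟨k, hγ, hk⟩
    -- uncountably many parameters share the same group element, which is affine
    choose g hg hgx using h
    have hninj : ¬ Function.Injective fun t => (⟨g t, hg t⟩ : Γ) := by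
      intro hinj
      have : Countable Γ := hcount.to_subtype
      exact not_countable (α := ℝ) hinj.countable
    simp only [Function.Injective, not_forall] at hninj
    obtain ⟨t, t', hgt, hne⟩ := hninj
    have hgt : g t = g t' := congrArg Subtype.val hgt
    have e1 := hgx t
    have e2 := hgx t'
    rw [← hgt] at e2
    set γ := g t
    have hfix : linearPart n γ v = v := by
      have h1 := apply_sub_apply γ (x + t • v) (x + t' • v)
      rw [e1, e2, add_sub_add_left_eq_sub, add_sub_add_left_eq_sub, ← sub_smul, ← sub_smul,
        map_smul, add_sub_add_right_eq_sub] at h1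
      exact (smul_right_injective _ (sub_ne_zero.2 hne) h1).symm
    refine ⟨γ, hg t, ?_⟩
    have h2 : linearPart n γ (x + t • v + transPart γ) = x + (t + 1) • v := by
      rw [← apply_eq, e1]
    have h3 := congrArg (projFixed (linearPart n γ)) h2
    rw [projFixed_apply, map_add, map_add, map_add, add_smul, one_smul, map_add, add_assoc,
      add_left_cancel_iff, add_left_cancel_iff] at h3
    rw [← coe_projFixed, h3, projFixed_of_mem hfix]
  · rintro ⟨γ, hγ, rfl⟩
    set B := linearPart n γ with hB
    set v := fixedProj B (transPart γ) with hv
    have hBv : B v = v := mem_fixedSpace.1 (projFixed B (transPart γ)).2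
    have hproj : projFixed B (B (v - transPart γ)) = 0 := by
      rw [projFixed_apply, map_sub, sub_eq_zero]
      exact Subtype.ext (projFixed_of_mem hBv)
    obtain ⟨x, hx⟩ := exists_apply_sub_eq B hproj
    refine ⟨x, v, fun t => ⟨γ, hγ, ?_⟩, rfl⟩
    rw [apply_eq, ← hB, map_add, map_add, map_smul, hBv, ← sub_add_cancel (B x) x, hx, map_sub, hBv]
    module

/-- The number `‖λ₊ + b₊‖²`, for `γ = B L_b` and `λ₊ ∈ p_B(Λ)`. -/
def dispSq (Γ : Subgroup (Isom n)) (γ : Isom n)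
    (v : (fixedProj (linearPart n γ) '' (lattice Γ : Set (E n)) : Set (E n))) : ℝ :=
  ‖(v : E n) + fixedProj (linearPart n γ) (transPart γ)‖ ^ 2

theorem heatTerm_eq (Γ : Subgroup (Isom n)) (γ : Isom n) (s : ℝ)
    (v : (fixedProj (linearPart n γ) '' (lattice Γ : Set (E n)) : Set (E n))) :
    heatTerm Γ γ s v = Real.exp (-(dispSq Γ γ v) / (4 * s)) := rfl

/-- The geodesic lengths, through a system of representatives of the holonomy group: the elements
of the class of `B L_b` are the products `B L_b L_λ = B L_{b + λ}`. -/
theorem IsBieberbach.mem_geodesicLengths_iff {Γ : Subgroup (Isom n)} (hΓ : IsBieberbach Γ)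
    (rep : Holonomy Γ → Γ) (hrep : ∀ q, (QuotientGroup.mk (rep q) : Holonomy Γ) = q) {l : ℝ} :
    l ∈ geodesicLengths Γ ↔ 0 ≤ l ∧ ∃ q v, dispSq Γ (rep q) v = l ^ 2 := by
  rw [hΓ.mem_geodesicLengths]
  have key : ∀ (γ : Isom n) (v : E n),
      linearPart n (γ * AffineIsometryEquiv.constVAdd ℝ (E n) v) = linearPart n γ ∧
      transPart (γ * AffineIsometryEquiv.constVAdd ℝ (E n) v) = v + transPart γ := by
    intro γ v
    have h1 : linearPart n (γ * AffineIsometryEquiv.constVAdd ℝ (E n) v) = linearPart n γ := by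
      rw [map_mul, linearPart_constVAdd, mul_one]
    refine ⟨h1, ?_⟩
    rw [transPart, h1, LinearIsometryEquiv.symm_apply_eq]
    simp [apply_eq γ]
  constructor
  · rintro ⟨γ, hγ, rfl⟩
    refine ⟨norm_nonneg _, QuotientGroup.mk (⟨γ, hγ⟩ : Γ), ?_⟩
    have h := hrep (QuotientGroup.mk (⟨γ, hγ⟩ : Γ))
    set δ := rep (QuotientGroup.mk (⟨γ, hγ⟩ : Γ))
    rw [QuotientGroup.eq, MonoidHom.mem_ker, holonomyHom_apply] at h
    set ε : Isom n := ((δ⁻¹ * ⟨γ, hγ⟩ : Γ) : Isom n) with hε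
    have hεl := eq_constVAdd_of_linearPart_eq_one h
    have hmem : ε 0 ∈ lattice Γ := apply_zero_mem_lattice (δ⁻¹ * ⟨γ, hγ⟩ : Γ).2 h
    have hγε : γ = δ * AffineIsometryEquiv.constVAdd ℝ (E n) (ε 0) := by
      rw [← hεl, hε]
      simp
    refine ⟨⟨fixedProj (linearPart n δ) (ε 0), ε 0, hmem, rfl⟩, ?_⟩
    rw [dispSq, hγε, (key _ _).1, (key _ _).2, map_add]
  · rintro ⟨hl, q, ⟨_, v, hv, rfl⟩, h⟩
    refine ⟨rep q * AffineIsometryEquiv.constVAdd ℝ (E n) v, Γ.mul_mem (rep q).2 hv, ?_⟩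
    rw [dispSq] at h
    rw [(key _ _).1, (key _ _).2, map_add]
    exact (pow_left_inj₀ (norm_nonneg _) hl two_ne_zero).1 h

end Geodesics

/-! ### Comparison of heat traces -/

section HeatPart

variable {n : ℕ} {Γ : Subgroup (Isom n)}

/-- The contribution of `γ = B L_b` to the heat trace at time `s`, up to the factor
`|F|⁻¹ tr τ(B)`. -/
def heatPart (Γ : Subgroup (Isom n)) (γ : Isom n) (s : ℝ) : ℝ :=
  (latticeVol (fixedLattice (dualLattice (lattice Γ)) (linearPart n γ)))⁻¹ *
    (4 * Real.pi * s) ^ (-(fixedDim (linearPart n γ) : ℝ) / 2) * ∑' v, heatTerm Γ γ s v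

/-- For large times each class in `F` contributes only its zero frequency. -/
theorem IsBieberbach.tendsto_heatPart (hΓ : IsBieberbach Γ) {γ : Isom n} (hγ : γ ∈ Γ) :
    Tendsto (heatPart Γ γ) atTop (𝓝 1) := by
  have := hΓ.discreteTopology_projLattice hγ
  have := hΓ.isZLattice_projLattice (linearPart n γ)
  have h := tendsto_tsum_dual_gaussian (dualOf (projLattice Γ (linearPart n γ)))
    (projFixed _ (transPart γ))
  have h1 : Tendsto (fun s => (heatPart Γ γ s : ℂ)) atTop (𝓝 ((1 : ℝ) : ℂ)) := by
    rw [Complex.ofReal_one]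
    refine h.congr' ?_
    filter_upwards [eventually_gt_atTop 0] with s hs
    rw [(hasSum_poisson (projLattice Γ (linearPart n γ)) hs (projFixed _ (transPart γ))).tsum_eq]
    have e : ∑' v, heatTerm Γ γ s v = ∑' w : projLattice Γ (linearPart n γ),
        Real.exp (-((4 * s)⁻¹ * ‖(w : fixedSpace (linearPart n γ)) +
          projFixed (linearPart n γ) (transPart γ)‖ ^ 2)) := by
      rw [← (projLatticeEquiv Γ (linearPart n γ)).tsum_eq]
      exact tsum_congr fun w => heatTerm_projLatticeEquiv s w
    rw [heatPart, e, ← dualOf_projLattice]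
    rfl
  have h2 := (Complex.continuous_re.tendsto _).comp h1
  exact h2

theorem fixedDim_le (B : O n) : fixedDim B ≤ n :=
  (Submodule.finrank_le _).trans (finrank_euclideanSpace_fin (𝕜 := ℝ)).le

theorem fixedDim_eq_iff {B : O n} : fixedDim B = n ↔ B = 1 := by
  constructor
  · intro h
    have htop : fixedSpace B = ⊤ :=
      Submodule.eq_top_of_finrank_eq (h.trans (finrank_euclideanSpace_fin (𝕜 := ℝ)).symm)
    ext1 x
    exact mem_fixedSpace.1 (htop ▸ Submodule.mem_top)
  · rintro rfl
    have htop : fixedSpace (1 : O n) = ⊤ := eq_top_iff.2 fun x _ => mem_fixedSpace.2 rfl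
    rw [fixedDim, htop, finrank_top, finrank_euclideanSpace_fin]

/-- The identity contributes the heat trace of the torus `T_Λ`. -/
theorem IsBieberbach.heatPart_one (hΓ : IsBieberbach Γ) {s : ℝ} (hs : 0 < s) :
    heatPart Γ 1 s =
      ∑' v : dualOf (lattice Γ), Real.exp (-(4 * Real.pi ^ 2 * ‖(v : E n)‖ ^ 2 * s)) := by
  have h := hΓ.hasSum_fixedLattice Γ.one_mem hs
  let e : fixedLattice (dualLattice (lattice Γ)) (linearPart n 1) ≃ dualOf (lattice Γ) :=
    { toFun := fun v => ⟨(v : fixedSpace (linearPart n 1)), by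
        rw [← dualLattice_eq_dualOf]; exact v.2⟩
      invFun := fun v => ⟨⟨v, by rw [mem_fixedSpace, map_one]; rfl⟩,
        (SetLike.ext_iff.1 (dualLattice_eq_dualOf (lattice Γ)) (v : E n)).2 v.2⟩
      left_inv := fun v => rfl
      right_inv := fun v => rfl }
  have h0 : transPart (1 : Isom n) = 0 := by
    exact (LinearIsometryEquiv.symm_apply_eq _).2 (map_zero (linearPart n 1)).symm
  have h1 := h.tsum_eq
  rw [← heatPart, ← e.symm.tsum_eq] at h1
  have h2 := congrArg Complex.re h1
  rw [Complex.ofReal_re] at h2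
  rw [← h2, ← Complex.ofReal_re (∑' v : dualOf (lattice Γ), _), Complex.ofReal_tsum]
  congr 1
  refine tsum_congr fun v => ?_
  rw [h0, chr_zero, one_mul]
  rfl

variable {V : Type*} [NormedAddCommGroup V] [NormedSpace ℂ V]

/-- The coefficient `|F|⁻¹ Re tr τ(B)` of the contribution of `B L_b` to the heat trace. -/
def traceCoef (τ : Representation ℂ (O n) V) (Γ : Subgroup (Isom n)) (γ : Isom n) : ℝ :=
  (Nat.card (Holonomy Γ) : ℝ)⁻¹ * (LinearMap.trace ℂ V (τ (linearPart n γ))).re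

/-- The real part of the heat trace formula. -/
theorem IsBieberbach.hasSum_heatTrace_re (hΓ : IsBieberbach Γ) [FiniteDimensional ℂ V]
    [Fintype (Holonomy Γ)] (τ : Representation ℂ (O n) V)
    (rep : Holonomy Γ → Γ) (hrep : ∀ q, (QuotientGroup.mk (rep q) : Holonomy Γ) = q) {s : ℝ}
    (hs : 0 < s) :
    HasSum (fun μ : NNReal => (dmult τ Γ μ : ℝ) * Real.exp (-(4 * Real.pi ^ 2 * μ * s)))
      (∑ q, traceCoef τ Γ (rep q) * heatPart Γ (rep q) s) := by
  have h := Complex.hasSum_re (hΓ.hasSum_heatTrace τ rep hrep hs)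
  rw [finsum_eq_sum_of_fintype, Finset.mul_sum, Complex.re_sum] at h
  have e : (∑ q, traceCoef τ Γ (rep q) * heatPart Γ (rep q) s) =
      ∑ q, ((Nat.card (Holonomy Γ) : ℂ)⁻¹ * (LinearMap.trace ℂ V (τ (linearPart n (rep q))) *
        (heatPart Γ (rep q) s : ℂ))).re := by
    refine Finset.sum_congr rfl fun q _ => ?_
    rw [← mul_assoc, Complex.re_mul_ofReal, traceCoef, ← Complex.ofReal_natCast,
      ← Complex.ofReal_inv, Complex.re_ofReal_mul]
  rw [e]
  refine Eq.mp ?_ h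
  congr 1
  ext μ
  rw [Complex.re_mul_ofReal, Complex.natCast_re]

end HeatPart

section Expansion

variable {n : ℕ} {Γ : Subgroup (Isom n)} {V : Type*} [NormedAddCommGroup V] [NormedSpace ℂ V]

theorem dispSq_nonneg (γ : Isom n)
    (v : (fixedProj (linearPart n γ) '' (lattice Γ : Set (E n)) : Set (E n))) :
    0 ≤ dispSq Γ γ v := sq_nonneg _

/-- Indices of the full heat expansion: a class in `F` and a vector of `p_B(Λ)`. -/
abbrev HeatIndex (rep : Holonomy Γ → Γ) :=
  Σ q : Holonomy Γ, (fixedProj (linearPart n (rep q)) '' (lattice Γ : Set (E n)) : Set (E n))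

theorem summable_sigma_of_finite {ι : Type*} [Finite ι] {β : ι → Type*} {f : (Σ i, β i) → ℝ}
    (h : ∀ i, Summable fun x => f ⟨i, x⟩) : Summable f := by
  rw [← summable_abs_iff, summable_sigma_of_nonneg fun x => abs_nonneg _]
  exact ⟨fun i => (h i).abs, Summable.of_finite⟩

theorem IsBieberbach.summable_exp_dispSq (hΓ : IsBieberbach Γ) {γ : Isom n} (hγ : γ ∈ Γ) {t : ℝ}
    (ht : 0 < t) : Summable fun v => Real.exp (-(t * dispSq Γ γ v)) := by
  have h := hΓ.summable_heatTerm hγ (s := (4 * t)⁻¹) (by positivity)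
  refine h.congr fun v => ?_
  rw [heatTerm_eq]
  congr 1
  field_simp

variable (τ : Representation ℂ (O n) V)

/-- The coefficient of the terms of the heat expansion which belong to `γ = B L_b`. -/
def heatCoef (τ : Representation ℂ (O n) V) (Γ : Subgroup (Isom n)) (γ : Isom n) : ℝ :=
  traceCoef τ Γ γ * (latticeVol (fixedLattice (dualLattice (lattice Γ)) (linearPart n γ)))⁻¹

/-- The time `s = (4πu²)⁻¹` turns `(4πs)^(-d/2) exp (-x / 4s)` into `u ^ d exp (-πx u²)`. -/
theorem traceCoef_mul_heatPart {u : ℝ} (hu : 0 < u) (γ : Isom n) :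
    traceCoef τ Γ γ * heatPart Γ γ (4 * Real.pi * u ^ 2)⁻¹ =
      ∑' v, heatCoef τ Γ γ * u ^ fixedDim (linearPart n γ) *
        Real.exp (-(Real.pi * dispSq Γ γ v * u ^ 2)) := by
  have e1 : (4 * Real.pi * (4 * Real.pi * u ^ 2)⁻¹) ^ (-(fixedDim (linearPart n γ) : ℝ) / 2) =
      u ^ fixedDim (linearPart n γ) := by
    have h : 4 * Real.pi * (4 * Real.pi * u ^ 2)⁻¹ = u ^ (-2 : ℝ) := by
      rw [Real.rpow_neg hu.le, Real.rpow_two]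
      have := Real.pi_pos
      field_simp
    rw [h, ← Real.rpow_mul hu.le, ← Real.rpow_natCast]
    congr 1
    ring
  have e2 : ∀ v, heatTerm Γ γ (4 * Real.pi * u ^ 2)⁻¹ v =
      Real.exp (-(Real.pi * dispSq Γ γ v * u ^ 2)) := fun v => by
    rw [heatTerm_eq]
    congr 1
    have := Real.pi_pos
    field_simp
  rw [tsum_mul_left, heatPart, e1, tsum_congr e2, heatCoef]
  ring

theorem IsBieberbach.tsum_heatIndex (hΓ : IsBieberbach Γ) [Fintype (Holonomy Γ)]
    (rep : Holonomy Γ → Γ) {u : ℝ} (hu : 0 < u) :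
    ∑' x : HeatIndex rep, heatCoef τ Γ (rep x.1) * u ^ fixedDim (linearPart n (rep x.1)) *
        Real.exp (-(Real.pi * dispSq Γ (rep x.1) x.2 * u ^ 2)) =
      ∑ q, traceCoef τ Γ (rep q) * heatPart Γ (rep q) (4 * Real.pi * u ^ 2)⁻¹ := by
  have hsum : ∀ q, Summable fun v => heatCoef τ Γ (rep q) * u ^ fixedDim (linearPart n (rep q)) *
      Real.exp (-(Real.pi * dispSq Γ (rep q) v * u ^ 2)) := fun q => by
    have hpi := Real.pi_pos
    refine Summable.mul_left _ ((hΓ.summable_exp_dispSq (rep q).2 (t := Real.pi * u ^ 2)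
      (by positivity)).congr fun v => ?_)
    rw [mul_right_comm]
  have hsig : Summable fun x : HeatIndex rep => heatCoef τ Γ (rep x.1) *
      u ^ fixedDim (linearPart n (rep x.1)) *
        Real.exp (-(Real.pi * dispSq Γ (rep x.1) x.2 * u ^ 2)) := summable_sigma_of_finite hsum
  refine hsig.tsum_sigma.trans ?_
  rw [tsum_fintype]
  exact Finset.sum_congr rfl fun q _ => (traceCoef_mul_heatPart τ hu _).symm

end Expansion

section Comparison

variable {n m : ℕ} {Γ : Subgroup (Isom n)} {Γ' : Subgroup (Isom m)}
  {V V' : Type*} [NormedAddCommGroup V] [NormedSpace ℂ V] [FiniteDimensional ℂ V]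
  [NormedAddCommGroup V'] [NormedSpace ℂ V'] [FiniteDimensional ℂ V']
  {τ : Representation ℂ (O n) V} {τ' : Representation ℂ (O m) V'}
  [Fintype (Holonomy Γ)] [Fintype (Holonomy Γ')]

/-- Equal spectra have equal heat expansions: for each `k`, the classes `B L_b` in `F` with
`n_B = k` contribute the same weighted distribution of the numbers `‖λ₊ + b₊‖²`. -/
theorem sum_heatCoef_eq (hΓ : IsBieberbach Γ) (hΓ' : IsBieberbach Γ')
    (h : ∀ a, mult τ Γ a = mult τ' Γ' a)
    {rep : Holonomy Γ → Γ} (hrep : ∀ q, (QuotientGroup.mk (rep q) : Holonomy Γ) = q)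
    {rep' : Holonomy Γ' → Γ'} (hrep' : ∀ q, (QuotientGroup.mk (rep' q) : Holonomy Γ') = q)
    (k : ℕ) {g : ℝ → ℝ} (hg : ∀ q, Summable fun v => g (dispSq Γ (rep q) v))
    (hg' : ∀ q, Summable fun v => g (dispSq Γ' (rep' q) v)) :
    ∑ q, (if fixedDim (linearPart n (rep q)) = k then
        heatCoef τ Γ (rep q) * ∑' v, g (dispSq Γ (rep q) v) else 0) =
      ∑ q, (if fixedDim (linearPart m (rep' q)) = k then
        heatCoef τ' Γ' (rep' q) * ∑' v, g (dispSq Γ' (rep' q) v) else 0) := by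
  set C := (∑ q, |heatCoef τ Γ (rep q)|) + ∑ q, |heatCoef τ' Γ' (rep' q)| with hC
  have hC1 : ∀ q, |heatCoef τ Γ (rep q)| ≤ C := fun q =>
    (Finset.single_le_sum (f := fun q => |heatCoef τ Γ (rep q)|) (fun _ _ => abs_nonneg _)
      (Finset.mem_univ q)).trans
      (le_add_of_nonneg_right (Finset.sum_nonneg fun _ _ => abs_nonneg _))
  have hC2 : ∀ q, |heatCoef τ' Γ' (rep' q)| ≤ C := fun q =>
    (Finset.single_le_sum (f := fun q => |heatCoef τ' Γ' (rep' q)|) (fun _ _ => abs_nonneg _)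
      (Finset.mem_univ q)).trans
      (le_add_of_nonneg_left (Finset.sum_nonneg fun _ _ => abs_nonneg _))
  have hgpi : ∀ t, g (Real.pi * t / Real.pi) = g t := fun t => by
    rw [mul_div_cancel_left₀ _ Real.pi_ne_zero]
  have hG : Summable fun x : HeatIndex rep => g (dispSq Γ (rep x.1) x.2) :=
    summable_sigma_of_finite hg
  have hG' : Summable fun x : HeatIndex rep' => g (dispSq Γ' (rep' x.1) x.2) :=
    summable_sigma_of_finite hg'
  have key := tsum_coeff_mul_eq (X := HeatIndex rep) (X' := HeatIndex rep')
    (c := fun x => heatCoef τ Γ (rep x.1)) (c' := fun x => heatCoef τ' Γ' (rep' x.1))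
    (d := fun x => fixedDim (linearPart n (rep x.1)))
    (d' := fun x => fixedDim (linearPart m (rep' x.1)))
    (r := fun x => Real.pi * dispSq Γ (rep x.1) x.2)
    (r' := fun x => Real.pi * dispSq Γ' (rep' x.1) x.2) (N := max n m) (C := C)
    (fun x => (fixedDim_le _).trans (le_max_left _ _))
    (fun x => (fixedDim_le _).trans (le_max_right _ _))
    (fun x => hC1 x.1) (fun x => hC2 x.1)
    (fun x => mul_nonneg Real.pi_pos.le (dispSq_nonneg _ _))
    (fun x => mul_nonneg Real.pi_pos.le (dispSq_nonneg _ _))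
    (summable_sigma_of_finite fun q => hΓ.summable_exp_dispSq (rep q).2 Real.pi_pos)
    (summable_sigma_of_finite fun q => hΓ'.summable_exp_dispSq (rep' q).2 Real.pi_pos)
    (fun u hu => ?_) k (fun t => g (t / Real.pi)) (by simpa only [hgpi] using hG)
    (by simpa only [hgpi] using hG')
  · simp only [hgpi] at key
    rw [(summable_ite_coeff_mul (X := HeatIndex rep) (fun x => hC1 x.1) hG k).tsum_sigma,
      (summable_ite_coeff_mul (X := HeatIndex rep') (fun x => hC2 x.1) hG' k).tsum_sigma,
      tsum_fintype, tsum_fintype] at key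
    refine Eq.trans (Finset.sum_congr rfl fun q _ => ?_)
      (key.trans (Finset.sum_congr rfl fun q _ => ?_))
    · split_ifs
      · exact (tsum_mul_left (α := ℝ)).symm
      · exact (tsum_zero (α := ℝ)).symm
    · split_ifs
      · refine Eq.symm ?_
        exact (tsum_mul_left (α := ℝ)).symm
      · exact tsum_zero
  · have hu0 : 0 < u := by linarith
    have hs : 0 < (4 * Real.pi * u ^ 2)⁻¹ := by positivity
    rw [hΓ.tsum_heatIndex τ rep hu0, hΓ'.tsum_heatIndex τ' rep' hu0]
    have h1 := hΓ.hasSum_heatTrace_re τ rep hrep hs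
    have h2 := hΓ'.hasSum_heatTrace_re τ' rep' hrep' hs
    have e : ∀ μ : ℝ, dmult τ Γ μ = dmult τ' Γ' μ := fun μ => h _
    simp only [e] at h1
    exact h1.unique h2

theorem sum_traceCoef_mul_heatPart_eq (hΓ : IsBieberbach Γ) (hΓ' : IsBieberbach Γ')
    (h : ∀ a, mult τ Γ a = mult τ' Γ' a)
    {rep : Holonomy Γ → Γ} (hrep : ∀ q, (QuotientGroup.mk (rep q) : Holonomy Γ) = q)
    {rep' : Holonomy Γ' → Γ'} (hrep' : ∀ q, (QuotientGroup.mk (rep' q) : Holonomy Γ') = q)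
    (k : ℕ) {s : ℝ} (hs : 0 < s) :
    ∑ q, (if fixedDim (linearPart n (rep q)) = k then
        traceCoef τ Γ (rep q) * heatPart Γ (rep q) s else 0) =
      ∑ q, (if fixedDim (linearPart m (rep' q)) = k then
        traceCoef τ' Γ' (rep' q) * heatPart Γ' (rep' q) s else 0) := by
  have key := sum_heatCoef_eq hΓ hΓ' h hrep hrep' k (g := fun t => Real.exp (-t / (4 * s)))
    (fun q => hΓ.summable_heatTerm (rep q).2 hs) (fun q => hΓ'.summable_heatTerm (rep' q).2 hs)
  have key := congrArg (fun t => (4 * Real.pi * s) ^ (-(k : ℝ) / 2) * t) key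
  simp only [Finset.mul_sum] at key
  refine Eq.trans (Finset.sum_congr rfl fun q _ => ?_)
    (key.trans (Finset.sum_congr rfl fun q _ => ?_))
  · split_ifs with hk
    · rw [heatCoef, heatPart, hk]
      simp only [heatTerm_eq]
      ring
    · rw [mul_zero]
  · split_ifs with hk
    · rw [heatCoef, heatPart, hk]
      simp only [heatTerm_eq]
      ring
    · rw [mul_zero]

/-- The limit of the heat expansions for large times. -/
theorem sum_traceCoef_eq (hΓ : IsBieberbach Γ) (hΓ' : IsBieberbach Γ')
    (h : ∀ a, mult τ Γ a = mult τ' Γ' a)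
    {rep : Holonomy Γ → Γ} (hrep : ∀ q, (QuotientGroup.mk (rep q) : Holonomy Γ) = q)
    {rep' : Holonomy Γ' → Γ'} (hrep' : ∀ q, (QuotientGroup.mk (rep' q) : Holonomy Γ') = q)
    (k : ℕ) :
    ∑ q, (if fixedDim (linearPart n (rep q)) = k then traceCoef τ Γ (rep q) else 0) =
      ∑ q, (if fixedDim (linearPart m (rep' q)) = k then traceCoef τ' Γ' (rep' q) else 0) := by
  have h1 : Tendsto (fun s => ∑ q, (if fixedDim (linearPart n (rep q)) = k then
      traceCoef τ Γ (rep q) * heatPart Γ (rep q) s else 0)) atTop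
      (𝓝 (∑ q, (if fixedDim (linearPart n (rep q)) = k then traceCoef τ Γ (rep q) else 0))) := by
    refine tendsto_finsetSum _ fun q _ => ?_
    split_ifs
    · simpa using (hΓ.tendsto_heatPart (rep q).2).const_mul (traceCoef τ Γ (rep q))
    · exact tendsto_const_nhds
  have h2 : Tendsto (fun s => ∑ q, (if fixedDim (linearPart m (rep' q)) = k then
      traceCoef τ' Γ' (rep' q) * heatPart Γ' (rep' q) s else 0)) atTop
      (𝓝 (∑ q, (if fixedDim (linearPart m (rep' q)) = k then traceCoef τ' Γ' (rep' q) else 0))) := by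
    refine tendsto_finsetSum _ fun q _ => ?_
    split_ifs
    · simpa using (hΓ'.tendsto_heatPart (rep' q).2).const_mul (traceCoef τ' Γ' (rep' q))
    · exact tendsto_const_nhds
  refine tendsto_nhds_unique (h1.congr' ?_) h2
  filter_upwards [eventually_gt_atTop 0] with s hs
  exact sum_traceCoef_mul_heatPart_eq hΓ hΓ' h hrep hrep' k hs

end Comparison

/-! ### What the spectrum determines -/

section Representatives

variable {n : ℕ} {Γ : Subgroup (Isom n)}

theorem exists_representatives (Γ : Subgroup (Isom n)) : ∃ rep : Holonomy Γ → Γ,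
    (∀ q, (QuotientGroup.mk (rep q) : Holonomy Γ) = q) ∧ rep 1 = 1 := by
  classical
  refine ⟨Function.update Quotient.out 1 1, fun q => ?_, Function.update_self _ _ _⟩
  by_cases hq : q = 1
  · rw [hq, Function.update_self]
    rfl
  · rw [Function.update_of_ne hq]
    exact Quotient.out_eq q

theorem linearPart_rep {rep : Holonomy Γ → Γ}
    (hrep : ∀ q, (QuotientGroup.mk (rep q) : Holonomy Γ) = q) (q : Holonomy Γ) :
    linearPart n (rep q) = holonomyLin Γ q := by
  rw [← holonomyLin_mk, hrep]

/-- Only the trivial class of `F` fixes all of `ℝⁿ`. -/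
theorem sum_ite_fixedDim_eq [Fintype (Holonomy Γ)] {rep : Holonomy Γ → Γ}
    (hrep : ∀ q, (QuotientGroup.mk (rep q) : Holonomy Γ) = q) (f : Holonomy Γ → ℝ) :
    ∑ q, (if fixedDim (linearPart n (rep q)) = n then f q else 0) = f 1 := by
  rw [Finset.sum_eq_single 1]
  · rw [if_pos]
    rw [fixedDim_eq_iff, linearPart_rep hrep, map_one]
  · intro q _ hq
    rw [if_neg]
    rw [fixedDim_eq_iff, linearPart_rep hrep]
    exact fun h => hq (holonomyLin_injective (h.trans (map_one _).symm))
  · exact fun h => absurd (Finset.mem_univ _) h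

end Representatives

section Torus

variable {n : ℕ}

theorem tsum_ite_freqSphere (L : Submodule ℤ (E n)) [DiscreteTopology L] [IsZLattice ℝ L] (a : ℝ) :
    ∑' v : dualOf L, (open Classical in if 4 * Real.pi ^ 2 * ‖(v : E n)‖ ^ 2 = a then (1 : ℝ) else 0) =
      Fintype.card (freqSphere L a) := by
  classical
  let ι : freqSphere L a → dualOf L := fun v => ⟨v, v.2.1⟩
  have hι : Function.Injective ι := fun v w h =>
    Subtype.ext (congrArg (Subtype.val : dualOf L → E n) h)
  have h := hasSum_fintype fun _ : freqSphere L a => (1 : ℝ)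
  have h1 : HasSum (fun v : dualOf L => if 4 * Real.pi ^ 2 * ‖(v : E n)‖ ^ 2 = a then (1 : ℝ) else 0)
      (∑ _ : freqSphere L a, (1 : ℝ)) := by
    rw [← hι.hasSum_iff]
    · refine h.congr_fun fun v => ?_
      simp only [Function.comp_apply, ι]
      rw [if_pos v.2.2]
    · intro v hv
      rw [if_neg]
      exact fun hva => hv ⟨⟨v, v.2, hva⟩, rfl⟩
  rw [h1.tsum_eq]
  simp

/-- The theta function of `Λ*` determines the number of vectors of each length. -/
theorem card_freqSphere_eq {L L' : Submodule ℤ (E n)} [DiscreteTopology L] [IsZLattice ℝ L]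
    [DiscreteTopology L'] [IsZLattice ℝ L']
    (h : ∀ s : ℝ, 0 < s → ∑' v : dualOf L, Real.exp (-(4 * Real.pi ^ 2 * ‖(v : E n)‖ ^ 2 * s)) =
      ∑' v : dualOf L', Real.exp (-(4 * Real.pi ^ 2 * ‖(v : E n)‖ ^ 2 * s))) (a : ℝ) :
    Fintype.card (freqSphere L a) = Fintype.card (freqSphere L' a) := by
  classical
  have hs : ∀ (M : Submodule ℤ (E n)) [DiscreteTopology M] [IsZLattice ℝ M],
      Summable fun v : dualOf M => Real.exp (-(4 * Real.pi ^ 2 * ‖(v : E n)‖ ^ 2)) :=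
    fun M _ _ => summable_gaussian_lattice (dualOf M) (by positivity)
  have hg : ∀ (M : Submodule ℤ (E n)) [DiscreteTopology M] [IsZLattice ℝ M],
      Summable fun v : dualOf M =>
        if 4 * Real.pi ^ 2 * ‖(v : E n)‖ ^ 2 = a then (1 : ℝ) else 0 := fun M _ _ =>
    summable_of_hasFiniteSupport ((finite_of_summable_exp (hs M) a).subset fun v hv => by
      by_contra hne
      exact hv (if_neg fun hva => hne hva.le))
  have key := tsum_coeff_mul_eq (c := fun _ : dualOf L => 1) (c' := fun _ : dualOf L' => 1)
    (d := fun _ => 0) (d' := fun _ => 0) (N := 0) (C := 1)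
    (r := fun v => 4 * Real.pi ^ 2 * ‖(v : E n)‖ ^ 2)
    (r' := fun v => 4 * Real.pi ^ 2 * ‖(v : E n)‖ ^ 2)
    (fun _ => le_rfl) (fun _ => le_rfl) (fun _ => abs_one.le) (fun _ => abs_one.le)
    (fun _ => by positivity) (fun _ => by positivity) (hs L) (hs L')
    (fun u hu => by simpa using h (u ^ 2) (by positivity)) 0
    (fun t => if t = a then 1 else 0) (hg L) (hg L')
  simp only [if_true, one_mul] at key
  rw [tsum_ite_freqSphere, tsum_ite_freqSphere] at key
  exact_mod_cast key

end Torus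

section Determines

variable {n m : ℕ} {V V' : Type*} [NormedAddCommGroup V] [NormedSpace ℂ V] [FiniteDimensional ℂ V]
  [NormedAddCommGroup V'] [NormedSpace ℂ V'] [FiniteDimensional ℂ V']

theorem traceCoef_one (τ : Representation ℂ (O n) V) (Γ : Subgroup (Isom n)) :
    traceCoef τ Γ 1 = (Nat.card (Holonomy Γ) : ℝ)⁻¹ * finrank ℂ V := by
  rw [traceCoef, map_one, map_one, LinearMap.trace_one, Complex.natCast_re]

/-- The largest `n_B` in the heat expansion is the dimension. -/
theorem dim_le_of_mult_eq {Γ : Subgroup (Isom n)} {Γ' : Subgroup (Isom m)} (hΓ : IsBieberbach Γ)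
    (hΓ' : IsBieberbach Γ') [Nontrivial V'] {τ : Representation ℂ (O n) V}
    {τ' : Representation ℂ (O m) V'} (h : ∀ a, mult τ Γ a = mult τ' Γ' a) : m ≤ n := by
  have := hΓ.finite_holonomy
  have := hΓ'.finite_holonomy
  have := Fintype.ofFinite (Holonomy Γ)
  have := Fintype.ofFinite (Holonomy Γ')
  obtain ⟨rep, hrep, -⟩ := exists_representatives Γ
  obtain ⟨rep', hrep', hone'⟩ := exists_representatives Γ'
  have key := sum_traceCoef_eq hΓ hΓ' h hrep hrep' m
  rw [sum_ite_fixedDim_eq hrep' fun q => traceCoef τ' Γ' (rep' q), hone', OneMemClass.coe_one,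
    traceCoef_one] at key
  by_contra! hlt
  rw [Finset.sum_eq_zero fun q _ => if_neg ((fixedDim_le _).trans_lt hlt).ne] at key
  have h1 : (Nat.card (Holonomy Γ') : ℝ)⁻¹ ≠ 0 :=
    inv_ne_zero (Nat.cast_ne_zero.2 Nat.card_pos.ne')
  have h2 : (finrank ℂ V' : ℝ) ≠ 0 := Nat.cast_ne_zero.2 finrank_pos.ne'
  exact mul_ne_zero h1 h2 key.symm

/-- The classes `B L_b` with `n_B = n` contribute the heat trace of the covering torus, with
the coefficient `|F|⁻¹ dim V`. -/
theorem isospectral_translationGroup_of_mult_eq {Γ Γ' : Subgroup (Isom n)} (hΓ : IsBieberbach Γ)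
    (hΓ' : IsBieberbach Γ') [Nontrivial V] (hdim : finrank ℂ V = finrank ℂ V')
    {τ : Representation ℂ (O n) V} {τ' : Representation ℂ (O n) V'}
    (h : ∀ a, mult τ Γ a = mult τ' Γ' a) :
    Isospectral (translationGroup Γ) (translationGroup Γ') ∧
      Nat.card (Holonomy Γ) = Nat.card (Holonomy Γ') := by
  have := hΓ.finite_holonomy
  have := hΓ'.finite_holonomy
  have := Fintype.ofFinite (Holonomy Γ)
  have := Fintype.ofFinite (Holonomy Γ')
  have := hΓ.discreteTopology_lattice
  have := hΓ.isZLattice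
  have := hΓ'.discreteTopology_lattice
  have := hΓ'.isZLattice
  obtain ⟨rep, hrep, hone⟩ := exists_representatives Γ
  obtain ⟨rep', hrep', hone'⟩ := exists_representatives Γ'
  have hV : (finrank ℂ V : ℝ) ≠ 0 := Nat.cast_ne_zero.2 finrank_pos.ne'
  have hF : (Nat.card (Holonomy Γ) : ℝ)⁻¹ ≠ 0 :=
    inv_ne_zero (Nat.cast_ne_zero.2 Nat.card_pos.ne')
  have key := sum_traceCoef_eq hΓ hΓ' h hrep hrep' n
  rw [sum_ite_fixedDim_eq hrep fun q => traceCoef τ Γ (rep q),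
    sum_ite_fixedDim_eq hrep' fun q => traceCoef τ' Γ' (rep' q), hone, hone',
    OneMemClass.coe_one, OneMemClass.coe_one, traceCoef_one, traceCoef_one, ← hdim] at key
  have hcard : Nat.card (Holonomy Γ) = Nat.card (Holonomy Γ') := by
    exact_mod_cast inv_injective (mul_right_cancel₀ hV key)
  refine ⟨fun a => ?_, hcard⟩
  rw [mult_translationGroup, mult_translationGroup,
    card_freqSphere_eq (L := lattice Γ) (L' := lattice Γ')]
  intro s hs
  rw [← hΓ.heatPart_one hs, ← hΓ'.heatPart_one hs]
  have key2 := sum_traceCoef_mul_heatPart_eq hΓ hΓ' h hrep hrep' n hs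
  rw [sum_ite_fixedDim_eq hrep fun q => traceCoef τ Γ (rep q) * heatPart Γ (rep q) s,
    sum_ite_fixedDim_eq hrep' fun q => traceCoef τ' Γ' (rep' q) * heatPart Γ' (rep' q) s, hone,
    hone', OneMemClass.coe_one, OneMemClass.coe_one, traceCoef_one, traceCoef_one, ← hdim,
    ← hcard] at key2
  exact mul_left_cancel₀ (mul_ne_zero hF hV) key2

theorem traceCoef_trivRep (Γ : Subgroup (Isom n)) (γ : Isom n) :
    traceCoef (trivRep n) Γ γ = (Nat.card (Holonomy Γ) : ℝ)⁻¹ := by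
  have h : trivRep n (linearPart n γ) = 1 := rfl
  rw [traceCoef, h, LinearMap.trace_one, finrank_self, Nat.cast_one, Complex.one_re, mul_one]

theorem card_fixedDim_eq_of_isospectral {Γ : Subgroup (Isom n)} {Γ' : Subgroup (Isom m)}
    (hΓ : IsBieberbach Γ) (hΓ' : IsBieberbach Γ') (h : Isospectral Γ Γ') (d : ℕ) :
    Nat.card {q : Holonomy Γ // fixedDim (holonomyLin Γ q) = d} =
      Nat.card {q : Holonomy Γ' // fixedDim (holonomyLin Γ' q) = d} := by
  classical
  obtain rfl : n = m := le_antisymm (dim_le_of_mult_eq hΓ' hΓ fun a => (h a).symm)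
    (dim_le_of_mult_eq hΓ hΓ' h)
  have := hΓ.finite_holonomy
  have := hΓ'.finite_holonomy
  have := Fintype.ofFinite (Holonomy Γ)
  have := Fintype.ofFinite (Holonomy Γ')
  obtain ⟨rep, hrep, -⟩ := exists_representatives Γ
  obtain ⟨rep', hrep', -⟩ := exists_representatives Γ'
  have hcard := (isospectral_translationGroup_of_mult_eq hΓ hΓ' rfl h).2
  have hF : (Nat.card (Holonomy Γ) : ℝ)⁻¹ ≠ 0 :=
    inv_ne_zero (Nat.cast_ne_zero.2 Nat.card_pos.ne')
  have key := sum_traceCoef_eq hΓ hΓ' h hrep hrep' d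
  simp only [traceCoef_trivRep, linearPart_rep hrep, linearPart_rep hrep', ← Finset.sum_filter,
    Finset.sum_const, nsmul_eq_mul, ← hcard] at key
  have key2 := mul_right_cancel₀ hF key
  rw [Nat.card_eq_fintype_card, Nat.card_eq_fintype_card, Fintype.card_subtype,
    Fintype.card_subtype]
  exact_mod_cast key2

theorem geodesicLengths_subset_of_isospectral {Γ : Subgroup (Isom n)} {Γ' : Subgroup (Isom m)}
    (hΓ : IsBieberbach Γ) (hΓ' : IsBieberbach Γ') (h : Isospectral Γ Γ') :
    geodesicLengths Γ ⊆ geodesicLengths Γ' := by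
  classical
  have := hΓ.finite_holonomy
  have := hΓ'.finite_holonomy
  have := Fintype.ofFinite (Holonomy Γ)
  have := Fintype.ofFinite (Holonomy Γ')
  obtain ⟨rep, hrep, -⟩ := exists_representatives Γ
  obtain ⟨rep', hrep', -⟩ := exists_representatives Γ'
  intro l hl
  rw [hΓ.mem_geodesicLengths_iff rep hrep] at hl
  rw [hΓ'.mem_geodesicLengths_iff rep' hrep']
  obtain ⟨hl, q₀, v₀, hv₀⟩ := hl
  refine ⟨hl, ?_⟩
  let g : ℝ → ℝ := fun t => if t = l ^ 2 then 1 else 0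
  have hg0 : ∀ t, 0 ≤ g t := fun t => by
    simp only [g]; split_ifs <;> norm_num
  have hg : ∀ {k : ℕ} {Δ : Subgroup (Isom k)}, IsBieberbach Δ → ∀ γ ∈ Δ,
      Summable fun v => g (dispSq Δ γ v) := fun hΔ γ hγ => by
    have h1 := hΔ.summable_exp_dispSq hγ one_pos
    simp only [one_mul] at h1
    exact summable_of_hasFiniteSupport ((finite_of_summable_exp h1 (l ^ 2)).subset fun v hv => by
      by_contra hne
      exact hv (if_neg fun hva => hne hva.le))
  have hcoef : ∀ {q}, 0 < heatCoef (trivRep n) Γ (rep q) := fun {q} => by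
    rw [heatCoef, traceCoef_trivRep]
    exact mul_pos (inv_pos.2 (Nat.cast_pos.2 Nat.card_pos))
      (inv_pos.2 (hΓ.latticeVol_pos (rep q).2))
  have key := sum_heatCoef_eq hΓ hΓ' h hrep hrep' (fixedDim (linearPart n (rep q₀)))
    (fun q => hg hΓ _ (rep q).2) (fun q => hg hΓ' _ (rep' q).2)
  by_contra! hno
  have hzero : ∀ q, ∑' v, g (dispSq Γ' (rep' q) v) = 0 := fun q => by
    simp only [g, if_neg (hno q _), tsum_zero]
  simp only [hzero, mul_zero, ite_self, Finset.sum_const_zero] at key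
  rw [Finset.sum_eq_zero_iff_of_nonneg] at key
  · have h1 := key q₀ (Finset.mem_univ _)
    rw [if_pos rfl] at h1
    have h2 := (hg hΓ _ (rep q₀).2).tsum_pos (fun v => hg0 _) v₀
      (by simp only [g]; rw [if_pos hv₀]; exact one_pos)
    exact (mul_pos hcoef h2).ne' h1
  · intro q _
    split_ifs
    · exact mul_nonneg hcoef.le (tsum_nonneg fun v => hg0 _)
    · exact le_rfl

end Determines

section Forms

variable (n p : ℕ)

instance finiteDimensional_forms : FiniteDimensional ℂ (E n [⋀^Fin p]→L[ℝ] ℂ) := by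
  let f : (E n [⋀^Fin p]→L[ℝ] ℂ) →ₗ[ℝ] MultilinearMap ℝ (fun _ : Fin p => E n) ℂ :=
    { toFun := fun η => η.toMultilinearMap
      map_add' := fun _ _ => rfl
      map_smul' := fun _ _ => rfl }
  have hf : Function.Injective f := fun η θ h => by
    ext v
    exact congrArg (fun M : MultilinearMap ℝ (fun _ : Fin p => E n) ℂ => M v) h
  have : FiniteDimensional ℝ (E n [⋀^Fin p]→L[ℝ] ℂ) := FiniteDimensional.of_injective f hf
  exact FiniteDimensional.right ℝ ℂ _

variable {n p}

/-- The form `dx₁ ∧ ⋯ ∧ dx_p` is not zero. -/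
theorem nontrivial_forms (hp : p ≤ n) : Nontrivial (E n [⋀^Fin p]→L[ℝ] ℂ) := by
  let r : E n →L[ℝ] (Fin p → ℝ) :=
    ContinuousLinearMap.pi fun i => EuclideanSpace.proj (Fin.castLE hp i)
  let D : E n [⋀^Fin p]→ₗ[ℝ] ℂ :=
    Complex.ofRealCLM.toLinearMap.compAlternatingMap
      ((Matrix.detRowAlternating (R := ℝ) (n := Fin p)).compLinearMap r.toLinearMap)
  have hD : ∀ v, D v = ((Matrix.det fun i j => v i (Fin.castLE hp j) : ℝ) : ℂ) := fun v => rfl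
  have hcont : Continuous D := by
    have h : Continuous fun v : Fin p → E n => Matrix.det fun i j => v i (Fin.castLE hp j) :=
      Continuous.matrix_det (continuous_pi fun i => continuous_pi fun j => by fun_prop)
    exact Complex.continuous_ofReal.comp h
  let η : E n [⋀^Fin p]→L[ℝ] ℂ := { D with cont := hcont }
  refine ⟨η, 0, fun h => ?_⟩
  have h1 : η (fun j => EuclideanSpace.single (Fin.castLE hp j) 1) = 1 := by
    refine (hD _).trans ?_
    have e : (fun i j => EuclideanSpace.single (Fin.castLE hp i) (1 : ℝ) (Fin.castLE hp j)) =
        (1 : Matrix (Fin p) (Fin p) ℝ) := by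
      ext i j
      simp [Matrix.one_apply, eq_comm]
    rw [e, Matrix.det_one, Complex.ofReal_one]
  rw [h] at h1
  exact zero_ne_one h1

end Forms

end FlatManifold
end

open FlatManifold in
theorem theorem4p1 :
    -- (i) the Poisson summation formula
    (∀ (n : ℕ) (Γ : Subgroup (Isom n)), IsBieberbach Γ →
      ∀ (V : Type*) [NormedAddCommGroup V] [NormedSpace ℂ V] [FiniteDimensional ℂ V]
        (τ : Representation ℂ (O n) V),
      Finite (Holonomy Γ) ∧
      (∀ a : ℝ, FiniteDimensional ℂ (eigenspace τ Γ a)) ∧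
      ∀ rep : Holonomy Γ → Γ, (∀ q, (QuotientGroup.mk (rep q) : Holonomy Γ) = q) →
      ∀ s : ℝ, 0 < s →
        (∀ γ ∈ Γ, Summable (heatTerm Γ γ s)) ∧
        HasSum
          (fun μ : NNReal => (dmult τ Γ μ : ℂ) * (Real.exp (-(4 * Real.pi ^ 2 * μ * s)) : ℂ))
          ((Nat.card (Holonomy Γ) : ℂ)⁻¹ * ∑ᶠ q : Holonomy Γ,
            LinearMap.trace ℂ V (τ (linearPart n (rep q))) *
              (((latticeVol (fixedLattice (dualLattice (lattice Γ)) (linearPart n (rep q))))⁻¹ *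
                (4 * Real.pi * s) ^ (-(fixedDim (linearPart n (rep q)) : ℝ) / 2) *
                ∑' v, heatTerm Γ (rep q) s v : ℝ) : ℂ))) ∧
    -- (ii) the spectrum on functions determines the lengths of closed geodesics and the `n_B`
    (∀ (n m : ℕ) (Γ : Subgroup (Isom n)) (Γ' : Subgroup (Isom m)),
      IsBieberbach Γ → IsBieberbach Γ' → Isospectral Γ Γ' →
        geodesicLengths Γ = geodesicLengths Γ' ∧
        ∀ d : ℕ, Nat.card {q : Holonomy Γ // fixedDim (holonomyLin Γ q) = d} =
          Nat.card {q : Holonomy Γ' // fixedDim (holonomyLin Γ' q) = d}) ∧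
    -- (iii) the `τ`-spectrum determines the spectrum of the covering torus and `|F|`
    (∀ (n : ℕ) (V : Type*) [NormedAddCommGroup V] [NormedSpace ℂ V] [FiniteDimensional ℂ V]
      [Nontrivial V] (τ : Representation ℂ (O n) V) (Γ Γ' : Subgroup (Isom n)),
      IsBieberbach Γ → IsBieberbach Γ' → TauIsospectral τ Γ Γ' →
        Isospectral (translationGroup Γ) (translationGroup Γ') ∧
        Nat.card (Holonomy Γ) = Nat.card (Holonomy Γ')) ∧
    -- (iii) for the `p`-spectrum, `0 ≤ p ≤ dim`
    (∀ (n m p : ℕ) (Γ : Subgroup (Isom n)) (Γ' : Subgroup (Isom m)), p ≤ n → p ≤ m →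
      IsBieberbach Γ → IsBieberbach Γ' → PIsospectral p Γ Γ' →
        Isospectral (translationGroup Γ) (translationGroup Γ') ∧
        Nat.card (Holonomy Γ) = Nat.card (Holonomy Γ')) := by
  refine ⟨?_, ?_, ?_, ?_⟩
  · intro n Γ hΓ V _ _ _ τ
    have := hΓ.discreteTopology_lattice
    have := hΓ.isZLattice
    exact ⟨hΓ.finite_holonomy, finiteDimensional_eigenspace Γ τ, fun rep hrep s hs =>
      ⟨fun γ hγ => hΓ.summable_heatTerm hγ hs, hΓ.hasSum_heatTrace τ rep hrep hs⟩⟩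
  · intro n m Γ Γ' hΓ hΓ' h
    exact ⟨(geodesicLengths_subset_of_isospectral hΓ hΓ' h).antisymm
      (geodesicLengths_subset_of_isospectral hΓ' hΓ fun a => (h a).symm),
      card_fixedDim_eq_of_isospectral hΓ hΓ' h⟩
  · intro n V _ _ _ _ τ Γ Γ' hΓ hΓ' h
    exact isospectral_translationGroup_of_mult_eq hΓ hΓ' rfl h
  · intro n m p Γ Γ' hn hm hΓ hΓ' h
    have := nontrivial_forms hn
    have := nontrivial_forms hm
    obtain rfl : n = m := le_antisymm (dim_le_of_mult_eq hΓ' hΓ fun a => (h a).symm)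
      (dim_le_of_mult_eq hΓ hΓ' h)
    exact isospectral_translationGroup_of_mult_eq hΓ hΓ' rfl h
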